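/- Alphabets are finite. An \emph{oracle npda} is a one-way one-head nondeterministic pushdown automaton with $\lambda$-moves, reading its input between the endmarkers ¢ and $\$$, that has a write-only query tape, a write-only output tape (each step appends at most one symbol to each of them), sets of accepting and of rejecting (together: halting) states, and three further states $q_{query},q_{yes},q_{no}$: whenever it is in $q_{query}$ with the string $s$ on the query tape, the next state is $q_{yes}$ if $s$ is in the oracle language $A$ and $q_{no}$ otherwise, and the query tape becomes blank. Every such machine is required to satisfy the termination condition: there are $a,b\in\mathbb{N}$ such that, whatever the oracle is, on every input of length $n$ all computation paths reach a halting state within $an+b$ steps. With oracle $A$ the machine recognizes the set of inputs that have an accepting computation path, and it computes the multi-valued partial function that maps $x$ to the set of all strings that are on the output tape at the end of an accepting computation path on $x$. For a family $\mathcal{C}$ of languages, let $\mathrm{CFL}_T(\mathcal{C})$ be the family of languages recognized by oracle npda's (without output tape) with an oracle from $\mathcal{C}$, and let $\mathrm{CFLMV}_T(\mathcal{C})$ be the class of multi-valued partial functions computed by oracle npda's with an oracle from $\mathcal{C}$. Let $\Sigma^{\mathrm{CFL}}_1$ be the family of context-free languages and, for $k\ge 1$, let $\Pi^{\mathrm{CFL}}_k$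 be the family of the complements of the languages in $\Sigma^{\mathrm{CFL}}_k$ and $\Sigma^{\mathrm{CFL}}_{k+1}=\mathrm{CFL}_T(\Pi^{\mathrm{CFL}}_k)$. For $k\ge 2$, let $\Sigma^{\mathrm{CFL}}_k\mathrm{SV}_t$ be the class of those functions $f:\Sigma^*\to\mathcal{P}(\Gamma^*)$ in $\mathrm{CFLMV}_T(\Pi^{\mathrm{CFL}}_{k-1})$ (for some alphabets $\Sigma,\Gamma$) that are single-valued and total, i.e. $|f(x)|=1$ for all $x\in\Sigma^*$. For strings $x\in\Sigma^*$ and $y\in\Gamma^*$, let $\left[\begin{smallmatrix}x\\ y\end{smallmatrix}\right]$ be the string of length $\max\{|x|,|y|\}$ over pairs of symbols whose upper track is $x$ and whose lower track is $y$, the shorter of the two being padded at its right end with a new symbol $\#$. For a class $\mathcal{F}$ of functions, $\mathrm{REG}/\!/\mathcal{F}$ is the family of all languages $L$ for which there are a regular language $B$ and a function $h\in\mathcal{F}$ with $L=\{x\mid \exists\, y\in h(x):\ \left[\begin{smallmatrix}x\\ y\end{smallmatrix}\right]\in B\}$. Then, for every $k\ge 3$, \[ \Sigma^{\mathrm{CFL}}_k\cap\Pi^{\mathrm{CFL}}_k=\mathrm{REG}/\!/\Sigma^{\mathrm{CFL}}_k\mathrm{SV}_t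 . \] -/

import Mathlib

/-- Symbols on a read-only input tape over the alphabet `α`: the left endmarker, the letters
of `α`, the right endmarker. -/
inductive TapeSym (α : Type) : Type
  | left : TapeSym α
  | letter : α → TapeSym α
  | right : TapeSym α

/-- The input tape content `¢ x $`. -/
def inputTape {α : Type} (x : List α) : List (TapeSym α) :=
  TapeSym.left :: (x.map TapeSym.letter ++ [TapeSym.right])

/-- A one-way nondeterministic pushdown automaton with input alphabet `α`, a write-only query
tape over `Ω` and a write-only output tape over `Γ`.  A transition depends on the inner state,
on the scanned input symbol (`none` for a `λ`-move) and on the topmost stack symbol; it gives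
the next state, the word that replaces the topmost stack symbol, and at most one symbol to be
appended to the query tape and to the output tape.  Values of `δ` at halting states and at the
query state are never used. -/
structure OracleNPDA (α Ω Γ : Type) where
  State : Type
  Stack : Type
  finite_state : Finite State
  finite_stack : Finite Stack
  δ : State → Option (TapeSym α) → Stack → Set (State × List Stack × Option Ω × Option Γ)
  finite_δ : ∀ q s a, (δ q s a).Finite
  start : State
  bottom : Stack
  acc : Set State
  rej : Set State
  acc_rej_disjoint : Disjoint acc rej
  query : State
  yes : State
  no : State
  query_not_acc : query ∉ acc
  query_not_rej : query ∉ rej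
  query_ne_yes : query ≠ yes
  query_ne_no : query ≠ no
  yes_ne_no : yes ≠ no

namespace OracleNPDA

variable {α Ω Γ : Type}

/-- A configuration: inner state, unread part of the input tape, stack (topmost symbol first),
contents of the query tape and of the output tape. -/
structure Cfg (M : OracleNPDA α Ω Γ) where
  state : M.State
  input : List (TapeSym α)
  stack : List M.Stack
  queryTape : List Ω
  output : List Γ

/-- The initial configuration on input `x`. -/
def init (M : OracleNPDA α Ω Γ) (x : List α) : M.Cfg :=
  ⟨M.start, inputTape x, [M.bottom], [], []⟩

/-- Halting states are the accepting and the rejecting ones. -/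
def halt (M : OracleNPDA α Ω Γ) : Set M.State := M.acc ∪ M.rej

/-- One step of `M` with oracle `A`. -/
inductive Step (M : OracleNPDA α Ω Γ) (A : Language Ω) : M.Cfg → M.Cfg → Prop
  | read {q p : M.State} {s : TapeSym α} {w : List (TapeSym α)} {a : M.Stack}
      {u v : List M.Stack} {y : List Ω} {z : List Γ} {b : Option Ω} {c : Option Γ}
      (h_halt : q ∉ M.halt) (h_query : q ≠ M.query) (h : (p, u, b, c) ∈ M.δ q (some s) a) :
      Step M A ⟨q, s :: w, a :: v, y, z⟩ ⟨p, w, u ++ v, y ++ b.toList, z ++ c.toList⟩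
  | silent {q p : M.State} {w : List (TapeSym α)} {a : M.Stack}
      {u v : List M.Stack} {y : List Ω} {z : List Γ} {b : Option Ω} {c : Option Γ}
      (h_halt : q ∉ M.halt) (h_query : q ≠ M.query) (h : (p, u, b, c) ∈ M.δ q none a) :
      Step M A ⟨q, w, a :: v, y, z⟩ ⟨p, w, u ++ v, y ++ b.toList, z ++ c.toList⟩
  | answerYes {w : List (TapeSym α)} {v : List M.Stack} {y : List Ω} {z : List Γ} (h : y ∈ A) :
      Step M A ⟨M.query, w, v, y, z⟩ ⟨M.yes, w, v, [], z⟩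
  | answerNo {w : List (TapeSym α)} {v : List M.Stack} {y : List Ω} {z : List Γ} (h : y ∉ A) :
      Step M A ⟨M.query, w, v, y, z⟩ ⟨M.no, w, v, [], z⟩

/-- `M.Run A t c d`: with oracle `A`, some computation of exactly `t` steps leads from `c`
to `d`. -/
inductive Run (M : OracleNPDA α Ω Γ) (A : Language Ω) : ℕ → M.Cfg → M.Cfg → Prop
  | refl (c : M.Cfg) : Run M A 0 c c
  | tail {t : ℕ} {c d e : M.Cfg} (h : Run M A t c d) (h' : M.Step A d e) : Run M A (t + 1) c e

/-- The termination condition: no matter what oracle is used, all computation paths reach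
halting states within linearly many steps.  (No computation is longer than the bound, and
none is stuck in a configuration that is not halting.) -/
def Terminates (M : OracleNPDA α Ω Γ) : Prop :=
  ∃ a b : ℕ, ∀ (A : Language Ω) (x : List α) (t : ℕ) (c : M.Cfg), M.Run A t (M.init x) c →
    t ≤ a * x.length + b ∧ (c.state ∈ M.halt ∨ ∃ d, M.Step A c d)

/-- The machine never enters the query state, so that it is an npda without oracle. -/
def QueryFree (M : OracleNPDA α Ω Γ) : Prop :=
  M.start ≠ M.query ∧ ∀ q s a, ∀ r ∈ M.δ q s a, r.1 ≠ M.query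

/-- The language recognized by `M` with oracle `A`. -/
def accepts (M : OracleNPDA α Ω Γ) (A : Language Ω) : Language α :=
  {x | ∃ t c, M.Run A t (M.init x) c ∧ c.state ∈ M.acc}

/-- The set of valid outcomes of `M` with oracle `A` on input `x`, that is, the output strings
produced along accepting computation paths. -/
def outcomes (M : OracleNPDA α Ω Γ) (A : Language Ω) (x : List α) : Set (List Γ) :=
  {z | ∃ t c, M.Run A t (M.init x) c ∧ c.state ∈ M.acc ∧ c.output = z}

end OracleNPDA

/-- Language families: for each (finite) alphabet, a set of languages over it. -/
abbrev LangFamily : Type 1 := ∀ α : Type, Set (Language α)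

/-- Classes of multi-valued partial functions `α* → 𝒫(Γ*)`. -/
abbrev FunClass : Type 1 := ∀ α Γ : Type, Set (List α → Set (List Γ))

/-- The family of context-free languages. -/
def CFL : LangFamily := fun _ => {L | L.IsContextFree}

/-- Complements of the languages of a family. -/
def coFamily (C : LangFamily) : LangFamily := fun α => {L | Lᶜ ∈ C α}

/-- `CFL_T(C)`: the languages recognized by oracle npda's (without output tape) that satisfy
the termination condition, with an oracle from `C`. -/
def CFLT (C : LangFamily) : LangFamily := fun α =>
  {L | ∃ (Ω : Type) (_ : Finite Ω) (A : Language Ω), A ∈ C Ω ∧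
    ∃ M : OracleNPDA α Ω Empty, M.Terminates ∧ L = M.accepts A}

/-- `CFLMV_T(C)`: the multi-valued partial functions computed by oracle npda's that satisfy the
termination condition, with an oracle from `C`. -/
def CFLMVT (C : LangFamily) : FunClass := fun α Γ =>
  {f | ∃ (Ω : Type) (_ : Finite Ω) (A : Language Ω), A ∈ C Ω ∧
    ∃ M : OracleNPDA α Ω Γ, M.Terminates ∧ ∀ x, f x = M.outcomes A x}

/-- `CFLMV`: the multi-valued partial functions computed by npda's (without oracle) that
satisfy the termination condition. The oracle `0` is the empty language; it is never asked. -/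
def CFLMV : FunClass := fun α Γ =>
  {f | ∃ M : OracleNPDA α Empty Γ, M.QueryFree ∧ M.Terminates ∧ ∀ x, f x = M.outcomes 0 x}

/-- The classes `Σ_k^CFL`, `k ≥ 1`; there is no level `0`. -/
def SigmaCFL : ℕ → LangFamily
  | 0 => fun _ => ∅
  | 1 => CFL
  | k + 2 => CFLT (coFamily (SigmaCFL (k + 1)))

/-- The classes `Π_k^CFL`, `k ≥ 1`. -/
def PiCFL (k : ℕ) : LangFamily := coFamily (SigmaCFL k)

/-- The classes `Σ_k^CFL MV`, `k ≥ 1`; there is no level `0`. -/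
def SigmaCFLMV : ℕ → FunClass
  | 0 => fun _ _ => ∅
  | 1 => CFLMV
  | k + 2 => CFLMVT (PiCFL (k + 1))

/-- The classes `Σ_k^CFL SV` of the single-valued (partial) functions. -/
def SigmaCFLSV (k : ℕ) : FunClass := fun α Γ =>
  {f | f ∈ SigmaCFLMV k α Γ ∧ ∀ x, (f x).Subsingleton}

/-- The classes `Σ_k^CFL SV_t` of the single-valued total functions. -/
def SigmaCFLSVt (k : ℕ) : FunClass := fun α Γ =>
  {f | f ∈ SigmaCFLSV k α Γ ∧ ∀ x, (f x).Nonempty}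

/-- The two-track string of `x` (upper track) and `y` (lower track), where the shorter one is
padded at its end with the new symbol `#`, here `none`. -/
def track {α Γ : Type} (x : List α) (y : List Γ) : List (Option α × Option Γ) :=
  List.zipWithAll Prod.mk x y

/-- `REG // F`. -/
def RegAdvice (F : FunClass) : LangFamily := fun α =>
  {L | ∃ (Γ : Type) (_ : Finite Γ) (B : Language (Option α × Option Γ))
    (h : List α → Set (List Γ)), B.IsRegular ∧ h ∈ F α Γ ∧ L = {x | ∃ y ∈ h x, track x y ∈ B}}

/-! From left to right: `L` and its complement are both recognized by machines with oracles of level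
`k - 1`. The two oracles are merged into one of the same class by tagging queries (`exists_join`, by
induction on the level, starting from a joined grammar). A machine that guesses which of the two to
run, prefixes every query with the corresponding tag and outputs the number of the guessed machine
has exactly one outcome on each input, namely the truth value of `x ∈ L`. A regular language only
has to look at the first symbol of the lower track.

From right to left: since `h` is single-valued and total, the complement of the language given by
`B` and `h` is the one given by `Bᶜ` and `h`. So it is enough to prove membership in level `k`, and
regular languages are closed under complement. Let `M` compute `h` with an oracle `A`. As `k - 1 ≥
2`, the complement of `A` is recognized by a machine `M'` with an oracle `A'` of level `k - 2`. A
single query to a language `E` of valid certificates then suffices (`recog_advice`): a stackless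
generator copies the input to the query tape, interspersed with guessed symbols, and accepts on a
positive answer (`recog_of_certificates`).

A certificate contains a transcript of an accepting computation of `M`, transcripts of accepting
computations of `M'` on the queries of `M` that are answered negatively, and the two-track word of
input and output. In the transcripts every query is preceded by a label that announces its answer.
Validity of a certificate is a conjunction, so a machine with oracle `A'` recognizes the complement
of `E` by guessing one violated condition (`certificates_compl_recog`): a transcript is not
consistent, which a deterministic pushdown device finds out (`recog_check`), because the transcript
names all moves; two subsequences that ought to agree differ, which a counter and a guessed position
reveal (`recog_queue`); a query of `M` labelled as positive is not in `A`, which is found by running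
`M'` on it (`recog_queries`); a query of `M'` has the wrong label, which is found by asking `A'`. A
negative label in the transcript of `M` needs no such test: it is justified by the accepting
transcript of `M'`. Thus `E` belongs to the class of oracles that level `k` may use, and the linear
time bounds of `M` and `M'` make the certificates linearly long, as the generator requires.

Machines are built in two ways only: a `Prog` is a pushdown device with one query at the end of its
input, and a `Bundle` runs one of several given machines on a segment of its input. Both have
rejecting escape moves everywhere, so that termination reduces to counting steps. -/

namespace OracleNPDA

/-! ### Steps and runs of oracle machines -/

variable {α Ω Γ : Type} {M : OracleNPDA α Ω Γ} {A : Language Ω}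

theorem Step.inversion {c d : M.Cfg} (h : M.Step A c d) :
    (c.state ∉ M.halt ∧ c.state ≠ M.query ∧ ∃ p a u v b o, c.stack = a :: v ∧
      ((∃ s w, c.input = s :: w ∧ (p, u, b, o) ∈ M.δ c.state (some s) a ∧
          d = ⟨p, w, u ++ v, c.queryTape ++ b.toList, c.output ++ o.toList⟩) ∨
        ((p, u, b, o) ∈ M.δ c.state none a ∧
          d = ⟨p, c.input, u ++ v, c.queryTape ++ b.toList, c.output ++ o.toList⟩))) ∨
    (c.state = M.query ∧
      ((c.queryTape ∈ A ∧ d = ⟨M.yes, c.input, c.stack, [], c.output⟩) ∨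
        (c.queryTape ∉ A ∧ d = ⟨M.no, c.input, c.stack, [], c.output⟩))) := by
  cases h with
  | read h1 h2 h3 => exact .inl ⟨h1, h2, _, _, _, _, _, _, rfl, .inl ⟨_, _, rfl, h3, rfl⟩⟩
  | silent h1 h2 h3 => exact .inl ⟨h1, h2, _, _, _, _, _, _, rfl, .inr ⟨h3, rfl⟩⟩
  | answerYes h => exact .inr ⟨rfl, .inl ⟨h, rfl⟩⟩
  | answerNo h => exact .inr ⟨rfl, .inr ⟨h, rfl⟩⟩

theorem Run.trans {s t : ℕ} {c d e : M.Cfg} (h : M.Run A s c d) (h' : M.Run A t d e) :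
    M.Run A (s + t) c e := by
  induction h' with
  | refl => exact h
  | tail _ hs ih => exact (ih h).tail hs

theorem Run.single {c d : M.Cfg} (h : M.Step A c d) : M.Run A 1 c d :=
  (Run.refl c).tail h

theorem Run.cases_head {t : ℕ} {c e : M.Cfg} (h : M.Run A t c e) :
    (t = 0 ∧ c = e) ∨ ∃ s d, t = s + 1 ∧ M.Step A c d ∧ M.Run A s d e := by
  induction h with
  | refl => exact .inl ⟨rfl, rfl⟩
  | tail h hs ih =>
    obtain ⟨rfl, rfl⟩ | ⟨s, d, rfl, h1, h2⟩ := ih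
    · exact .inr ⟨0, _, rfl, hs, .refl _⟩
    · exact .inr ⟨s + 1, d, rfl, h1, h2.tail hs⟩

end OracleNPDA

/-! ### Pushdown programs with one query at the end of the input -/

instance TapeSym.instFinite {α : Type} [Finite α] : Finite (TapeSym α) :=
  Finite.of_injective
    (fun s : TapeSym α => match s with
      | .left => (none : Option (Option α))
      | .letter a => some (some a)
      | .right => some none) (by
    rintro (_ | _ | _) (_ | _ | _) h <;> simp_all)

/-- A pushdown program reading a word of `α`: silent moves lower the rank of the state, and
at the end of the word the query tape is submitted to the oracle, the answer of which together
with the state reached decides on acceptance.  The second argument of `δ` is `none` for silent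
moves, the third is `none` on the empty stack. -/
structure Prog (α Ω : Type) where
  Q : Type
  S : Type
  finite_Q : Finite Q
  finite_S : Finite S
  δ : Q → Option α → Option S → Set (Q × List S × Option Ω)
  finite_δ : ∀ q a s, (δ q a s).Finite
  start : Q
  verdict : Q → Bool → Prop
  rank : Q → ℕ
  rank_lt : ∀ q s r, r ∈ δ q none s → rank r.1 < rank q

namespace Prog

variable {α Ω : Type}

/-- `P.Reach w q v y`: having read `w`, the program `P` can be in state `q` with stack `v` and
query tape `y`. -/
inductive Reach (P : Prog α Ω) : List α → P.Q → List P.S → List Ω → Prop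
  | init : Reach P [] P.start [] []
  | read {w q v y a p u b} (h : Reach P w q v y) (h' : (p, u, b) ∈ P.δ q (some a) v.head?) :
      Reach P (w ++ [a]) p (u ++ v.tail) (y ++ b.toList)
  | silent {w q v y p u b} (h : Reach P w q v y) (h' : (p, u, b) ∈ P.δ q none v.head?) :
      Reach P w p (u ++ v.tail) (y ++ b.toList)

/-- States of the machine executing a program. -/
inductive St (P : Prog α Ω) : Type
  | start | run (q : P.Q) | query | ans (b : Bool) | acc | rej

/-- Stack symbols of the machine executing a program; `cell none` marks the bottom. -/
inductive Sk (P : Prog α Ω) : Type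
  | cell (s : Option P.S) | memo (q : P.Q)

/-- The stack of the machine executing a program. -/
def encStack (P : Prog α Ω) (v : List P.S) : List P.Sk :=
  v.map (fun s => .cell (some s)) ++ [.cell none]

/-- The bottom mark has to be restored when a program works on the empty stack. -/
def refill (P : Prog α Ω) : Option P.S → List P.Sk
  | none => [.cell none]
  | some _ => []

/-- Lets the empty stack be treated like any other: the top cell always carries `v.head?`, and the
bottom mark, if consumed, is put back by `refill`. -/
theorem encStack_eq (P : Prog α Ω) (v : List P.S) :
    ∃ r, P.encStack v = .cell v.head? :: r ∧
      ∀ u : List P.S, u.map (fun s => Sk.cell (some s)) ++ P.refill v.head? ++ r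
        = P.encStack (u ++ v.tail) := by
  cases v with
  | nil => exact ⟨[], rfl, by simp [encStack, refill]⟩
  | cons a v => exact ⟨P.encStack v, rfl, by simp [encStack, refill]⟩

/-- Transitions of the machine executing a program. -/
inductive Trans (P : Prog α Ω) :
    P.St → Option (TapeSym α) → P.Sk → P.St × List P.Sk × Option Ω × Option Empty → Prop
  | start (a) : Trans P .start (some .left) a (.run P.start, [a], none, none)
  | read {q x s p u b} (h : (p, u, b) ∈ P.δ q (some x) s) :
      Trans P (.run q) (some (.letter x)) (.cell s)
        (.run p, u.map (fun s => .cell (some s)) ++ P.refill s, b, none)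
  | silent {q s p u b} (h : (p, u, b) ∈ P.δ q none s) :
      Trans P (.run q) none (.cell s)
        (.run p, u.map (fun s => .cell (some s)) ++ P.refill s, b, none)
  | submit (q a) : Trans P (.run q) (some .right) a (.query, [.memo q, a], none, none)
  | accept {q b} (h : P.verdict q b) : Trans P (.ans b) none (.memo q) (.acc, [], none, none)
  | escape (q a) : Trans P q none a (.rej, [a], none, none)

instance (P : Prog α Ω) : Finite P.St :=
  have := P.finite_Q
  Finite.of_injective
    (fun s : P.St => match s with
      | .start => (.inl 0 : Fin 4 ⊕ P.Q ⊕ Bool)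
      | .run q => .inr (.inl q)
      | .query => .inl 1
      | .ans b => .inr (.inr b)
      | .acc => .inl 2
      | .rej => .inl 3) (by
    rintro (_ | _ | _ | _ | _ | _) (_ | _ | _ | _ | _ | _) h <;> simp_all)

instance (P : Prog α Ω) : Finite P.Sk :=
  have := P.finite_Q
  have := P.finite_S
  Finite.of_injective
    (fun s : P.Sk => match s with
      | .cell s => (.inl s : Option P.S ⊕ P.Q)
      | .memo q => .inr q) (by
    rintro (_ | _) (_ | _) h <;> simp_all)

theorem finite_trans (P : Prog α Ω) (q : P.St) (s : Option (TapeSym α)) (a : P.Sk) :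
    {r | P.Trans q s a r}.Finite := by
  classical
  have hf : ∀ (q : P.Q) (x : Option α) (s : Option P.S),
      ((fun r : P.Q × List P.S × Option Ω => ((.run r.1,
        r.2.1.map (fun s => .cell (some s)) ++ P.refill s, r.2.2, none) :
          P.St × List P.Sk × Option Ω × Option Empty)) '' P.δ q x s).Finite :=
    fun q x s => (P.finite_δ q x s).image _
  have h1 : ({(.run P.start, [a], none, none), (.acc, [], none, none), (.rej, [a], none, none)} :
      Set (P.St × List P.Sk × Option Ω × Option Empty)).Finite := Set.toFinite _
  have h2 : {r | ∃ q', q = .run q' ∧ r = ((.query, [.memo q', a], none, none) :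
      P.St × List P.Sk × Option Ω × Option Empty)}.Finite := by
    have := P.finite_Q
    exact (Set.finite_range (fun q' : P.Q => ((.query, [.memo q', a], none, none) :
      P.St × List P.Sk × Option Ω × Option Empty))).subset (by rintro r ⟨q', _, rfl⟩; simp)
  have h3 : (⋃ (q : P.Q) (t : Option P.S), ((fun r : P.Q × List P.S × Option Ω => ((.run r.1,
        r.2.1.map (fun s => .cell (some s)) ++ P.refill t, r.2.2, none) :
          P.St × List P.Sk × Option Ω × Option Empty)) ''
          P.δ q (match s with | some (.letter x) => some x | _ => none) t)).Finite := by
    have := P.finite_Q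
    have := P.finite_S
    exact Set.finite_iUnion fun q => Set.finite_iUnion fun t => hf q _ t
  refine ((h1.union h2).union h3).subset ?_
  intro r hr
  cases hr with
  | start => simp
  | read h => right; simp only [Set.mem_iUnion]; exact ⟨_, _, _, h, rfl⟩
  | silent h => right; simp only [Set.mem_iUnion]; exact ⟨_, _, _, h, rfl⟩
  | submit q => left; right; exact ⟨_, rfl, rfl⟩
  | accept => simp
  | escape => simp

/-- The machine executing a program. -/
abbrev machine (P : Prog α Ω) : OracleNPDA α Ω Empty where
  State := P.St
  Stack := P.Sk
  finite_state := inferInstance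
  finite_stack := inferInstance
  δ q s a := {r | P.Trans q s a r}
  finite_δ := P.finite_trans
  start := .start
  bottom := .cell none
  acc := {.acc}
  rej := {.rej}
  acc_rej_disjoint := by simp
  query := .query
  yes := .ans true
  no := .ans false
  query_not_acc := by simp
  query_not_rej := by simp
  query_ne_yes := by simp
  query_ne_no := by simp
  yes_ne_no := by simp

theorem not_mem_halt {P : Prog α Ω} {q : P.St} (h : q ≠ .acc) (h' : q ≠ .rej) :
    q ∉ P.machine.halt := by
  rintro (h1 | h1)
  exacts [h h1, h' h1]

/-- The invariant of the computations on `x` of the machine executing a program whose ranks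
are at most `K`; `t` is the number of steps. -/
inductive Inv (P : Prog α Ω) (A : Language Ω) (K : ℕ) (x : List α) : ℕ → P.machine.Cfg → Prop
  | start : Inv P A K x 0 (P.machine.init x)
  | run {t q w r v y} (h : P.Reach w q v y) (hx : x = w ++ r)
      (ht : t + (K + 1) * r.length + P.rank q ≤ 1 + (K + 1) * x.length + K) :
      Inv P A K x t ⟨.run q, r.map .letter ++ [.right], P.encStack v, y, []⟩
  | query {t q v y s} (h : P.Reach x q v y) (ht : t ≤ 2 + (K + 1) * x.length + K) :
      Inv P A K x t ⟨.query, [], .memo q :: s, y, []⟩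
  | ans {t q v y b s} (h : P.Reach x q v y) (hb : b = true ↔ y ∈ A)
      (ht : t ≤ 3 + (K + 1) * x.length + K) :
      Inv P A K x t ⟨.ans b, [], .memo q :: s, [], []⟩
  | acc {t q v y b c} (h : P.Reach x q v y) (hb : b = true ↔ y ∈ A) (hv : P.verdict q b)
      (ht : t ≤ 4 + (K + 1) * x.length + K) (hc : c.state = .acc) : Inv P A K x t c
  | rej {t c} (ht : t ≤ 4 + (K + 1) * x.length + K) (hc : c.state = .rej) : Inv P A K x t c

theorem Inv.bound {P : Prog α Ω} {A : Language Ω} {K : ℕ} {x : List α} {t : ℕ}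
    {c : P.machine.Cfg} (h : P.Inv A K x t c) : t ≤ 4 + (K + 1) * x.length + K := by
  cases h <;> omega

/-- The rejecting `escape` move is available in every non-halting state except the query state,
since the stack is never empty; the query state is left by an answer. -/
theorem Inv.exists_step {P : Prog α Ω} {A : Language Ω} {K : ℕ} {x : List α} {t : ℕ}
    {c : P.machine.Cfg} (h : P.Inv A K x t c) :
    c.state ∈ P.machine.halt ∨ ∃ d, P.machine.Step A c d := by
  cases h with
  | start =>
    exact .inr ⟨_, .silent (M := P.machine) (a := .cell none) (v := []) (not_mem_halt (by nofun) (by nofun))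
      (by nofun) (Trans.escape _ _)⟩
  | run h =>
    obtain ⟨r, hr, -⟩ := P.encStack_eq ‹_›
    rw [hr]
    exact .inr ⟨_, .silent (M := P.machine) (not_mem_halt (by nofun) (by nofun))
      (by nofun)
      (Trans.escape _ _)⟩
  | @query t q v y s h =>
    by_cases hy : y ∈ A
    · exact .inr ⟨_, .answerYes (M := P.machine) hy⟩
    · exact .inr ⟨_, .answerNo (M := P.machine) hy⟩
  | ans h =>
    exact .inr ⟨_, .silent (M := P.machine) (not_mem_halt (by nofun) (by nofun))
      (by nofun)
      (Trans.escape _ _)⟩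
  | acc h _ _ _ hc => exact .inl (.inl hc)
  | rej _ hc => exact .inl (.inr hc)

/-- The bound on running times is a potential argument: reading a letter releases `K + 1` units,
which pay for the step and for the new rank, at most `K`; a silent move is paid by the drop of the
rank. -/
theorem Inv.step {P : Prog α Ω} {A : Language Ω} {K : ℕ} (hK : ∀ q, P.rank q ≤ K) {x : List α}
    {t : ℕ} {c d : P.machine.Cfg} (h : P.Inv A K x t c) (hs : P.machine.Step A c d) :
    P.Inv A K x (t + 1) d := by
  have hs := hs.inversion
  cases h with
  | start =>
    rcases hs with ⟨_, _, p, a, u, v, b, o, hst, h⟩ | ⟨h, _⟩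
    · rcases h with ⟨s, w, hw, hδ, rfl⟩ | ⟨hδ, rfl⟩
      · simp only [OracleNPDA.init, inputTape, List.cons.injEq] at hw hst
        obtain ⟨rfl, rfl⟩ := hw
        obtain ⟨rfl, rfl⟩ := hst
        cases (show P.Trans .start _ _ _ from hδ) with
        | start => exact .run (v := []) .init rfl (by have := hK P.start; omega)
      · cases (show P.Trans .start _ _ _ from hδ) with
        | escape => exact .rej (by omega) rfl
    · exact absurd h (by simp [machine, OracleNPDA.init])
  | @run t q w r v y hR hx ht =>
    rcases hs with ⟨_, _, p, a, u, v', b, o, hst, h⟩ | ⟨h, _⟩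
    · obtain ⟨rs, hrs, hup⟩ := P.encStack_eq v
      simp only [hrs, List.cons.injEq] at hst
      obtain ⟨rfl, rfl⟩ := hst
      rcases h with ⟨s, w', hw, hδ, rfl⟩ | ⟨hδ, rfl⟩
      · cases r with
        | nil =>
          simp only [List.map_nil, List.nil_append, List.cons.injEq] at hw
          obtain ⟨rfl, rfl⟩ := hw
          cases (show P.Trans (.run q) _ _ _ from hδ) with
          | submit =>
            subst hx
            have : P.Reach (w ++ []) q v (y ++ (none : Option Ω).toList) := by simpa using hR
            exact .query this (by simp at ht ⊢; omega)
        | cons a r =>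
          simp only [List.map_cons, List.cons_append, List.cons.injEq] at hw
          obtain ⟨rfl, rfl⟩ := hw
          generalize hs' : v.head? = s' at hδ
          cases (show P.Trans (.run q) _ _ _ from hδ) with
          | read hd =>
            rw [← hs'] at hd ⊢
            have := hR.read hd
            rw [hup]
            refine .run this (by simpa using hx) ?_
            rename_i p _
            have := hK p
            simp only [List.length_cons, Nat.mul_add] at ht
            omega
      · generalize hs' : v.head? = s' at hδ
        cases (show P.Trans (.run q) _ _ _ from hδ) with
        | silent hd =>
          rw [← hs'] at hd ⊢
          have := hR.silent hd
          rw [hup]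
          refine .run this hx ?_
          have := P.rank_lt _ _ _ hd
          simp only at this
          omega
        | escape => exact .rej (by omega) rfl
    · exact absurd h (by simp [machine])
  | @query t q v y s hR ht =>
    rcases hs with ⟨_, h, _⟩ | ⟨_, h⟩
    · exact absurd rfl h
    · rcases h with ⟨h, rfl⟩ | ⟨h, rfl⟩
      · exact .ans (b := true) hR (by simpa using h) (by omega)
      · exact .ans (b := false) hR (by simpa using h) (by omega)
  | @ans t q v y b s hR hb ht =>
    rcases hs with ⟨_, _, p, a, u, v', b, o, hst, h⟩ | ⟨h, _⟩
    · simp only [List.cons.injEq] at hst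
      obtain ⟨rfl, rfl⟩ := hst
      rcases h with ⟨s, w', hw, hδ, rfl⟩ | ⟨hδ, rfl⟩
      · simp at hw
      · cases (show P.Trans (.ans _) _ _ _ from hδ) with
        | accept hv => exact .acc hR hb hv (by omega) rfl
        | escape => exact .rej (by omega) rfl
    · exact absurd h (by simp [machine])
  | acc _ _ _ _ hc =>
    rcases hs with ⟨h, _⟩ | ⟨h, _⟩
    · exact absurd (.inl hc) h
    · rw [hc] at h; exact absurd h (by simp [machine])
  | rej _ hc =>
    rcases hs with ⟨h, _⟩ | ⟨h, _⟩
    · exact absurd (.inr hc) h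
    · rw [hc] at h; exact absurd h (by simp [machine])

theorem inv_of_run {P : Prog α Ω} {A : Language Ω} {K : ℕ} (hK : ∀ q, P.rank q ≤ K) {x : List α}
    {t : ℕ} {c : P.machine.Cfg} (h : P.machine.Run A t (P.machine.init x) c) :
    P.Inv A K x t c := by
  generalize hi : P.machine.init x = i at h
  induction h with
  | refl => subst hi; exact .start
  | tail _ hs ih => exact (ih hi).step hK hs

theorem exists_rank_le (P : Prog α Ω) : ∃ K, ∀ q, P.rank q ≤ K := by
  have := P.finite_Q
  obtain ⟨K, hK⟩ := (Set.finite_range P.rank).bddAbove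
  exact ⟨K, fun q => hK ⟨q, rfl⟩⟩

theorem machine_terminates (P : Prog α Ω) : P.machine.Terminates := by
  obtain ⟨K, hK⟩ := P.exists_rank_le
  refine ⟨K + 1, 4 + K, fun A x t c h => ?_⟩
  have h := inv_of_run hK h
  exact ⟨by have := h.bound; omega, h.exists_step⟩

/-- `Reach` knows nothing of the unread input, so the rest `r` has to be arbitrary for the induction
over `Reach` to work. -/
theorem run_of_reach {P : Prog α Ω} (A : Language Ω) {w : List α} {q : P.Q} {v : List P.S}
    {y : List Ω} (h : P.Reach w q v y) (r : List α) :
    ∃ t, P.machine.Run A t (P.machine.init (w ++ r))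
      ⟨.run q, r.map .letter ++ [.right], P.encStack v, y, []⟩ := by
  induction h generalizing r with
  | init =>
    exact ⟨1, .single (.read (M := P.machine) (a := .cell none) (v := [])
      (not_mem_halt (by nofun) (by nofun))
      (by nofun) (Trans.start _))⟩
  | @read w q v y a p u b h h' ih =>
    obtain ⟨t, ht⟩ := ih (a :: r)
    obtain ⟨rs, hrs, hup⟩ := P.encStack_eq v
    rw [hrs] at ht
    have := ht.tail (.read (M := P.machine) (not_mem_halt (by nofun) (by nofun))
      (by nofun)
      (Trans.read h'))
    rw [hup] at this
    exact ⟨_, by simpa using this⟩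
  | @silent w q v y p u b h h' ih =>
    obtain ⟨t, ht⟩ := ih r
    obtain ⟨rs, hrs, hup⟩ := P.encStack_eq v
    rw [hrs] at ht
    have := ht.tail (.silent (M := P.machine) (not_mem_halt (by nofun) (by nofun))
      (by nofun)
      (Trans.silent h'))
    rw [hup] at this
    exact ⟨_, by simpa using this⟩

theorem mem_accepts_machine {P : Prog α Ω} {A : Language Ω} {x : List α} :
    x ∈ P.machine.accepts A ↔
      ∃ q v y b, P.Reach x q v y ∧ (b = true ↔ y ∈ A) ∧ P.verdict q b := by
  constructor
  · rintro ⟨t, c, h, hc⟩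
    obtain ⟨K, hK⟩ := P.exists_rank_le
    replace hc : c.state = .acc := hc
    cases inv_of_run hK h with
    | acc h hb hv => exact ⟨_, _, _, _, h, hb, hv⟩
    | rej _ hc' => simp [hc] at hc'
    | _ => simp [OracleNPDA.init, machine] at hc
  · rintro ⟨q, v, y, b, h, hb, hv⟩
    obtain ⟨t, ht⟩ := run_of_reach A h []
    obtain ⟨rs, hrs, -⟩ := P.encStack_eq v
    rw [List.append_nil, hrs] at ht
    have ht := ht.tail (.read (M := P.machine) (not_mem_halt (by nofun) (by nofun))
      (by nofun)
      (Trans.submit _ _))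
    have ht : ∃ t, P.machine.Run A t (P.machine.init x)
        ⟨.ans b, [], .memo q :: .cell v.head? :: rs, [], []⟩ := by
      by_cases hy : y ∈ A
      · obtain rfl := hb.2 hy
        exact ⟨_, ht.tail (.answerYes (M := P.machine) (by simpa using hy))⟩
      · obtain rfl : b = false := by simpa [hy] using hb
        exact ⟨_, ht.tail (.answerNo (M := P.machine) (by simpa using hy))⟩
    obtain ⟨t, ht⟩ := ht
    exact ⟨_, _, ht.tail (.silent (M := P.machine) (not_mem_halt (by nofun) (by nofun))
      (by nofun)
      (Trans.accept hv)), rfl⟩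

end Prog

/-! ### Bundles: running one of several machines on a segment of the input -/

/-- How much of an input tape has been read: nothing, the left endmarker, everything. -/
inductive Phase : Type
  | pre | mid | post

instance : Finite Phase :=
  Finite.of_injective (fun p : Phase => match p with | .pre => (0 : Fin 3) | .mid => 1 | .post => 2)
    (by rintro (_ | _ | _) (_ | _ | _) h <;> simp_all)

/-- The letters in a word that `f` yields before it signals an end by `some none`; symbols with
value `none` are skipped. -/
def extract {α β : Type} (f : β → Option (Option α)) : List β → List α
  | [] => []
  | b :: v => match f b with
    | none => extract f v
    | some none => []
    | some (some a) => a :: extract f v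

theorem extract_length_le {α β : Type} (f : β → Option (Option α)) (v : List β) :
    (extract f v).length ≤ v.length := by
  induction v with
  | nil => simp [extract]
  | cons b v ih =>
    rw [extract]
    split <;> simp <;> omega

theorem inputTape_eq_append_left {α : Type} {x : List α} {u r : List (TapeSym α)}
    (h : inputTape x = u ++ .left :: r) : r = x.map .letter ++ [.right] := by
  cases u with
  | nil => simpa [inputTape] using h.symm
  | cons s u =>
    simp only [inputTape, List.cons_append, List.cons.injEq] at h
    have : (TapeSym.left : TapeSym α) ∈ x.map .letter ++ [.right] := by simp [h.2]
    simp at this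

theorem inputTape_eq_append_letter {α : Type} {x : List α} {u r : List (TapeSym α)} {b : α}
    (h : inputTape x = u ++ .letter b :: r) :
    ∃ u' r', x = u' ++ b :: r' ∧ r = r'.map .letter ++ [.right] := by
  cases u with
  | nil => simp [inputTape] at h
  | cons s u =>
    simp only [inputTape, List.cons_append, List.cons.injEq] at h
    replace h := h.2
    rw [List.append_eq_append_iff] at h
    obtain ⟨v, h1, h2⟩ | ⟨v, h1, h2⟩ := h
    · rcases v with _ | ⟨_, v⟩ <;> simp at h2
    · cases v with
      | nil => simp at h2
      | cons s v =>
        simp only [List.cons_append, List.cons.injEq] at h2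
        obtain ⟨rfl, rfl⟩ := h2
        obtain ⟨l1, l2, rfl, rfl, h3⟩ := List.map_eq_append_iff.1 h1
        cases l2 with
        | nil => simp at h3
        | cons c l2 =>
          simp only [List.map_cons, List.cons.injEq, TapeSym.letter.injEq] at h3
          obtain ⟨rfl, rfl⟩ := h3
          exact ⟨l1, l2, rfl, rfl⟩

/-- The state entered after the oracle's answer `b`. -/
def OracleNPDA.reply {α Ω Γ : Type} (M : OracleNPDA α Ω Γ) (b : Bool) : M.State :=
  if b then M.yes else M.no

theorem OracleNPDA.Step.answer {α Ω Γ : Type} {M : OracleNPDA α Ω Γ} {A : Language Ω}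
    {w : List (TapeSym α)} {v : List M.Stack} {y : List Ω} {z : List Γ} {b : Bool}
    (h : b = true ↔ y ∈ A) : M.Step A ⟨M.query, w, v, y, z⟩ ⟨M.reply b, w, v, [], z⟩ := by
  cases b with
  | true => exact .answerYes (h.1 rfl)
  | false => exact .answerNo (by simpa using h)

theorem OracleNPDA.Step.read_eq {α Ω Γ : Type} {M : OracleNPDA α Ω Γ} {A : Language Ω}
    {q p : M.State} {s : TapeSym α} {w : List (TapeSym α)} {a : M.Stack} {u v v' : List M.Stack}
    {y y' : List Ω} {z z' : List Γ} {b : Option Ω} {c : Option Γ} (h_halt : q ∉ M.halt)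
    (h_query : q ≠ M.query) (h : (p, u, b, c) ∈ M.δ q (some s) a) (hv : v' = u ++ v)
    (hy : y' = y ++ b.toList) (hz : z' = z ++ c.toList) :
    M.Step A ⟨q, s :: w, a :: v, y, z⟩ ⟨p, w, v', y', z'⟩ := by
  subst hv hy hz
  exact .read h_halt h_query h

theorem OracleNPDA.Step.silent_eq {α Ω Γ : Type} {M : OracleNPDA α Ω Γ} {A : Language Ω}
    {q p : M.State} {w : List (TapeSym α)} {a : M.Stack} {u v v' : List M.Stack}
    {y y' : List Ω} {z z' : List Γ} {b : Option Ω} {c : Option Γ} (h_halt : q ∉ M.halt)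
    (h_query : q ≠ M.query) (h : (p, u, b, c) ∈ M.δ q none a) (hv : v' = u ++ v)
    (hy : y' = y ++ b.toList) (hz : z' = z ++ c.toList) :
    M.Step A ⟨q, w, a :: v, y, z⟩ ⟨p, w, v', y', z'⟩ := by
  subst hv hy hz
  exact .silent h_halt h_query h

/-- A finite family of machines that can be started, nondeterministically, after the left
endmarker or after certain letters of an input over `β` (`launch`); from then on, the machine
works on the letters that `feed` extracts from the rest of the input.  Its queries are translated
by `emb` and start with the symbol `tag`, and `out` is written on the output tape. -/
structure Bundle (ι : Type) (α Ω : ι → Type) (β Ω' Γ : Type) where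
  M : ∀ i, OracleNPDA (α i) (Ω i) Empty
  launch : ι → Option β → Prop
  feed : ∀ i, β → Option (Option (α i))
  tag : ι → Option Ω'
  emb : ∀ i, Ω i → Ω'
  out : ι → Option Γ

namespace Bundle

variable {ι : Type} {α Ω : ι → Type} {β Ω' Γ : Type}

/-- On input `x`, the machine `i` can be launched with `r` as the rest of the input. -/
def Launches (B : Bundle ι α Ω β Ω' Γ) (i : ι) (x r : List β) : Prop :=
  (B.launch i none ∧ r = x) ∨ ∃ u b, x = u ++ b :: r ∧ B.launch i (some b)

/-- The oracle for the machine `i` that results from an oracle for the bundle. -/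
def oracle (B : Bundle ι α Ω β Ω' Γ) (A : Language Ω') (i : ι) : Language (Ω i) :=
  {w | (B.tag i).toList ++ w.map (B.emb i) ∈ A}

/-- States of the machine executing a bundle. -/
inductive St (B : Bundle ι α Ω β Ω' Γ) : Type
  | idle | sim (i : ι) (ph : Phase) (q : (B.M i).State) | query | ans (b : Bool) | acc | rej

/-- Stack symbols of the machine executing a bundle. -/
inductive Sk (B : Bundle ι α Ω β Ω' Γ) : Type
  | floor | tok (i : ι) (ph : Phase) | sym (i : ι) (a : (B.M i).Stack)

/-- `B.Feed i ph s s' ph'`: if the machine executing the bundle reads `s`, then the simulated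
machine `i` reads `s'`, and the phase changes from `ph` to `ph'`. -/
inductive Feed (B : Bundle ι α Ω β Ω' Γ) (i : ι) :
    Phase → Option (TapeSym β) → Option (TapeSym (α i)) → Phase → Prop
  | silent (ph) : Feed B i ph none none ph
  | left : Feed B i .pre none (some .left) .mid
  | letter {b a} (h : B.feed i b = some (some a)) :
      Feed B i .mid (some (.letter b)) (some (.letter a)) .mid
  | finish {b} (h : B.feed i b = some none) : Feed B i .mid (some (.letter b)) (some .right) .post
  | right : Feed B i .mid (some .right) (some .right) .post

/-- Transitions of the machine executing a bundle. -/
inductive Trans (B : Bundle ι α Ω β Ω' Γ) :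
    B.St → Option (TapeSym β) → B.Sk → B.St × List B.Sk × Option Ω' × Option Γ → Prop
  | wait (s a) : Trans B .idle (some s) a (.idle, [a], none, none)
  | launchLeft {i} (a) (h : B.launch i none) :
      Trans B .idle (some .left) a
        (.sim i .pre (B.M i).start, [.sym i (B.M i).bottom, a], B.tag i, B.out i)
  | launchLetter {i b} (a) (h : B.launch i (some b)) :
      Trans B .idle (some (.letter b)) a
        (.sim i .pre (B.M i).start, [.sym i (B.M i).bottom, a], B.tag i, B.out i)
  | accept {i ph q} (a) (h : q ∈ (B.M i).acc) : Trans B (.sim i ph q) none a (.acc, [a], none, none)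
  | ask (i ph a) : Trans B (.sim i ph (B.M i).query) none a (.query, [.tok i ph, a], none, none)
  | resume (b i ph) :
      Trans B (.ans b) none (.tok i ph) (.sim i ph ((B.M i).reply b), [], B.tag i, none)
  | skip {i b} (q a) (h : B.feed i b = none) :
      Trans B (.sim i .mid q) (some (.letter b)) a (.sim i .mid q, [a], none, none)
  | move {i ph s s' ph' q a p u b o} (hf : B.Feed i ph s s' ph') (h1 : q ∉ (B.M i).halt)
      (h2 : q ≠ (B.M i).query) (h : (p, u, b, o) ∈ (B.M i).δ q s' a) :
      Trans B (.sim i ph q) s (.sym i a) (.sim i ph' p, u.map (.sym i), b.map (B.emb i), none)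
  | escape (q a) : Trans B q none a (.rej, [a], none, none)

instance [Finite ι] (B : Bundle ι α Ω β Ω' Γ) : Finite B.St :=
  have := fun i => (B.M i).finite_state
  Finite.of_injective
    (fun s : B.St => match s with
      | .idle => (.inl 0 : Fin 4 ⊕ (Σ i, Phase × (B.M i).State) ⊕ Bool)
      | .sim i ph q => .inr (.inl ⟨i, ph, q⟩)
      | .query => .inl 1
      | .ans b => .inr (.inr b)
      | .acc => .inl 2
      | .rej => .inl 3) (by
    rintro (_ | _ | _ | _ | _ | _) (_ | _ | _ | _ | _ | _) h <;> simp_all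
    obtain ⟨rfl, h⟩ := h
    simp_all)

instance [Finite ι] (B : Bundle ι α Ω β Ω' Γ) : Finite B.Sk :=
  have := fun i => (B.M i).finite_stack
  Finite.of_injective
    (fun s : B.Sk => match s with
      | .floor => (none : Option ((ι × Phase) ⊕ (Σ i, (B.M i).Stack)))
      | .tok i ph => some (.inl (i, ph))
      | .sym i a => some (.inr ⟨i, a⟩)) (by
    rintro (_ | _ | _) (_ | _ | _) h <;> simp_all)

theorem finite_trans [Finite ι] [∀ i, Finite (α i)] (B : Bundle ι α Ω β Ω' Γ) (q : B.St)
    (s : Option (TapeSym β)) (a : B.Sk) : {r | B.Trans q s a r}.Finite := by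
  have := fun i => (B.M i).finite_state
  have := fun i => (B.M i).finite_stack
  let R := B.St × List B.Sk × Option Ω' × Option Γ
  have h1 : ({(.idle, [a], none, none), (.acc, [a], none, none), (.rej, [a], none, none)} :
      Set R).Finite := Set.toFinite _
  have h2 := Set.finite_range (fun i => ((.sim i .pre (B.M i).start,
    [.sym i (B.M i).bottom, a], B.tag i, B.out i) : R))
  have h3 := Set.finite_range (fun i : ι × Phase => ((.query, [.tok i.1 i.2, a], none, none) : R))
  have h4 := Set.finite_range (fun i : Bool × ι × Phase => ((.sim i.2.1 i.2.2
    ((B.M i.2.1).reply i.1), [], B.tag i.2.1, none) : R))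
  have h5 := Set.finite_range (fun i : Σ i, (B.M i).State =>
    ((.sim i.1 .mid i.2, [a], none, none) : R))
  have h6 : (⋃ (i : ι) (ph : Phase) (q : (B.M i).State) (s : Option (TapeSym (α i)))
      (a : (B.M i).Stack), (fun r : (B.M i).State × List (B.M i).Stack × Option (Ω i) ×
        Option Empty => ((.sim i ph r.1, r.2.1.map (.sym i), r.2.2.1.map (B.emb i), none) : R)) ''
          (B.M i).δ q s a).Finite :=
    Set.finite_iUnion fun i => Set.finite_iUnion fun ph => Set.finite_iUnion fun q =>
      Set.finite_iUnion fun s => Set.finite_iUnion fun a => ((B.M i).finite_δ q s a).image _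
  refine (((((h1.union h2).union h3).union h4).union h5).union h6).subset ?_
  intro r hr
  cases hr with
  | wait => simp
  | launchLeft _ h => exact .inl (.inl (.inl (.inl (.inr ⟨_, rfl⟩))))
  | launchLetter _ h => exact .inl (.inl (.inl (.inl (.inr ⟨_, rfl⟩))))
  | accept => simp
  | ask i ph => exact .inl (.inl (.inl (.inr ⟨(i, ph), rfl⟩)))
  | resume b i ph => exact .inl (.inl (.inr ⟨(b, i, ph), rfl⟩))
  | @skip i b q => exact .inl (.inr ⟨⟨i, q⟩, rfl⟩)
  | move _ _ _ h => right; simp only [Set.mem_iUnion]; exact ⟨_, _, _, _, _, _, h, rfl⟩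
  | escape => simp

/-- The machine executing a bundle. -/
abbrev machine [Finite ι] [∀ i, Finite (α i)] (B : Bundle ι α Ω β Ω' Γ) :
    OracleNPDA β Ω' Γ where
  State := B.St
  Stack := B.Sk
  finite_state := inferInstance
  finite_stack := inferInstance
  δ q s a := {r | B.Trans q s a r}
  finite_δ := B.finite_trans
  start := .idle
  bottom := .floor
  acc := {.acc}
  rej := {.rej}
  acc_rej_disjoint := by simp
  query := .query
  yes := .ans true
  no := .ans false
  query_not_acc := by simp
  query_not_rej := by simp
  query_ne_yes := by simp
  query_ne_no := by simp
  yes_ne_no := by simp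

/-- The correspondence between the input tape of the machine executing a bundle and that of the
simulated machine. -/
inductive Sync (B : Bundle ι α Ω β Ω' Γ) (i : ι) :
    Phase → List (TapeSym β) → List (TapeSym (α i)) → Prop
  | pre (r) : Sync B i .pre (r.map .letter ++ [.right]) (inputTape (extract (B.feed i) r))
  | mid (r) : Sync B i .mid (r.map .letter ++ [.right])
      ((extract (B.feed i) r).map .letter ++ [.right])
  | post (w) : Sync B i .post w []

/-- The endmarkers of the simulated tape need not be physical: the left one is consumed by a silent
move, and the right one is seen at a stopping letter or at the true right endmarker. After that the
rest of the real tape does not matter. -/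
theorem Sync.feed {B : Bundle ι α Ω β Ω' Γ} {i : ι} {ph ph' : Phase} {w w₁ : List (TapeSym β)}
    {w' : List (TapeSym (α i))} {s : Option (TapeSym β)} {s' : Option (TapeSym (α i))}
    (h : B.Sync i ph w w') (hf : B.Feed i ph s s' ph') (hw : w = s.toList ++ w₁) :
    ∃ w₁', w' = s'.toList ++ w₁' ∧ B.Sync i ph' w₁ w₁' := by
  cases hf with
  | silent => exact ⟨w', rfl, by simp_all⟩
  | left =>
    cases h with
    | pre r =>
      refine ⟨_, rfl, ?_⟩
      simp only [Option.toList_none, List.nil_append] at hw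
      rw [← hw]
      exact .mid r
  | letter hb =>
    cases h with
    | mid r =>
      cases r with
      | nil => simp at hw
      | cons x r =>
        simp only [List.map_cons, List.cons_append, Option.toList_some, List.nil_append,
          List.cons.injEq, TapeSym.letter.injEq] at hw
        obtain ⟨rfl, rfl⟩ := hw
        exact ⟨_, by simp [extract, hb], .mid r⟩
  | finish hb =>
    cases h with
    | mid r =>
      cases r with
      | nil => simp at hw
      | cons x r =>
        simp only [List.map_cons, List.cons_append, Option.toList_some, List.nil_append,
          List.cons.injEq, TapeSym.letter.injEq] at hw
        obtain ⟨rfl, rfl⟩ := hw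
        exact ⟨[], by simp [extract, hb], .post _⟩
  | right =>
    cases h with
    | mid r =>
      cases r with
      | nil => exact ⟨[], by simp [extract], .post _⟩
      | cons x r => simp at hw

theorem Sync.skip {B : Bundle ι α Ω β Ω' Γ} {i : ι} {w₁ : List (TapeSym β)}
    {w' : List (TapeSym (α i))} {b : β} (h : B.Sync i .mid (.letter b :: w₁) w')
    (hb : B.feed i b = none) : B.Sync i .mid w₁ w' := by
  generalize hw : (.letter b :: w₁) = w at h
  cases h with
  | mid r =>
    cases r with
    | nil => simp at hw
    | cons x r =>
      simp only [List.map_cons, List.cons_append, List.cons.injEq, TapeSym.letter.injEq] at hw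
      obtain ⟨rfl, rfl⟩ := hw
      have : extract (B.feed i) (b :: r) = extract (B.feed i) r := by simp [extract, hb]
      rw [this]
      exact .mid r

/-- The stack of the machine executing a bundle. -/
def encStack (B : Bundle ι α Ω β Ω' Γ) (i : ι) (v : List (B.M i).Stack) : List B.Sk :=
  v.map (.sym i) ++ [.floor]

variable [Finite ι] [∀ i, Finite (α i)]

theorem not_mem_halt {B : Bundle ι α Ω β Ω' Γ} {q : B.St} (h : q ≠ .acc) (h' : q ≠ .rej) :
    q ∉ B.machine.halt := by
  rintro (h1 | h1)
  exacts [h h1, h' h1]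

/-- The invariant of the computations on `x` of the machine executing a bundle; `T` bounds the
running times of the simulated machines, and `t` is the number of steps. -/
inductive Inv (B : Bundle ι α Ω β Ω' Γ) (A : Language Ω') (T : ℕ) (x : List β) :
    ℕ → B.machine.Cfg → Prop
  | idle {t u r} (hx : inputTape x = u ++ r) (ht : t + r.length = x.length + 2) :
      Inv B A T x t ⟨.idle, r, [.floor], [], []⟩
  | sim {t t' i ph q w w' v y z r} (hl : B.Launches i x r)
      (hr : (B.M i).Run (B.oracle A i) t' ((B.M i).init (extract (B.feed i) r)) ⟨q, w', v, y, z⟩)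
      (hs : B.Sync i ph w w') (ht : t + w.length ≤ x.length + 2 + 3 * t') :
      Inv B A T x t ⟨.sim i ph q, w, B.encStack i v, (B.tag i).toList ++ y.map (B.emb i),
        (B.out i).toList⟩
  | query {t t' i ph w w' v y z r} (hl : B.Launches i x r)
      (hr : (B.M i).Run (B.oracle A i) t' ((B.M i).init (extract (B.feed i) r))
        ⟨(B.M i).query, w', v, y, z⟩)
      (hs : B.Sync i ph w w') (ht : t + w.length ≤ x.length + 2 + 3 * t' + 1) :
      Inv B A T x t ⟨.query, w, .tok i ph :: B.encStack i v,
        (B.tag i).toList ++ y.map (B.emb i), (B.out i).toList⟩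
  | ans {t t' i ph b w w' v z r} (hl : B.Launches i x r)
      (hr : (B.M i).Run (B.oracle A i) (t' + 1) ((B.M i).init (extract (B.feed i) r))
        ⟨(B.M i).reply b, w', v, [], z⟩)
      (hs : B.Sync i ph w w') (ht : t + w.length ≤ x.length + 2 + 3 * t' + 2) :
      Inv B A T x t ⟨.ans b, w, .tok i ph :: B.encStack i v, [], (B.out i).toList⟩
  | acc {t c i r} (hl : B.Launches i x r)
      (hr : extract (B.feed i) r ∈ (B.M i).accepts (B.oracle A i))
      (hc : c.state = .acc) (ho : c.output = (B.out i).toList)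
      (ht : t ≤ x.length + 2 + 3 * T + 3) : Inv B A T x t c
  | rej {t c} (hc : c.state = .rej) (ht : t ≤ x.length + 2 + 3 * T + 3) : Inv B A T x t c

theorem Inv.exists_step {B : Bundle ι α Ω β Ω' Γ} {A : Language Ω'} {T : ℕ} {x : List β} {t : ℕ}
    {c : B.machine.Cfg} (h : B.Inv A T x t c) :
    c.state ∈ B.machine.halt ∨ ∃ d, B.machine.Step A c d := by
  have key : ∀ (q : B.St) (w : List (TapeSym β)) (s : List B.Sk) (y : List Ω') (z : List Γ),
      q ≠ .acc → q ≠ .rej → q ≠ .query → s ≠ [] → ∃ d, B.machine.Step A ⟨q, w, s, y, z⟩ d := by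
    intro q w s y z h1 h2 h3 h4
    cases s with
    | nil => exact absurd rfl h4
    | cons a s =>
      exact ⟨_, .silent (M := B.machine) (not_mem_halt h1 h2) h3 (Trans.escape _ _)⟩
  cases h with
  | idle => exact .inr (key _ _ _ _ _ (by nofun) (by nofun) (by nofun) (by nofun))
  | sim => exact .inr (key _ _ _ _ _ (by nofun) (by nofun) (by nofun) (by simp [encStack]))
  | ans => exact .inr (key _ _ _ _ _ (by nofun) (by nofun) (by nofun) (by nofun))
  | @query t' i ph w w' v y z r =>
    by_cases hy : (B.tag i).toList ++ y.map (B.emb i) ∈ A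
    · exact .inr ⟨_, .answerYes (M := B.machine) hy⟩
    · exact .inr ⟨_, .answerNo (M := B.machine) hy⟩
  | acc _ _ hc => exact .inl (.inl hc)
  | rej hc => exact .inl (.inr hc)

/-- `T` bounds the running times of the machines that can be launched on `x`. -/
def TimeBound (B : Bundle ι α Ω β Ω' Γ) (A : Language Ω') (T : ℕ) (x : List β) : Prop :=
  ∀ i r t c, B.Launches i x r →
    (B.M i).Run (B.oracle A i) t ((B.M i).init (extract (B.feed i) r)) c → t ≤ T

theorem Inv.bound {B : Bundle ι α Ω β Ω' Γ} {A : Language Ω'} {T : ℕ} {x : List β} {t : ℕ}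
    {c : B.machine.Cfg} (hT : B.TimeBound A T x) (h : B.Inv A T x t c) :
    t ≤ x.length + 2 + 3 * T + 3 := by
  cases h with
  | idle => omega
  | sim hl hr => have := hT _ _ _ _ hl hr; omega
  | query hl hr => have := hT _ _ _ _ hl hr; omega
  | ans hl hr => have := hT _ _ _ _ hl hr; omega
  | acc => omega
  | rej => omega

theorem Inv.launch {B : Bundle ι α Ω β Ω' Γ} {A : Language Ω'} {T : ℕ} {x r : List β} {t : ℕ}
    {i : ι} (hl : B.Launches i x r) (ht : t + (r.length + 1) ≤ x.length + 2) :
    B.Inv A T x t ⟨.sim i .pre (B.M i).start, r.map .letter ++ [.right],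
      [.sym i (B.M i).bottom, .floor], (B.tag i).toList, (B.out i).toList⟩ := by
  have := Inv.sim (A := A) (T := T) hl (.refl _) (.pre r) (t := t) (by simpa using ht)
  simpa [encStack] using this

/-- The accounting behind termination: one simulated step takes at most three steps, the worst case
being a query, which is submitted, answered and resumed. Skipped letters are paid by the shrinking
unread tape. -/
theorem Inv.sim_trans {B : Bundle ι α Ω β Ω' Γ} {A : Language Ω'} {T : ℕ} {x r : List β}
    {t t' : ℕ} {i : ι} {ph : Phase} {q : (B.M i).State} {w w₁ : List (TapeSym β)}
    {w' : List (TapeSym (α i))} {v : List (B.M i).Stack} {y : List (Ω i)} {z : List Empty}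
    {s : Option (TapeSym β)} {p : B.St} {a : B.Sk} {u v' : List B.Sk} {b : Option Ω'}
    {o : Option Γ} (hT : B.TimeBound A T x) (hl : B.Launches i x r)
    (hr : (B.M i).Run (B.oracle A i) t' ((B.M i).init (extract (B.feed i) r)) ⟨q, w', v, y, z⟩)
    (hsy : B.Sync i ph w w') (ht : t + w.length ≤ x.length + 2 + 3 * t')
    (hst : B.encStack i v = a :: v') (hw : w = s.toList ++ w₁)
    (hδ : B.Trans (.sim i ph q) s a (p, u, b, o)) :
    B.Inv A T x (t + 1) ⟨p, w₁, u ++ v', ((B.tag i).toList ++ y.map (B.emb i)) ++ b.toList,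
      (B.out i).toList ++ o.toList⟩ := by
  have hb := hT _ _ _ _ hl hr
  cases hδ with
  | accept _ h => exact .acc hl ⟨_, _, hr, h⟩ rfl (by simp) (by omega)
  | ask =>
    simp only [Option.toList_none, List.nil_append] at hw
    subst hw
    simpa [← hst] using Inv.query (T := T) hl hr hsy (t := t + 1) (by omega)
  | skip _ _ h =>
    simp only [Option.toList_some, List.singleton_append] at hw
    subst hw
    simpa [← hst] using Inv.sim (T := T) hl hr (hsy.skip h) (t := t + 1) (by simp at ht; omega)
  | @move _ _ _ s' ph' _ a p u b o hf h1 h2 h =>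
    obtain ⟨w₁', rfl, hsy'⟩ := hsy.feed hf hw
    cases v with
    | nil => simp [encStack] at hst
    | cons a' v =>
      simp only [encStack, List.map_cons, List.cons_append, List.cons.injEq] at hst
      obtain ⟨h3, rfl⟩ := hst
      cases h3
      have hr' : (B.M i).Run (B.oracle A i) (t' + 1)
          ((B.M i).init (extract (B.feed i) r))
          ⟨p, w₁', u ++ v, y ++ b.toList, z ++ o.toList⟩ := by
        cases s' with
        | none => exact hr.tail (.silent h1 h2 h)
        | some s' => exact hr.tail (.read h1 h2 h)
      have := Inv.sim (T := T) hl hr' hsy' (t := t + 1) (by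
        subst hw
        simp only [List.length_append] at ht
        omega)
      have e : ((B.tag i).toList ++ y.map (B.emb i)) ++ (b.map (B.emb i)).toList =
          (B.tag i).toList ++ (y ++ b.toList).map (B.emb i) := by cases b <;> simp
      rw [e]
      simpa [encStack] using this
  | escape => exact .rej rfl (by omega)

theorem Inv.step {B : Bundle ι α Ω β Ω' Γ} {A : Language Ω'} {T : ℕ} {x : List β} {t : ℕ}
    {c d : B.machine.Cfg} (hT : B.TimeBound A T x) (h : B.Inv A T x t c)
    (hs : B.machine.Step A c d) : B.Inv A T x (t + 1) d := by
  have hs := hs.inversion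
  cases h with
  | @idle w r hx ht =>
    rcases hs with ⟨_, _, p, a, u, v, b, o, hst, h⟩ | ⟨h, _⟩
    · simp only [List.cons.injEq] at hst
      obtain ⟨rfl, rfl⟩ := hst
      rcases h with ⟨s, r', hw, hδ, rfl⟩ | ⟨hδ, rfl⟩
      · simp only at hw
        subst hw
        simp only [List.length_cons] at ht
        cases (show B.Trans .idle _ _ _ from hδ) with
        | wait => exact .idle (u := w ++ [s]) (by simp [hx]) (by omega)
        | launchLeft _ hl =>
          have hr := inputTape_eq_append_left hx
          subst hr
          exact .launch (.inl ⟨hl, rfl⟩) (by simp at ht ⊢; omega)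
        | launchLetter _ hl =>
          obtain ⟨u', r, rfl, rfl⟩ := inputTape_eq_append_letter hx
          exact .launch (.inr ⟨_, _, rfl, hl⟩) (by simp at ht ⊢; omega)
      · cases (show B.Trans .idle _ _ _ from hδ) with
        | escape => exact .rej rfl (by omega)
    · exact absurd h (by nofun)
  | @sim t' i ph q w w' v y z r hl hr hsy ht =>
    rcases hs with ⟨_, _, p, a, u, v', b, o, hst, h⟩ | ⟨h, _⟩
    · rcases h with ⟨s, w₁, hw, hδ, rfl⟩ | ⟨hδ, rfl⟩
      · exact .sim_trans (s := some s) hT hl hr hsy ht hst hw hδ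
      · exact .sim_trans (s := none) hT hl hr hsy ht hst rfl hδ
    · exact absurd h (by nofun)
  | @query t' i ph w w' v y z r hl hr hsy ht =>
    rcases hs with ⟨_, h, _⟩ | ⟨_, h⟩
    · exact absurd rfl h
    · rcases h with ⟨h, rfl⟩ | ⟨h, rfl⟩
      · exact .ans (b := true) hl (hr.tail (.answer ⟨fun _ => h, fun _ => rfl⟩)) hsy
          (by simp only; omega)
      · exact .ans (b := false) hl (hr.tail (.answer ⟨nofun, fun h' => absurd h' h⟩)) hsy
          (by simp only; omega)
  | @ans t' i ph b w w' v z r hl hr hsy ht =>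
    rcases hs with ⟨_, _, p, a, u, v', b, o, hst, h⟩ | ⟨h, _⟩
    · simp only [List.cons.injEq] at hst
      obtain ⟨rfl, rfl⟩ := hst
      have hb := hT _ _ _ _ hl hr
      rcases h with ⟨s, r', hw, hδ, rfl⟩ | ⟨hδ, rfl⟩
      · cases (show B.Trans (.ans _) (some s) _ _ from hδ)
      · cases (show B.Trans (.ans _) _ _ _ from hδ) with
        | resume => simpa using Inv.sim (T := T) hl hr hsy (t := t + 1) (by omega)
        | escape => exact .rej rfl (by omega)
    · exact absurd h (by nofun)
  | acc _ _ hc =>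
    rcases hs with ⟨h, _⟩ | ⟨h, _⟩
    · exact absurd (.inl hc) h
    · rw [hc] at h; exact absurd h (by nofun)
  | rej hc =>
    rcases hs with ⟨h, _⟩ | ⟨h, _⟩
    · exact absurd (.inr hc) h
    · rw [hc] at h; exact absurd h (by nofun)

theorem inv_of_run {B : Bundle ι α Ω β Ω' Γ} {A : Language Ω'} {T : ℕ} {x : List β} {t : ℕ}
    {c : B.machine.Cfg} (hT : B.TimeBound A T x)
    (h : B.machine.Run A t (B.machine.init x) c) : B.Inv A T x t c := by
  generalize hi : B.machine.init x = i at h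
  induction h with
  | refl => subst hi; exact .idle (u := []) rfl (by simp [inputTape])
  | tail _ hs ih => exact (ih hi).step hT hs

/-- The components obey their time bounds under every oracle, in particular under the one that
tagging and translation of queries induce, and the word extracted for them is no longer than `x`. -/
theorem machine_terminates {B : Bundle ι α Ω β Ω' Γ} (h : ∀ i, (B.M i).Terminates) :
    (∃ a b, ∀ A x, B.TimeBound A (a * x.length + b) x) ∧ B.machine.Terminates := by
  have key : ∃ a b, ∀ A x, B.TimeBound A (a * x.length + b) x := by
    choose a b hab using h
    obtain ⟨a', ha⟩ := (Set.finite_range a).bddAbove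
    obtain ⟨b', hb⟩ := (Set.finite_range b).bddAbove
    refine ⟨a', b', fun A x i r t c hl hr => (hab i _ _ _ _ hr).1.trans ?_⟩
    have h1 : (extract (B.feed i) r).length ≤ x.length := by
      refine (extract_length_le _ _).trans ?_
      rcases hl with ⟨_, rfl⟩ | ⟨u, b, rfl, _⟩ <;> grind
    have h2 : a i ≤ a' := ha ⟨i, rfl⟩
    have h3 : b i ≤ b' := hb ⟨i, rfl⟩
    gcongr
  refine ⟨key, ?_⟩
  obtain ⟨a, b, hT⟩ := key
  -- This is `x.length + 2 + 3 * T + 3` with `T = a * x.length + b`.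
  refine ⟨3 * a + 1, 3 * b + 5, fun A x t c h => ?_⟩
  have h := inv_of_run (hT A x) h
  refine ⟨?_, h.exists_step⟩
  have := h.bound (hT A x)
  calc t ≤ _ := this
    _ = _ := by ring

/-- One step of a simulated machine can be carried out by the machine executing the bundle. -/
theorem exists_run_of_step {B : Bundle ι α Ω β Ω' Γ} {A : Language Ω'} {i : ι} {ph : Phase}
    {w : List (TapeSym β)} {c d : (B.M i).Cfg} (hs : (B.M i).Step (B.oracle A i) c d)
    (hsy : B.Sync i ph w c.input) :
    ∃ t ph' w₁, B.Sync i ph' w₁ d.input ∧ B.machine.Run A t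
      ⟨.sim i ph c.state, w, B.encStack i c.stack, (B.tag i).toList ++ c.queryTape.map (B.emb i),
        (B.out i).toList⟩
      ⟨.sim i ph' d.state, w₁, B.encStack i d.stack, (B.tag i).toList ++ d.queryTape.map (B.emb i),
        (B.out i).toList⟩ := by
  have hans : ∀ {w' v y z b}, (b = true ↔ y ∈ B.oracle A i) → c = ⟨(B.M i).query, w', v, y, z⟩ →
      d = ⟨(B.M i).reply b, w', v, [], z⟩ → ∃ t ph' w₁, B.Sync i ph' w₁ d.input ∧ B.machine.Run A t
      ⟨.sim i ph c.state, w, B.encStack i c.stack, (B.tag i).toList ++ c.queryTape.map (B.emb i),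
        (B.out i).toList⟩
      ⟨.sim i ph' d.state, w₁, B.encStack i d.stack, (B.tag i).toList ++ d.queryTape.map (B.emb i),
        (B.out i).toList⟩ := by
    rintro w' v y z b hb rfl rfl
    obtain ⟨a, s, has⟩ : ∃ a s, B.encStack i v = a :: s := by
      cases v <;> simp [encStack]
    have h1 : B.machine.Step A ⟨.sim i ph (B.M i).query, w, a :: s,
        (B.tag i).toList ++ y.map (B.emb i), (B.out i).toList⟩ _ :=
      .silent (M := B.machine) (not_mem_halt (by nofun) (by nofun)) (by nofun) (Trans.ask _ _ _)
    have h2 : B.machine.Step A ⟨.query, w, .tok i ph :: a :: s,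
        (B.tag i).toList ++ y.map (B.emb i), (B.out i).toList⟩
        ⟨.ans b, w, .tok i ph :: a :: s, [], (B.out i).toList⟩ := by
      cases b with
      | true => exact .answerYes (M := B.machine) (hb.1 rfl)
      | false => exact .answerNo (M := B.machine) (fun h => by simpa using hb.2 h)
    have h3 : B.machine.Step A ⟨.ans b, w, .tok i ph :: a :: s, [], (B.out i).toList⟩ _ :=
      .silent (M := B.machine) (not_mem_halt (by nofun) (by nofun)) (by nofun)
        (Trans.resume _ _ _)
    -- Submission with the index and phase saved on the stack, the answer, and the return to the
    -- simulation with the tag already on the blank query tape.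
    refine ⟨3, ph, w, hsy, ?_⟩
    have h3' := ((OracleNPDA.Run.single h1).tail (by simpa using h2)).tail h3
    rw [has]
    simpa using h3'
  cases hs with
  | answerYes h => exact hans (b := true) (by simpa using h) rfl rfl
  | answerNo h => exact hans (b := false) (by simpa using h) rfl rfl
  | @silent q p w' a u v y z b o h1 h2 h =>
    refine ⟨1, ph, w, hsy, .single ?_⟩
    exact .silent_eq (M := B.machine) (v := B.encStack i v)
      (not_mem_halt (by nofun) (by nofun)) (by nofun) (Trans.move (.silent ph) h1 h2 h)
      (by simp [encStack]) (by cases b <;> simp) (by simp)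
  | @read q p s w' a u v y z b o h1 h2 h =>
    have one : ∀ {ph w₁ ph' s₁}, B.Feed i ph s₁ (some s) ph' → B.machine.Step A
        ⟨.sim i ph q, s₁.toList ++ w₁, B.encStack i (a :: v),
          (B.tag i).toList ++ y.map (B.emb i), (B.out i).toList⟩
        ⟨.sim i ph' p, w₁, B.encStack i (u ++ v),
          (B.tag i).toList ++ (y ++ b.toList).map (B.emb i), (B.out i).toList⟩ := by
      intro ph w₁ ph' s₁ hf
      cases s₁ with
      | none =>
        exact .silent_eq (M := B.machine) (v := B.encStack i v)
          (not_mem_halt (by nofun) (by nofun)) (by nofun) (Trans.move hf h1 h2 h)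
          (by simp [encStack]) (by cases b <;> simp) (by simp)
      | some s₁ =>
        exact .read_eq (M := B.machine) (v := B.encStack i v)
          (not_mem_halt (by nofun) (by nofun)) (by nofun) (Trans.move hf h1 h2 h)
          (by simp [encStack]) (by cases b <;> simp) (by simp)
    clear hans
    generalize hc : (s :: w') = i' at hsy
    cases hsy with
    | post => simp at hc
    | pre r =>
      simp only [List.cons.injEq] at hc
      obtain ⟨rfl, rfl⟩ := hc
      exact ⟨1, .mid, _, .mid r, .single (one .left)⟩
    | mid r =>
      -- Letters that `feed` ignores have to be passed over before the symbol that the simulated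
      -- machine reads.
      induction r with
      | nil =>
        simp only [extract, List.map_nil] at hc
        obtain ⟨rfl, rfl⟩ := hc
        exact ⟨1, .post, [], .post _, .single (one .right)⟩
      | cons x r ih =>
        rcases hf : B.feed i x with _ | _ | e
        · have : extract (B.feed i) (x :: r) = extract (B.feed i) r := by simp [extract, hf]
          rw [this] at hc
          obtain ⟨t, ph', w₁, h3, h4⟩ := ih hc
          refine ⟨1 + t, ph', w₁, h3, .trans (.single ?_) h4⟩
          exact .read_eq (M := B.machine) (v := B.encStack i v) (a := .sym i a)
            (not_mem_halt (by nofun) (by nofun)) (by nofun) (Trans.skip q _ hf)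
            (by simp [encStack]) (by simp) (by simp)
        · have : extract (B.feed i) (x :: r) = [] := by simp [extract, hf]
          rw [this] at hc
          simp only [List.map_nil] at hc
          obtain ⟨rfl, rfl⟩ := hc
          exact ⟨1, .post, _, .post _, .single (one (.finish hf))⟩
        · have : extract (B.feed i) (x :: r) = e :: extract (B.feed i) r := by simp [extract, hf]
          rw [this] at hc
          simp only [List.map_cons] at hc
          obtain ⟨rfl, rfl⟩ := hc
          exact ⟨1, .mid, _, .mid r, .single (one (.letter hf))⟩

theorem exists_run_of_run {B : Bundle ι α Ω β Ω' Γ} {A : Language Ω'} {i : ι}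
    {x : List β} {t : ℕ} {c : (B.M i).Cfg}
    (hr : (B.M i).Run (B.oracle A i) t ((B.M i).init (extract (B.feed i) x)) c) :
    ∃ t ph w, B.Sync i ph w c.input ∧ B.machine.Run A t
      ⟨.sim i .pre (B.M i).start, x.map .letter ++ [.right], [.sym i (B.M i).bottom, .floor],
        (B.tag i).toList, (B.out i).toList⟩
      ⟨.sim i ph c.state, w, B.encStack i c.stack, (B.tag i).toList ++ c.queryTape.map (B.emb i),
        (B.out i).toList⟩ := by
  generalize hi : (B.M i).init (extract (B.feed i) x) = c₀ at hr
  induction hr with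
  | refl =>
    subst hi
    refine ⟨0, .pre, _, .pre x, ?_⟩
    simpa [OracleNPDA.init, encStack] using OracleNPDA.Run.refl _
  | tail _ hs ih =>
    obtain ⟨t, ph, w, hsy, hr⟩ := ih hi
    obtain ⟨t', ph', w', hsy', hr'⟩ := exists_run_of_step hs hsy
    exact ⟨_, _, _, hsy', hr.trans hr'⟩

theorem exists_run_launch {B : Bundle ι α Ω β Ω' Γ} (A : Language Ω') {i : ι} {x r : List β}
    (hl : B.Launches i x r) : ∃ t, B.machine.Run A t (B.machine.init x)
      ⟨.sim i .pre (B.M i).start, r.map .letter ++ [.right], [.sym i (B.M i).bottom, .floor],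
        (B.tag i).toList, (B.out i).toList⟩ := by
  have wait : ∀ u w : List (TapeSym β), ∃ t, B.machine.Run A t ⟨.idle, u ++ w, [.floor], [], []⟩
      ⟨.idle, w, [.floor], [], []⟩ := by
    intro u w
    induction u with
    | nil => exact ⟨0, .refl _⟩
    | cons s u ih =>
      obtain ⟨t, ht⟩ := ih
      refine ⟨1 + t, .trans (.single ?_) ht⟩
      exact .read (M := B.machine) (v := []) (y := []) (z := [])
        (not_mem_halt (by nofun) (by nofun)) (by nofun) (Trans.wait _ _)
  rcases hl with ⟨hl, rfl⟩ | ⟨u, b, rfl, hl⟩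
  · exact ⟨1, .single (.read (M := B.machine) (v := []) (y := []) (z := [])
      (not_mem_halt (by nofun) (by nofun)) (by nofun) (Trans.launchLeft _ hl))⟩
  · obtain ⟨t, ht⟩ := wait (.left :: u.map .letter) (.letter b :: (r.map .letter ++ [.right]))
    have := ht.tail (.read (M := B.machine) (v := []) (y := []) (z := [])
      (not_mem_halt (by nofun) (by nofun)) (by nofun) (Trans.launchLetter _ hl))
    refine ⟨t + 1, ?_⟩
    simpa [OracleNPDA.init, inputTape] using this

theorem mem_outcomes_machine {B : Bundle ι α Ω β Ω' Γ} (h : ∀ i, (B.M i).Terminates)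
    {A : Language Ω'} {x : List β} {z : List Γ} :
    z ∈ B.machine.outcomes A x ↔ ∃ i r, B.Launches i x r ∧
      extract (B.feed i) r ∈ (B.M i).accepts (B.oracle A i) ∧ z = (B.out i).toList := by
  constructor
  · rintro ⟨t, c, hr, hc, rfl⟩
    obtain ⟨⟨a, b, hT⟩, -⟩ := machine_terminates h
    replace hc : c.state = .acc := hc
    cases inv_of_run (hT A x) hr with
    | acc hl hr _ ho => exact ⟨_, _, hl, hr, ho⟩
    | rej hc' => simp [hc] at hc'
    | _ => simp at hc
  · rintro ⟨i, r, hl, ⟨t, c, hr, hc⟩, rfl⟩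
    obtain ⟨t₁, h₁⟩ := exists_run_launch A hl
    obtain ⟨t₂, ph, w, -, h₂⟩ := exists_run_of_run hr
    obtain ⟨a, s, has⟩ : ∃ a s, B.encStack i c.stack = a :: s := by
      cases c.stack <;> simp [encStack]
    rw [has] at h₂
    exact ⟨_, _, (h₁.trans h₂).tail (.silent (M := B.machine)
      (not_mem_halt (by nofun) (by nofun)) (by nofun) (Trans.accept _ hc)), rfl, by simp⟩

theorem mem_accepts_machine {B : Bundle ι α Ω β Ω' Γ} (h : ∀ i, (B.M i).Terminates)
    {A : Language Ω'} {x : List β} :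
    x ∈ B.machine.accepts A ↔ ∃ i r, B.Launches i x r ∧
      extract (B.feed i) r ∈ (B.M i).accepts (B.oracle A i) := by
  constructor
  · rintro ⟨t, c, hr, hc⟩
    obtain ⟨i, r, h1, h2, -⟩ := (mem_outcomes_machine h).1 ⟨t, c, hr, hc, rfl⟩
    exact ⟨i, r, h1, h2⟩
  · rintro ⟨i, r, h1, h2⟩
    obtain ⟨t, c, hr, hc, -⟩ := (mem_outcomes_machine h).2 ⟨i, r, h1, h2, rfl⟩
    exact ⟨t, c, hr, hc⟩

end Bundle

/-! ### Closure properties of recognizability with a fixed oracle -/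

/-- The languages over `α` recognized by terminating oracle machines with oracle `A`. -/
def Recog {Ω : Type} (A : Language Ω) (α : Type) : Set (Language α) :=
  {L | ∃ M : OracleNPDA α Ω Empty, M.Terminates ∧ L = M.accepts A}

section Closure

variable {α β Ω : Type} {A : Language Ω}

theorem Prog.recog (P : Prog α Ω) (A : Language Ω) :
    {x | ∃ q v y b, P.Reach x q v y ∧ (b = true ↔ y ∈ A) ∧ P.verdict q b} ∈ Recog A α :=
  ⟨P.machine, P.machine_terminates, by ext x; exact Prog.mem_accepts_machine.symm⟩

/-- A bundle with one component, no tag and untranslated queries. Its purpose is to run a machine on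
one query inside a transcript: `launch` picks the entry announcing the query, and `feed` extracts
the letters up to its end. -/
theorem recog_segment [Finite α] {L : Language α} (hL : L ∈ Recog A α)
    (launch : Option β → Prop) (feed : β → Option (Option α)) :
    {x | ∃ r, ((launch none ∧ r = x) ∨ ∃ u b, x = u ++ b :: r ∧ launch (some b)) ∧
      extract feed r ∈ L} ∈ Recog A β := by
  obtain ⟨M, hM, rfl⟩ := hL
  let B : Bundle Unit (fun _ => α) (fun _ => Ω) β Ω Empty :=
    { M := fun _ => M
      launch := fun _ => launch
      feed := fun _ => feed
      tag := fun _ => none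
      emb := fun _ => id
      out := fun _ => none }
  have hA : B.oracle A () = A := by
    ext w
    change [] ++ w.map id ∈ A ↔ _
    simp
  refine ⟨B.machine, (Bundle.machine_terminates fun _ => hM).2, ?_⟩
  ext x
  rw [Bundle.mem_accepts_machine fun _ => hM]
  constructor
  · rintro ⟨r, h1, h2⟩
    exact ⟨(), r, h1, by rw [hA]; exact h2⟩
  · rintro ⟨⟨⟩, r, h1, h2⟩
    exact ⟨r, h1, by rw [hA] at h2; exact h2⟩

theorem extract_some (f : β → Option α) (w : List β) :
    extract (fun b => (f b).map some) w = w.filterMap f := by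
  induction w with
  | nil => rfl
  | cons b w ih =>
    rw [extract]
    cases h : f b <;> simp [h, ih]

/-- The special case of a segment that starts at the left endmarker and is never stopped. -/
theorem recog_comap [Finite α] {L : Language α} (hL : L ∈ Recog A α) (f : β → Option α) :
    {w | w.filterMap f ∈ L} ∈ Recog A β := by
  convert recog_segment hL (fun b => b = none) (fun b => (f b).map some) using 1
  ext x
  simp only [extract_some]
  constructor
  · exact fun h => ⟨x, .inl ⟨trivial, rfl⟩, h⟩
  · rintro ⟨r, ⟨-, rfl⟩ | ⟨u, b, -, h⟩, h'⟩
    · exact h'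
    · simp at h

/-- A bundle of two machines launched at the left endmarker; no tags are needed because both use the
same oracle. -/
theorem recog_union [Finite α] {L L' : Language α} (h : L ∈ Recog A α) (h' : L' ∈ Recog A α) :
    (L ∪ L' : Set (List α)) ∈ Recog A α := by
  obtain ⟨M, hM, rfl⟩ := h
  obtain ⟨M', hM', rfl⟩ := h'
  let B : Bundle Bool (fun _ => α) (fun _ => Ω) α Ω Empty :=
    { M := fun i => if i then M else M'
      launch := fun _ b => b = none
      feed := fun _ b => some (some b)
      tag := fun _ => none
      emb := fun _ => id
      out := fun _ => none }
  have hB : ∀ i, (B.M i).Terminates := by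
    rintro (_ | _)
    exacts [hM', hM]
  have hA : ∀ i, B.oracle A i = A := by
    intro i
    ext w
    change [] ++ w.map id ∈ A ↔ _
    simp
  have he : ∀ x : List α, extract (fun b => some (some b)) x = x := fun x => by
    simpa using extract_some some x
  refine ⟨B.machine, (Bundle.machine_terminates hB).2, ?_⟩
  ext x
  rw [Bundle.mem_accepts_machine hB]
  constructor
  · rintro (h | h)
    · refine ⟨true, x, .inl ⟨rfl, rfl⟩, ?_⟩
      rw [hA]
      exact (he x).symm ▸ h
    · refine ⟨false, x, .inl ⟨rfl, rfl⟩, ?_⟩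
      rw [hA]
      exact (he x).symm ▸ h
  · rintro ⟨i, r, ⟨-, rfl⟩ | ⟨u, b, -, h⟩, h'⟩
    · rw [hA] at h'
      replace h' : extract (fun b => some (some b)) r ∈ (B.M i).accepts A := h'
      rw [he] at h'
      cases i
      exacts [.inr h', .inl h']
    · simp [B] at h

/-- The program that copies its input to the query tape and accepts on the answer `b`. -/
abbrev copyProg (Ω : Type) (b : Bool) : Prog Ω Ω where
  Q := Unit
  S := Empty
  finite_Q := inferInstance
  finite_S := inferInstance
  δ _ a _ := {r | a ≠ none ∧ r = ((), [], a)}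
  finite_δ _ a _ := (Set.finite_singleton ((), [], a)).subset fun _ h => h.2
  start := ()
  verdict _ b' := b' = b
  rank _ := 0
  rank_lt _ _ _ h := absurd rfl h.1

theorem copyProg_reach {b : Bool} {w : List Ω} {q v y} :
    (copyProg Ω b).Reach w q v y ↔ v = [] ∧ y = w := by
  constructor
  · intro h
    induction h with
    | init => exact ⟨rfl, rfl⟩
    | read h h' ih =>
      obtain ⟨rfl, rfl⟩ := ih
      obtain ⟨-, h⟩ := h'
      cases h
      exact ⟨rfl, rfl⟩
    | silent _ h' => exact absurd rfl h'.1
  · rintro ⟨rfl, rfl⟩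
    induction y using List.reverseRecOn with
    | nil => exact .init
    | append_singleton y a ih =>
      exact .read (a := a) ih (p := ()) (u := []) (b := some a) ⟨by simp, rfl⟩

theorem recog_self (A : Language Ω) : A ∈ Recog A Ω := by
  refine ⟨(copyProg Ω true).machine, Prog.machine_terminates _, ?_⟩
  ext x
  rw [Prog.mem_accepts_machine]
  constructor
  · exact fun h => ⟨(), [], x, true, copyProg_reach.2 ⟨rfl, rfl⟩, by simpa using h, rfl⟩
  · rintro ⟨q, v, y, b, h, hb, rfl⟩
    obtain ⟨-, rfl⟩ := copyProg_reach.1 h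
    simpa using hb

theorem recog_compl_self (A : Language Ω) : Aᶜ ∈ Recog A Ω := by
  refine ⟨(copyProg Ω false).machine, Prog.machine_terminates _, ?_⟩
  ext x
  rw [Prog.mem_accepts_machine]
  constructor
  · exact fun h => ⟨(), [], x, false, copyProg_reach.2 ⟨rfl, rfl⟩,
      ⟨nofun, fun h' => absurd h' h⟩, rfl⟩
  · rintro ⟨q, v, y, b, h, hb, rfl⟩
    obtain ⟨-, rfl⟩ := copyProg_reach.1 h
    exact fun h' => by simpa using hb.2 h'

end Closure

/-! ### Detecting that a deterministic pushdown device does not accept -/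

section Check

variable {α Q S Ω : Type}

/-- The computations of a real-time pushdown device given by its steps; in
`step q a s (p, u)`, the topmost stack symbol `s` (`none` on the empty stack) is replaced
by `u`. -/
inductive Exec (step : Q → α → Option S → Q × List S → Prop) :
    Q × List S → List α → Q × List S → Prop
  | nil (c) : Exec step c [] c
  | cons {q v a p u T c} (h : step q a v.head? (p, u)) (h' : Exec step (p, u ++ v.tail) T c) :
      Exec step (q, v) (a :: T) c

theorem Exec.append {step : Q → α → Option S → Q × List S → Prop} {c d e : Q × List S}
    {T T' : List α} (h : Exec step c T d) (h' : Exec step d T' e) : Exec step c (T ++ T') e := by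
  induction h with
  | nil => exact h'
  | cons h _ ih => exact .cons h (ih h')

theorem exec_snoc {step : Q → α → Option S → Q × List S → Prop} {c d : Q × List S}
    {T : List α} {a : α} : Exec step c (T ++ [a]) d ↔
      ∃ q v p u, Exec step c T (q, v) ∧ step q a v.head? (p, u) ∧ d = (p, u ++ v.tail) := by
  constructor
  · intro h
    induction T generalizing c with
    | nil =>
      cases h with
      | cons h h' =>
        cases h'
        exact ⟨_, _, _, _, .nil _, h, rfl⟩
    | cons b T ih =>
      cases h with
      | cons h h' =>
        obtain ⟨q, v, p, u, h1, h2, h3⟩ := ih h'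
        exact ⟨q, v, p, u, .cons h h1, h2, h3⟩
  · rintro ⟨q, v, p, u, h1, h2, rfl⟩
    exact h1.append (.cons h2 (.nil _))

/-- The program that detects that a deterministic pushdown device rejects. -/
abbrev checkProg (step : Q → α → Option S → Q × List S → Prop) [Finite Q] [Finite S]
    (hd : ∀ q a s r r', step q a s r → step q a s r' → r = r') (q₀ : Q) (final : Q → Prop) :
    Prog α Ω where
  Q := Option Q
  S := S
  finite_Q := inferInstance
  finite_S := inferInstance
  δ q a s := {r | ∃ b, a = some b ∧
    ((∃ q' p u, q = some q' ∧ step q' b s (p, u) ∧ r = (some p, u, none)) ∨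
      ((∀ q' r, q = some q' → ¬ step q' b s r) ∧ r = (none, [], none)))}
  finite_δ q a s := by
    apply Set.Subsingleton.finite
    rintro r ⟨b, rfl, h⟩ r' ⟨b', hb, h'⟩
    cases hb
    rcases h with ⟨q', p, u, rfl, h, rfl⟩ | ⟨h, rfl⟩ <;>
      rcases h' with ⟨q'', p', u', hq, h', rfl⟩ | ⟨h', rfl⟩
    · cases hq
      cases hd _ _ _ _ _ h h'
      rfl
    · exact absurd h (h' _ _ rfl)
    · exact absurd h' (h _ _ hq)
    · rfl
  start := some q₀
  verdict q _ := ∀ q', q = some q' → ¬ final q'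
  rank _ := 0
  rank_lt := by
    rintro q s r ⟨b, h, -⟩
    simp at h

variable {step : Q → α → Option S → Q × List S → Prop} [Finite Q] [Finite S]
  {hd : ∀ q a s r r', step q a s r → step q a s r' → r = r'} {q₀ : Q} {final : Q → Prop}

/-- By determinism the program follows the only execution there is; its additional state `none` is a
sink, entered when the execution cannot be continued. -/
theorem checkProg_reach {w : List α} {q v} {y : List Ω}
    (h : (checkProg (Ω := Ω) step hd q₀ final).Reach w q v y) :
    (∀ q', q = some q' → ∀ c, Exec step (q₀, []) w c ↔ c = (q', v)) ∧
      (q = none → ∀ c, ¬ Exec step (q₀, []) w c) := by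
  induction h with
  | init =>
    refine ⟨?_, nofun⟩
    rintro q' h c
    cases h
    exact ⟨fun h => by cases h; rfl, fun h => h ▸ .nil _⟩
  | @read w q v y a p u b h h' ih =>
    obtain ⟨b', hb, ⟨q', p', u', rfl, h1, h2⟩ | ⟨h1, h2⟩⟩ := h'
    · cases h2
      cases hb
      refine ⟨?_, nofun⟩
      rintro p'' hp c
      cases hp
      rw [exec_snoc]
      constructor
      · rintro ⟨q, v, p, u, h3, h4, rfl⟩
        cases (ih.1 _ rfl _).1 h3
        cases hd _ _ _ _ _ h1 h4
        rfl
      · rintro rfl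
        exact ⟨_, _, _, _, (ih.1 _ rfl _).2 rfl, h1, rfl⟩
    · cases h2
      cases hb
      refine ⟨nofun, fun _ c hc => ?_⟩
      rw [exec_snoc] at hc
      obtain ⟨q', v', p, u, h3, h4, rfl⟩ := hc
      cases q with
      | none => exact ih.2 rfl _ h3
      | some q =>
        cases (ih.1 _ rfl _).1 h3
        exact h1 _ _ rfl h4
  | silent _ h' =>
    obtain ⟨b, h, -⟩ := h'
    simp at h

theorem checkProg_exists_reach (w : List α) :
    ∃ q v, (checkProg (Ω := Ω) step hd q₀ final).Reach w q v [] := by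
  induction w using List.reverseRecOn with
  | nil => exact ⟨_, _, .init⟩
  | append_singleton w a ih =>
    obtain ⟨q, v, h⟩ := ih
    by_cases hq : ∃ q' r, q = some q' ∧ step q' a v.head? r
    · obtain ⟨q', ⟨p, u⟩, hq, hs⟩ := hq
      exact ⟨_, _, h.read (p := some p) (u := u) (b := none)
        ⟨a, rfl, .inl ⟨q', p, u, hq, hs, rfl⟩⟩⟩
    · refine ⟨_, _, h.read (p := (none : Option Q)) (u := []) (b := none)
        ⟨a, rfl, .inr ⟨fun q' r h1 h2 => hq ⟨q', r, h1, h2⟩, rfl⟩⟩⟩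

/-- Complementation works because the device is deterministic and real-time: the program never
blocks, so that on every word it ends with a state that decides acceptance. -/
theorem recog_check (A : Language Ω) (step : Q → α → Option S → Q × List S → Prop)
    (hd : ∀ q a s r r', step q a s r → step q a s r' → r = r') (q₀ : Q) (final : Q → Prop) :
    {w | ¬ ∃ q v, Exec step (q₀, []) w (q, v) ∧ final q} ∈ Recog A α := by
  convert (checkProg step hd q₀ final).recog A using 1
  ext w
  constructor
  · intro hw
    obtain ⟨q, v, h⟩ := checkProg_exists_reach (Ω := Ω) (hd := hd) (q₀ := q₀) (final := final) w
    have hr := checkProg_reach h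
    -- The program submits the empty query because it has to submit something; the verdict does not
    -- depend on the answer.
    by_cases hA : ([] : List Ω) ∈ A
    · refine ⟨q, v, [], true, h, by simpa using hA, ?_⟩
      rintro q' rfl hf
      exact hw ⟨q', v, (hr.1 _ rfl _).2 rfl, hf⟩
    · refine ⟨q, v, [], false, h, by simpa using hA, ?_⟩
      rintro q' rfl hf
      exact hw ⟨q', v, (hr.1 _ rfl _).2 rfl, hf⟩
  · rintro ⟨q, v, y, b, h, hb, hv⟩ ⟨q', v', he, hf⟩
    have hr := checkProg_reach h
    rcases q with _ | q
    · exact hr.2 rfl _ he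
    · cases (hr.1 _ rfl _).1 he
      exact hv _ rfl hf

end Check

/-! ### Detecting a difference of two interleaved words -/

section Queue

variable {X Ω : Type}

/-- The word formed by the letters on track `s`. -/
def onTrack (s : Bool) (w : List (Bool × X)) : List X :=
  w.filterMap fun p => if p.1 = s then some p.2 else none

theorem onTrack_snoc (s s' : Bool) (a : X) (w : List (Bool × X)) :
    onTrack s (w ++ [(s', a)]) = onTrack s w ++ if s' = s then [a] else [] := by
  by_cases h : s' = s <;> simp [onTrack, h]

/-- States of the program that compares two tracks: the difference of the numbers of letters is
counted; a letter is waiting for its partner on the other track; a mismatch has been found. -/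
inductive QSt (X : Type) : Type
  | count | wait (s : Bool) (a : X) | done

instance [Finite X] : Finite (QSt X) :=
  Finite.of_injective
    (fun q : QSt X => match q with
      | .count => (none : Option (Option (Bool × X)))
      | .wait s a => some (some (s, a))
      | .done => some none) (by
    rintro (_ | _ | _) (_ | _ | _) h <;> simp_all)

/-- Steps of the program that compares two tracks. -/
inductive QStep : QSt X → Bool × X → Option Bool → QSt X × List Bool → Prop
  | push {s a t} (h : t ≠ some (!s)) : QStep .count (s, a) t (.count, s :: t.toList)
  | pop (s a) : QStep .count (s, a) (some !s) (.count, [])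
  | guess {s a t} (h : t ≠ some (!s)) : QStep .count (s, a) t (.wait s a, t.toList)
  | same (s a b t) : QStep (.wait s a) (s, b) t (.wait s a, t.toList)
  | other (s a b t) : QStep (.wait s a) (!s, b) (some t) (.wait s a, [])
  | found {s a b} (h : a ≠ b) : QStep (.wait s a) (!s, b) none (.done, [])
  | done (x t) : QStep .done x t (.done, t.toList)

theorem finite_qStep [Finite X] (q : QSt X) (x : Bool × X) (t : Option Bool) :
    {r | QStep q x t r}.Finite := by
  have : (Set.univ ×ˢ {l | l.length ≤ 2} : Set (QSt X × List Bool)).Finite :=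
    Set.finite_univ.prod (List.finite_length_le _ _)
  refine this.subset fun r hr => ⟨trivial, ?_⟩
  cases hr <;> simp_all <;> cases t <;> simp

/-- The program that detects a difference of two tracks. -/
abbrev queueProg (X Ω : Type) [Finite X] : Prog (Bool × X) Ω where
  Q := QSt X
  S := Bool
  finite_Q := inferInstance
  finite_S := inferInstance
  δ q a s := {r | ∃ b, a = some b ∧ QStep q b s (r.1, r.2.1) ∧ r.2.2 = none}
  finite_δ q a s := by
    cases a with
    | none => simp
    | some a =>
      refine ((finite_qStep q a s).image fun r => (r.1, r.2, none)).subset ?_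
      rintro ⟨p, u, o⟩ ⟨b, hb, h, rfl⟩
      cases hb
      exact ⟨_, h, rfl⟩
  start := .count
  verdict q _ := q ≠ .count
  rank _ := 0
  rank_lt := by
    rintro q s r ⟨b, h, -⟩
    simp at h

variable [Finite X]

theorem queueProg_read {w : List (Bool × X)} {q p : QSt X} {v u : List Bool} {a : Bool × X}
    (h : (queueProg X Ω).Reach w q v []) (h' : QStep q a v.head? (p, u)) :
    (queueProg X Ω).Reach (w ++ [a]) p (u ++ v.tail) [] :=
  h.read (b := none) ⟨a, rfl, h', rfl⟩

/-- The stack while counting. -/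
def countStack (w : List (Bool × X)) : List Bool :=
  List.replicate ((onTrack false w).length - (onTrack true w).length) false ++
    List.replicate ((onTrack true w).length - (onTrack false w).length) true

omit [Finite X] in
theorem countStack_eq (s : Bool) {w : List (Bool × X)}
    (h : (onTrack (!s) w).length ≤ (onTrack s w).length) :
    countStack w = List.replicate ((onTrack s w).length - (onTrack (!s) w).length) s := by
  cases s <;> simp_all [countStack]

theorem head_toList_append_tail {β : Type} (v : List β) : v.head?.toList ++ v.tail = v := by
  cases v <;> rfl

omit [Finite X] in
theorem countStack_push {s : Bool} {w : List (Bool × X)} (a : X)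
    (h : (countStack w).head? ≠ some (!s)) : countStack (w ++ [(s, a)]) = s :: countStack w := by
  have hle : (onTrack (!s) w).length ≤ (onTrack s w).length := by
    by_contra hlt
    apply h
    rw [countStack_eq (!s) (by simp; omega), List.head?_replicate, if_neg (by simp; omega)]
  rw [countStack_eq s hle, countStack_eq s (by simpa [onTrack_snoc] using by omega)]
  simp only [onTrack_snoc, if_true, List.length_append, List.length_singleton,
    Bool.eq_not_self, if_false, List.append_nil]
  rw [Nat.sub_add_comm hle, List.replicate_succ]

omit [Finite X] in
theorem countStack_pop {s : Bool} {w : List (Bool × X)} (a : X)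
    (h : (countStack w).head? = some (!s)) : countStack (w ++ [(s, a)]) = (countStack w).tail := by
  have hlt : (onTrack s w).length < (onTrack (!s) w).length := by
    by_contra hle
    rw [countStack_eq s (by omega), List.head?_replicate] at h
    split at h <;> simp at h
  rw [countStack_eq (!s) (w := w) (by simp; omega),
    countStack_eq (!s) (by simp [onTrack_snoc]; omega)]
  simp [onTrack_snoc]
  omega

/-- The invariant of the program that compares two tracks. -/
def QInv (w : List (Bool × X)) : QSt X → List Bool → Prop
  | .count, v => v = countStack w
  | .wait s a, v => ∃ i : ℕ, (onTrack s w)[i]? = some a ∧ (onTrack (!s) w).length ≤ i ∧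
      v.length + (onTrack (!s) w).length = i
  | .done, _ => ∃ (s : Bool) (i : ℕ) (a b : X),
      (onTrack s w)[i]? = some a ∧ (onTrack (!s) w)[i]? = some b ∧ a ≠ b

/-- While counting, the stack holds the lead of the longer track in unary. Once a letter at position
`i` has been chosen, the stack height is `i` minus the length of the other track, so on an empty
stack the next letter of that track is the partner. -/
theorem queueProg_reach_sound {w : List (Bool × X)} {q v} {y : List Ω}
    (h : (queueProg X Ω).Reach w q v y) : QInv w q v := by
  have mono : ∀ {s x a} {i : ℕ} {w : List (Bool × X)}, (onTrack s w)[i]? = some a →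
      (onTrack s (w ++ [x]))[i]? = some a := by
    rintro s ⟨s', b⟩ a i w h
    rw [onTrack_snoc, List.getElem?_append_left (List.getElem?_eq_some_iff.1 h).1, h]
  induction h with
  | init => rfl
  | @read w q v y a p u b h h' ih =>
    obtain ⟨b', hb, hs, -⟩ := h'
    cases hb
    simp only at hs
    generalize ht : v.head? = t at hs
    cases hs with
    | @push s a _ hne =>
      obtain rfl : v = countStack w := ih
      subst ht
      change _ = countStack _
      rw [countStack_push a hne, List.cons_append, head_toList_append_tail]
    | pop s a =>
      obtain rfl : v = countStack w := ih
      exact (countStack_pop a ht).symm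
    | @guess s a _ hne =>
      obtain rfl : v = countStack w := ih
      subst ht
      have hle : (onTrack (!s) w).length ≤ (onTrack s w).length := by
        by_contra hlt
        apply hne
        rw [countStack_eq (!s) (by simp; omega), List.head?_replicate, if_neg (by simp; omega)]
      refine ⟨(onTrack s w).length, ?_, ?_, ?_⟩
      · simp [onTrack_snoc]
      · simpa [onTrack_snoc] using hle
      · rw [head_toList_append_tail, countStack_eq s hle]
        simp [onTrack_snoc, hle]
    | same s a b =>
      obtain ⟨i, h1, h2, h3⟩ := ih
      subst ht
      refine ⟨i, mono h1, ?_, ?_⟩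
      · simpa [onTrack_snoc] using h2
      · rw [head_toList_append_tail]
        simpa [onTrack_snoc] using h3
    | other s a b t =>
      obtain ⟨i, h1, h2, h3⟩ := ih
      cases v with
      | nil => simp at ht
      | cons c v =>
        simp only [List.length_cons] at h3
        refine ⟨i, mono h1, ?_, ?_⟩
        · simp [onTrack_snoc]; omega
        · simp [onTrack_snoc]; omega
    | @found s a b hab =>
      obtain ⟨i, h1, h2, h3⟩ := ih
      cases v with
      | cons c v => simp at ht
      | nil =>
        simp only [List.length_nil, zero_add] at h3
        exact ⟨s, i, a, b, mono h1, by simp [onTrack_snoc, ← h3], hab⟩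
    | done =>
      obtain ⟨s, i, a, b, h1, h2, h3⟩ := ih
      exact ⟨s, i, a, b, mono h1, mono h2, h3⟩
  | silent _ h' =>
    obtain ⟨b, h, -⟩ := h'
    simp at h

theorem queueProg_reach_count (w : List (Bool × X)) :
    (queueProg X Ω).Reach w .count (countStack w) [] := by
  induction w using List.reverseRecOn with
  | nil => exact .init
  | append_singleton w a ih =>
    obtain ⟨s, a⟩ := a
    by_cases h : (countStack w).head? = some (!s)
    · rw [countStack_pop a h]
      refine queueProg_read ih (u := []) ?_
      rw [h]
      exact .pop s a
    · rw [countStack_push a h]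
      have := queueProg_read ih (.push (a := a) h)
      rwa [List.cons_append, head_toList_append_tail] at this

/-- A position that the other track has not reached was not behind it when its letter arrived, so
the letter could be chosen then; each later letter of the other track removes one stack symbol. -/
theorem queueProg_reach_wait {w : List (Bool × X)} {s : Bool} {i : ℕ} {a : X}
    (h1 : (onTrack s w)[i]? = some a) (h2 : (onTrack (!s) w).length ≤ i) :
    (queueProg X Ω).Reach w (.wait s a) (List.replicate (i - (onTrack (!s) w).length) s) [] := by
  induction w using List.reverseRecOn with
  | nil => simp [onTrack] at h1
  | append_singleton w b ih =>
    obtain ⟨s', b⟩ := b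
    by_cases hs : s' = s
    · subst hs
      simp only [onTrack_snoc, if_true, Bool.eq_not_self, if_false, List.append_nil] at h1 h2 ⊢
      by_cases hi : i < (onTrack s' w).length
      · rw [List.getElem?_append_left hi] at h1
        have := queueProg_read (ih h1 h2) (.same s' a b _)
        rwa [head_toList_append_tail] at this
      · have hi' : i = (onTrack s' w).length := by
          have := (List.getElem?_eq_some_iff.1 h1).1
          simp at this
          omega
        subst hi'
        simp only [List.getElem?_concat_length, Option.some.injEq] at h1
        subst h1
        have hne : (countStack w).head? ≠ some (!s') := by
          rw [countStack_eq s' h2, List.head?_replicate]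
          split <;> simp
        have := queueProg_read (Ω := Ω) (queueProg_reach_count w) (.guess (a := b) hne)
        rwa [head_toList_append_tail, countStack_eq s' h2] at this
    · obtain rfl : s' = !s := by cases s <;> cases s' <;> simp_all
      simp only [onTrack_snoc, if_true, Bool.not_eq_self, if_false, List.append_nil,
        List.length_append, List.length_singleton] at h1 h2 ⊢
      have := ih h1 (by omega)
      obtain ⟨m, hm⟩ : ∃ m, i - (onTrack (!s) w).length = m + 1 :=
        ⟨i - (onTrack (!s) w).length - 1, by omega⟩
      rw [hm] at this
      have := queueProg_read this (.other s a b s)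
      rw [show i - ((onTrack (!s) w).length + 1) = m by omega]
      simpa using this

/-- Of the two differing letters, the earlier one is chosen and the later one triggers the
discovery; the proof is by induction on the word with a distinction of which track brings the last
letter. -/
theorem queueProg_reach_done {w : List (Bool × X)} {s : Bool} {i : ℕ} {a b : X}
    (h1 : (onTrack s w)[i]? = some a) (h2 : (onTrack (!s) w)[i]? = some b) (hab : a ≠ b) :
    ∃ v, (queueProg X Ω).Reach w .done v [] := by
  induction w using List.reverseRecOn with
  | nil => simp [onTrack] at h1
  | append_singleton w c ih =>
    obtain ⟨s', c⟩ := c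
    -- The case in which the last letter is the partner that was awaited, on an empty stack.
    have key : ∀ {s a b}, (onTrack s w)[i]? = some a → (onTrack (!s) (w ++ [(!s, c)]))[i]? = some b →
        a ≠ b → (onTrack (!s) w)[i]? = none → ∃ v, (queueProg X Ω).Reach (w ++ [(!s, c)]) .done v [] := by
      intro s a b h1 h2 hab h3
      rw [List.getElem?_eq_none_iff] at h3
      have hi : i = (onTrack (!s) w).length := by
        have := (List.getElem?_eq_some_iff.1 h2).1
        simp [onTrack_snoc] at this
        omega
      simp only [onTrack_snoc, if_true, hi, List.getElem?_concat_length, Option.some.injEq] at h2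
      subst h2
      have := queueProg_reach_wait (Ω := Ω) h1 h3
      rw [hi, Nat.sub_self] at this
      exact ⟨_, queueProg_read this (.found hab)⟩
    by_cases h3 : (onTrack s w)[i]? = some a ∧ (onTrack (!s) w)[i]? = some b
    · obtain ⟨v, hv⟩ := ih h3.1 h3.2
      exact ⟨_, queueProg_read hv (.done (s', c) _)⟩
    · have ext : ∀ {t a}, (onTrack t (w ++ [(s', c)]))[i]? = some a →
          (onTrack t w)[i]? = some a ∨ ((onTrack t w)[i]? = none ∧ s' = t) := by
        intro t a h
        by_cases hi : i < (onTrack t w).length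
        · rw [onTrack_snoc, List.getElem?_append_left hi] at h
          exact .inl h
        · refine .inr ⟨by simpa using hi, ?_⟩
          by_contra hne
          simp [onTrack_snoc, hne] at h
          have := (List.getElem?_eq_some_iff.1 h).1
          omega
      rcases ext h1 with h4 | ⟨h4, rfl⟩ <;> rcases ext h2 with h5 | ⟨h5, h6⟩
      · exact absurd ⟨h4, h5⟩ h3
      · subst h6
        exact key h4 h2 hab h5
      · have := key (s := !s') h5 (by simpa using h1) hab.symm (by simpa using h4)
        simpa using this
      · simp at h6

/-- Different words have a position at which the letters differ or only one of them has a letter.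
The first case ends in `done`; in the second the chosen letter is still waiting at the end, which is
why `wait` is accepted too. -/
theorem recog_queue (A : Language Ω) :
    {w : List (Bool × X) | onTrack false w ≠ onTrack true w} ∈ Recog A (Bool × X) := by
  convert (queueProg X Ω).recog A using 1
  ext w
  constructor
  · intro hw
    suffices ∃ q v, (queueProg X Ω).Reach w q v [] ∧ q ≠ .count by
      obtain ⟨q, v, h, hq⟩ := this
      by_cases hA : ([] : List Ω) ∈ A
      · exact ⟨q, v, [], true, h, by simpa using hA, hq⟩
      · exact ⟨q, v, [], false, h, by simpa using hA, hq⟩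
    obtain ⟨i, hi⟩ : ∃ i, (onTrack false w)[i]? ≠ (onTrack true w)[i]? := by
      by_contra! h
      exact hw (List.ext_getElem? h)
    rcases h1 : (onTrack false w)[i]? with _ | a <;> rcases h2 : (onTrack true w)[i]? with _ | b
    · simp [h1, h2] at hi
    · exact ⟨_, _, queueProg_reach_wait h2 (by simpa using h1), nofun⟩
    · exact ⟨_, _, queueProg_reach_wait h1 (by simpa using h2), nofun⟩
    · obtain ⟨v, hv⟩ := queueProg_reach_done (Ω := Ω) h1 h2 (by simpa [h1, h2] using hi)
      exact ⟨_, v, hv, nofun⟩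
  · rintro ⟨q, v, y, b, h, -, hq⟩ heq
    have hs := queueProg_reach_sound h
    have heq' : ∀ s, onTrack s w = onTrack (!s) w := by
      rintro (_ | _)
      exacts [heq, heq.symm]
    cases q with
    | count => exact hq rfl
    | wait s a =>
      obtain ⟨i, h1, h2, -⟩ := hs
      rw [heq'] at h1
      have := (List.getElem?_eq_some_iff.1 h1).1
      omega
    | done =>
      obtain ⟨s, i, a, b, h1, h2, h3⟩ := hs
      rw [heq', h2] at h1
      exact h3 (Option.some.inj h1).symm

end Queue

/-! ### Encoding lists of words, and phases of the input tape -/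

theorem extract_append {α β : Type} {f : β → Option (Option α)} {v : List β} (w : List β)
    (h : ∃ b ∈ v, f b = some none) : extract f (v ++ w) = extract f v := by
  induction v with
  | nil => simp at h
  | cons b v ih =>
    rw [List.cons_append, extract, extract]
    rcases hb : f b with _ | _ | a
    · simp only
      exact ih (by simpa [hb] using h)
    · rfl
    · simp only
      rw [ih (by simpa [hb] using h)]

theorem extract_cons_stop {α β : Type} {f : β → Option (Option α)} {b : β} (v : List β)
    (h : f b = some none) : extract f (b :: v) = [] := by
  simp [extract, h]

theorem extract_cons_map {α β : Type} {f : β → Option (Option α)} {b : β} {o : Option α}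
    (v : List β) (h : f b = o.map some) : extract f (b :: v) = o.toList ++ extract f v := by
  cases o <;> simp [extract, h]

/-- A list of words as one word, each of them being followed by `none`. -/
def encWords {α : Type} (xs : List (List α)) : List (Option α) :=
  xs.flatMap fun x => x.map some ++ [none]

theorem encWords_cons {α : Type} (x : List α) (xs : List (List α)) :
    encWords (x :: xs) = x.map some ++ none :: encWords xs := by
  simp [encWords]

theorem map_some_append_none_inj {α : Type} {x y : List α} {u v : List (Option α)}
    (h : x.map some ++ none :: u = y.map some ++ none :: v) : x = y ∧ u = v := by
  induction x generalizing y with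
  | nil => cases y <;> simp_all
  | cons a x ih =>
    cases y with
    | nil => simp at h
    | cons b y =>
      simp only [List.map_cons, List.cons_append, List.cons.injEq, Option.some.injEq] at h
      simp [h.1, ih h.2]

theorem encWords_eq_append {α : Type} {y : List α} {u : List (Option α)} {xs : List (List α)}
    (h : y.map some ++ none :: u = encWords xs) : ∃ xs', xs = y :: xs' ∧ u = encWords xs' := by
  cases xs with
  | nil => simp [encWords] at h
  | cons x xs =>
    rw [encWords_cons] at h
    obtain ⟨rfl, rfl⟩ := map_some_append_none_inj h
    exact ⟨xs, rfl, rfl⟩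

/-- The unread part of an input tape. -/
def tapeAt {α : Type} : Phase → List α → List (TapeSym α)
  | .pre, x => inputTape x
  | .mid, x => x.map .letter ++ [.right]
  | .post, _ => []

/-- Changes of the phase when a tape symbol (or none) is read. -/
inductive PhStep {α : Type} : Phase → Option (TapeSym α) → Phase → Prop
  | silent (ph) : PhStep ph none ph
  | left : PhStep .pre (some .left) .mid
  | letter (a) : PhStep .mid (some (.letter a)) .mid
  | right : PhStep .mid (some .right) .post

/-- The letter on a tape cell, if any. -/
def letterOf {α : Type} : Option (TapeSym α) → Option α
  | some (.letter a) => some a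
  | _ => none

theorem PhStep.unique {α : Type} {ph ph' ph'' : Phase} {s : Option (TapeSym α)}
    (h : PhStep ph s ph') (h' : PhStep ph s ph'') : ph' = ph'' := by
  cases h <;> cases h' <;> rfl

/-- In phase `post` the tape is empty whatever `x` is, so the unread word is determined by the tape
only with the convention that it is empty in that phase; the convention is passed backwards along
each step. -/
theorem PhStep.tapeAt {α : Type} {ph ph' : Phase} {s : Option (TapeSym α)} (h : PhStep ph s ph')
    {x : List α} (hx : ph' = .post → x = []) :
    tapeAt ph ((letterOf s).toList ++ x) = s.toList ++ tapeAt ph' x ∧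
      (ph = .post → (letterOf s).toList ++ x = []) := by
  cases h with
  | silent => exact ⟨rfl, hx⟩
  | left => exact ⟨rfl, nofun⟩
  | letter => exact ⟨rfl, nofun⟩
  | right => cases hx rfl; exact ⟨rfl, nofun⟩

theorem exists_phStep {α : Type} {ph : Phase} {x : List α} {s : TapeSym α}
    {w : List (TapeSym α)} (h : tapeAt ph x = s :: w) :
    ∃ ph' x', PhStep ph (some s) ph' ∧ x = (letterOf (some s)).toList ++ x' ∧
      w = tapeAt ph' x' ∧ (ph' = .post → x' = []) := by
  cases ph with
  | pre =>
    simp only [tapeAt, inputTape, List.cons.injEq] at h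
    obtain ⟨rfl, rfl⟩ := h
    exact ⟨.mid, x, .left, rfl, rfl, nofun⟩
  | mid =>
    cases x with
    | nil =>
      simp only [tapeAt, List.map_nil, List.nil_append, List.cons.injEq] at h
      obtain ⟨rfl, rfl⟩ := h
      exact ⟨.post, [], .right, rfl, rfl, fun _ => rfl⟩
    | cons a x =>
      simp only [tapeAt, List.map_cons, List.cons_append, List.cons.injEq] at h
      obtain ⟨rfl, rfl⟩ := h
      exact ⟨.mid, x, .letter a, rfl, rfl, nofun⟩
  | post => simp [tapeAt] at h

/-! ### Transcripts of computations with announced oracle answers -/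

namespace OracleNPDA

variable {α Ω Γ : Type}

/-- The moves of a machine, other than answers of the oracle. -/
structure Move (M : OracleNPDA α Ω Γ) where
  src : M.State
  sym : Option (TapeSym α)
  top : M.Stack
  dst : M.State
  push : List M.Stack
  qry : Option Ω
  out : Option Γ
  mem : (dst, push, qry, out) ∈ M.δ src sym top

/-- Entries of transcripts of computations.  A label `some b` announces that the query that is
going to be written on the query tape will be answered by `b`, and the label `none` that it will
not be submitted.  After acceptance, the rest of the input is read by `drain`. -/
inductive Tok (M : OracleNPDA α Ω Γ) : Type
  | start (l : Option Bool)
  | move (m : M.Move) (l : Option Bool)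
  | ans (b : Bool) (l : Option Bool)
  | drain (s : TapeSym α)
  | finish

instance [Finite α] (M : OracleNPDA α Ω Γ) : Finite M.Move := by
  have := M.finite_state
  have := M.finite_stack
  have hf : (⋃ i : M.State × Option (TapeSym α) × M.Stack,
      (fun r => (i, r)) '' M.δ i.1 i.2.1 i.2.2).Finite :=
    Set.finite_iUnion fun i => (M.finite_δ _ _ _).image _
  have := hf.to_subtype
  refine Finite.of_injective (β := ↑(⋃ i : M.State × Option (TapeSym α) × M.Stack,
      (fun r => (i, r)) '' M.δ i.1 i.2.1 i.2.2)) (fun m => ⟨((m.src, m.sym, m.top),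
    (m.dst, m.push, m.qry, m.out)), Set.mem_iUnion.2 ⟨_, _, m.mem, rfl⟩⟩) ?_
  rintro ⟨⟩ ⟨⟩ h
  simp_all

instance [Finite α] (M : OracleNPDA α Ω Γ) : Finite M.Tok :=
  Finite.of_injective
    (fun t : M.Tok => match t with
      | .start l => (.inl l : Option Bool ⊕ (M.Move × Option Bool) ⊕ (Bool × Option Bool) ⊕
          Option (TapeSym α))
      | .move m l => .inr (.inl (m, l))
      | .ans b l => .inr (.inr (.inl (b, l)))
      | .drain s => .inr (.inr (.inr (some s)))
      | .finish => .inr (.inr (.inr none))) (by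
    rintro (_ | _ | _ | _ | _) (_ | _ | _ | _ | _) h <;> simp_all)

/-- States of the device that checks transcripts. -/
inductive CSt (M : OracleNPDA α Ω Γ) : Type
  | idle | run (q : M.State) (ph : Phase) (l : Option Bool)

instance (M : OracleNPDA α Ω Γ) : Finite M.CSt :=
  have := M.finite_state
  Finite.of_injective
    (fun t : M.CSt => match t with
      | .idle => (none : Option (M.State × Phase × Option Bool))
      | .run q ph l => some (q, ph, l)) (by
    rintro (_ | _) (_ | _) h <;> simp_all)

/-- Steps of the device that checks transcripts; the stack symbol `none` separates the stacks of
consecutive computations. -/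
inductive CStep (M : OracleNPDA α Ω Γ) :
    M.CSt → M.Tok → Option (Option M.Stack) → M.CSt × List (Option M.Stack) → Prop
  | start (l t) :
      CStep M .idle (.start l) t (.run M.start .pre l, some M.bottom :: none :: t.toList)
  | move {m ph ph'} (l) (h1 : m.src ∉ M.halt) (h2 : m.src ≠ M.query) (hp : PhStep ph m.sym ph') :
      CStep M (.run m.src ph l) (.move m l) (some (some m.top)) (.run m.dst ph' l, m.push.map some)
  | ans (b l ph t) :
      CStep M (.run M.query ph (some b)) (.ans b l) t (.run (M.reply b) ph l, t.toList)
  | drain {q ph ph' s} (l t) (h : q ∈ M.acc) (hp : PhStep ph (some s) ph') :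
      CStep M (.run q ph l) (.drain s) t (.run q ph' l, t.toList)
  | finish {q} (t) (h : q ∈ M.acc) : CStep M (.run q .post none) .finish t (.idle, t.toList)

/-- Each entry names the move, the answer and the label, so the nondeterminism of the machine is
gone; only the phase is computed, and it is unique as well. -/
theorem CStep.unique {M : OracleNPDA α Ω Γ} (q : M.CSt) (a : M.Tok) (s : Option (Option M.Stack))
    (r r' : M.CSt × List (Option M.Stack)) (h : M.CStep q a s r) (h' : M.CStep q a s r') :
    r = r' := by
  cases h with
  | start => cases h'; rfl
  | @move m ph _ l _ _ hp =>
    generalize hc : CSt.run m.src ph l = c at h'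
    cases h' with
    | move _ _ _ hp' =>
      cases hc
      rw [hp.unique hp']
  | ans b l ph t =>
    generalize hc : CSt.run M.query ph (some b) = c at h'
    cases h'
    cases hc
    rfl
  | drain _ _ _ hp => cases h' with | drain _ _ _ hp' => rw [hp.unique hp']
  | finish => cases h'; rfl

namespace Tok

variable {M : OracleNPDA α Ω Γ}

/-- The letters read in a transcript, `none` being the end of a computation. -/
def rd : M.Tok → Option (Option α)
  | .move m _ => (letterOf m.sym).map some
  | .drain s => (letterOf (some s)).map some
  | .finish => some none
  | _ => none

/-- The symbols written on the output tape. -/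
def ot : M.Tok → Option Γ
  | .move m _ => m.out
  | _ => none

/-- The symbols of queries answered negatively, `none` being the end of a query. -/
def nq : M.Tok → Option (Option Ω)
  | .move m (some false) => m.qry.map some
  | .ans false _ => some none
  | _ => none

/-- The symbols written on the query tape and the ends of queries. -/
def fd : M.Tok → Option (Option Ω)
  | .move m _ => m.qry.map some
  | .ans _ _ => some none
  | .finish => some none
  | _ => none

/-- The label of an entry that starts a new query. -/
def label : M.Tok → Option Bool
  | .start l => l
  | .ans _ l => l
  | _ => none

end Tok

/-- The labels in a transcript announce the answers of the oracle `A`. -/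
def QueriesOk {M : OracleNPDA α Ω Γ} (A : Language Ω) (T : List M.Tok) : Prop :=
  ∀ u θ v b, T = u ++ θ :: v → θ.label = some b → (extract Tok.fd v ∈ A ↔ b = true)

variable {M : OracleNPDA α Ω Γ} {A : Language Ω}

theorem QueriesOk.suffix {u T : List M.Tok} (h : QueriesOk A (u ++ T)) : QueriesOk A T := by
  rintro u' θ v b rfl hb
  exact h (u ++ u') θ v b (by simp) hb

theorem QueriesOk.tail {θ : M.Tok} {T : List M.Tok} (h : QueriesOk A (θ :: T)) :
    QueriesOk A T :=
  QueriesOk.suffix (u := [θ]) h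

theorem QueriesOk.cons {θ : M.Tok} {T : List M.Tok} (h : QueriesOk A T)
    (hθ : ∀ b, θ.label = some b → (extract Tok.fd T ∈ A ↔ b = true)) : QueriesOk A (θ :: T) := by
  rintro u θ' v b hu hb
  cases u with
  | nil =>
    simp only [List.nil_append, List.cons.injEq] at hu
    obtain ⟨rfl, rfl⟩ := hu
    exact hθ b hb
  | cons c u =>
    simp only [List.cons_append, List.cons.injEq] at hu
    exact h u θ' v b hu.2 hb

/-- The entry `finish` stops the extraction of a query, so queries of the first transcript are not
altered by what follows. -/
theorem QueriesOk.append_finish {T T' : List M.Tok} (h : QueriesOk A (T ++ [.finish]))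
    (h' : QueriesOk A T') : QueriesOk A (T ++ [.finish] ++ T') := by
  induction T with
  | nil => exact h'.cons (by simp [Tok.label])
  | cons θ T ih =>
    refine (ih h.tail).cons fun b hb => ?_
    rw [extract_append _ ⟨.finish, by simp, rfl⟩]
    exact h [] θ _ b rfl hb

/-- In an accepting state the checking device admits only `drain` and `finish`, neither of which
writes output. -/
theorem exists_session_of_acc {q : M.State} {ph : Phase} {l : Option Bool}
    {s s' : List (Option M.Stack)} {T : List M.Tok}
    (h : Exec M.CStep (.run q ph l, s) T (.idle, s')) (hq : q ∈ M.acc) :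
    ∃ x U T' s₁, (ph = .post → x = []) ∧ T = U ++ T' ∧ T'.length < T.length ∧
      Exec M.CStep (.idle, s₁) T' (.idle, s') ∧
      T.filterMap Tok.rd = x.map some ++ none :: T'.filterMap Tok.rd ∧
      T.filterMap Tok.ot = T'.filterMap Tok.ot := by
  induction T generalizing ph s with
  | nil => cases h
  | cons θ T ih =>
    cases h with
    | cons hs h =>
      generalize s.head? = t at hs
      cases hs with
      | move _ h1 => exact absurd (.inl hq) h1
      | ans => exact absurd hq M.query_not_acc
      | @drain _ _ _ a _ _ _ hp =>
        obtain ⟨x, U, T', s₁, h1, rfl, h3, h4, h5, h6⟩ := ih h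
        refine ⟨(letterOf (some a)).toList ++ x, _ :: U, T', s₁, (hp.tapeAt h1).2, rfl,
          by simp, h4, ?_, ?_⟩
        · rw [List.filterMap_cons, h5]
          cases a <;> simp [Tok.rd, letterOf]
        · rw [List.filterMap_cons, h6]
          rfl
      | finish => exact ⟨[], [_], T, _, fun _ => rfl, rfl, by simp, h, rfl, rfl⟩

/-- Splits off the first computation of a transcript and replays it. The label of the current query
announces an answer that is given later, so the hypothesis on `l` joins the part `y` already written
to the part still to come in `T`. The separator `none` keeps the computation from using stack
contents left over by earlier ones. -/
theorem exists_session {q : M.State} {ph : Phase} {l : Option Bool} {v : List M.Stack}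
    {r s' : List (Option M.Stack)} {y : List Ω} {T : List M.Tok}
    (h : Exec M.CStep (.run q ph l, v.map some ++ none :: r) T (.idle, s')) (hQ : QueriesOk A T)
    (hl : ∀ b, l = some b → (y ++ extract Tok.fd T ∈ A ↔ b = true)) :
    ∃ x U T' s₁ o, (ph = .post → x = []) ∧ T = U ++ T' ∧ T'.length < T.length ∧
      Exec M.CStep (.idle, s₁) T' (.idle, s') ∧
      T.filterMap Tok.rd = x.map some ++ none :: T'.filterMap Tok.rd ∧
      T.filterMap Tok.ot = o ++ T'.filterMap Tok.ot ∧
      ∀ z, ∃ t c, M.Run A t ⟨q, tapeAt ph x, v, y, z⟩ c ∧ c.state ∈ M.acc ∧ c.output = z ++ o := by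
  by_cases hq : q ∈ M.acc
  · obtain ⟨x, U, T', s₁, h1, h2, h3, h4, h5, h6⟩ := exists_session_of_acc h hq
    exact ⟨x, U, T', s₁, [], h1, h2, h3, h4, h5, h6, fun z => ⟨0, _, .refl _, hq, by simp⟩⟩
  induction T generalizing q ph l v y with
  | nil => cases h
  | cons θ T ih =>
    -- after one entry, either an accepting state is reached or the induction hypothesis applies
    have next : ∀ {q ph l v y}, Exec M.CStep (.run q ph l, v.map some ++ none :: r) T (.idle, s') →
        (∀ b, l = some b → (y ++ extract Tok.fd T ∈ A ↔ b = true)) →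
        ∃ x U T' s₁ o, (ph = .post → x = []) ∧ T = U ++ T' ∧ T'.length < T.length ∧
          Exec M.CStep (.idle, s₁) T' (.idle, s') ∧
          T.filterMap Tok.rd = x.map some ++ none :: T'.filterMap Tok.rd ∧
          T.filterMap Tok.ot = o ++ T'.filterMap Tok.ot ∧
          ∀ z, ∃ t c, M.Run A t ⟨q, tapeAt ph x, v, y, z⟩ c ∧ c.state ∈ M.acc ∧
            c.output = z ++ o := by
      intro q ph l v y h hl
      by_cases hq : q ∈ M.acc
      · obtain ⟨x, U, T', s₁, h1, h2, h3, h4, h5, h6⟩ := exists_session_of_acc h hq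
        exact ⟨x, U, T', s₁, [], h1, h2, h3, h4, h5, h6, fun z => ⟨0, _, .refl _, hq, by simp⟩⟩
      · exact ih h hQ.tail hl hq
    cases h with
    | cons hs h =>
      generalize ht : (v.map some ++ none :: r).head? = t at hs
      cases hs with
      | @move m _ ph' _ h1 h2 hp =>
        cases v with
        | nil => simp at ht
        | cons a v =>
          simp only [List.map_cons, List.cons_append, List.head?_cons, Option.some.injEq] at ht
          subst ht
          simp only [List.map_cons, List.cons_append, List.tail_cons, ← List.append_assoc,
            ← List.map_append] at h
          obtain ⟨x, U, T', s₁, o, g1, rfl, g3, g4, g5, g6, g7⟩ := next (y := y ++ m.qry.toList) h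
            (fun b hb => by
              rw [List.append_assoc, ← extract_cons_map T (b := .move m l) rfl]
              exact hl b hb)
          obtain ⟨e1, e2⟩ := hp.tapeAt g1
          refine ⟨(letterOf m.sym).toList ++ x, _ :: U, T', s₁, m.out.toList ++ o, e2, rfl,
            by simp, g4, ?_, ?_, fun z => ?_⟩
          · rw [List.filterMap_cons, g5]
            cases hm : letterOf m.sym <;> simp [Tok.rd, hm]
          · rw [List.filterMap_cons, g6]
            cases hm : m.out <;> simp [Tok.ot, hm]
          · obtain ⟨t, c, hr, hc, ho⟩ := g7 (z ++ m.out.toList)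
            refine ⟨1 + t, c, .trans (.single ?_) hr, hc, by simp [ho]⟩
            rw [e1]
            have hm := m.mem
            cases hsym : m.sym with
            | none =>
              rw [hsym] at hm
              exact .silent h1 h2 hm
            | some s =>
              rw [hsym] at hm
              exact .read h1 h2 hm
      | ans b l' =>
        subst ht
        rw [head_toList_append_tail] at h
        obtain ⟨x, U, T', s₁, o, g1, rfl, g3, g4, g5, g6, g7⟩ := next (y := []) h
          (fun b hb => hQ [] _ _ b rfl hb)
        refine ⟨x, _ :: U, T', s₁, o, g1, rfl, by simp, g4, ?_, ?_, fun z => ?_⟩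
        · rw [List.filterMap_cons, g5]; rfl
        · rw [List.filterMap_cons, g6]; rfl
        · obtain ⟨t, c, hr, hc, ho⟩ := g7 z
          refine ⟨1 + t, c, .trans (.single (.answer ?_)) hr, hc, ho⟩
          have := hl b rfl
          rw [extract_cons_stop (f := Tok.fd) (b := .ans b l') _ rfl, List.append_nil] at this
          exact this.symm
      | drain _ _ hq' => exact absurd hq' hq
      | finish _ hq' => exact absurd hq' hq

theorem exists_session_of_idle {s s' : List (Option M.Stack)} {T : List M.Tok}
    (h : Exec M.CStep (.idle, s) T (.idle, s')) (hQ : QueriesOk A T) (hT : T ≠ []) :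
    ∃ x U T' s₁ o, T = U ++ T' ∧ T'.length < T.length ∧
      Exec M.CStep (.idle, s₁) T' (.idle, s') ∧
      T.filterMap Tok.rd = x.map some ++ none :: T'.filterMap Tok.rd ∧
      T.filterMap Tok.ot = o ++ T'.filterMap Tok.ot ∧ o ∈ M.outcomes A x := by
  cases h with
  | nil => exact absurd rfl hT
  | cons hs h =>
    generalize ht : s.head? = t at hs
    cases hs with
    | start l =>
      subst ht
      simp only [List.cons_append, head_toList_append_tail] at h
      obtain ⟨x, U, T', s₁, o, g1, rfl, g3, g4, g5, g6, g7⟩ :=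
        exists_session (v := [M.bottom]) (y := []) h hQ.tail (fun b hb => hQ [] _ _ b rfl hb)
      obtain ⟨t, c, hr, hc, ho⟩ := g7 []
      refine ⟨x, _ :: U, T', s₁, o, rfl, by simp, g4, ?_, ?_, t, c, hr, hc, ho⟩
      · rw [List.filterMap_cons, g5]; rfl
      · rw [List.filterMap_cons, g6]; rfl

/-- Every computation contributes one end mark to the letters read; as there is just one mark,
nothing follows the first computation. -/
theorem mem_outcomes_of_transcript {s s' : List (Option M.Stack)} {T : List M.Tok} {x : List α}
    (h : Exec M.CStep (.idle, s) T (.idle, s')) (hQ : QueriesOk A T)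
    (hx : T.filterMap Tok.rd = x.map some ++ [none]) : T.filterMap Tok.ot ∈ M.outcomes A x := by
  obtain ⟨x', U, T', s₁, o, rfl, g2, g3, g4, g5, g6⟩ :=
    exists_session_of_idle h hQ (by rintro rfl; simp at hx)
  rw [g4] at hx
  obtain ⟨rfl, hT'⟩ := map_some_append_none_inj hx
  obtain rfl : T' = [] := by
    by_contra hne
    obtain ⟨x'', _, _, _, _, _, _, _, g7, _⟩ := exists_session_of_idle g3 hQ.suffix hne
    rw [hT'] at g7
    simp at g7
  rw [g5]
  simpa using g6

theorem exists_words_of_transcript {s s' : List (Option M.Stack)} {T : List M.Tok}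
    (h : Exec M.CStep (.idle, s) T (.idle, s')) (hQ : QueriesOk A T) :
    ∃ xs, T.filterMap Tok.rd = encWords xs ∧ ∀ x ∈ xs, x ∈ M.accepts A := by
  induction hn : T.length using Nat.strong_induction_on generalizing T s with
  | _ n ih =>
    by_cases hT : T = []
    · exact ⟨[], by simp [hT, encWords], by simp⟩
    · obtain ⟨x, U, T', s₁, o, rfl, g2, g3, g4, g5, t, c, hr, hc, -⟩ :=
        exists_session_of_idle h hQ hT
      obtain ⟨xs, h1, h2⟩ := ih _ (hn ▸ g2) g3 hQ.suffix rfl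
      refine ⟨x :: xs, by rw [g4, h1, encWords_cons], ?_⟩
      simp only [List.mem_cons, forall_eq_or_imp]
      exact ⟨⟨t, c, hr, hc⟩, h2⟩

/-- The part of a query with a negative answer that has already been written. -/
def pending : M.CSt → List Ω → List (Option Ω)
  | .run _ _ (some false), y => y.map some
  | _, _ => []

theorem pending_nil (c : M.CSt) : pending c [] = [] := by
  rcases c with _ | ⟨_, _, _ | _ | _⟩ <;> rfl

/-- Independent of any oracle: the device forces every move to carry the label of the current query,
and a labelled query to be answered as announced. Hence the symbols selected by `Tok.nq` are exactly
the negatively labelled queries, one after the other. -/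
theorem extract_mem_of_negative {c : M.CSt} {s s' : List (Option M.Stack)} {T : List M.Tok}
    {y : List Ω} {ys : List (List Ω)} (h : Exec M.CStep (c, s) T (.idle, s'))
    (hy : pending c y ++ T.filterMap Tok.nq = encWords ys) :
    (∀ q ph, c = .run q ph (some false) → y ++ extract Tok.fd T ∈ ys) ∧
      ∀ u θ v, T = u ++ θ :: v → θ.label = some false → extract Tok.fd v ∈ ys := by
  induction T generalizing c s y ys with
  | nil =>
    cases h
    exact ⟨nofun, by simp⟩
  | cons θ T ih =>
    cases h with
    | @cons _ _ _ p _ _ _ hs h =>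
      -- it is enough to treat the first entry
      suffices (∀ q ph, c = .run q ph (some false) → y ++ extract Tok.fd (θ :: T) ∈ ys) ∧
          (θ.label = some false → extract Tok.fd T ∈ ys) ∧
          ∀ u θ v, T = u ++ θ :: v → θ.label = some false → extract Tok.fd v ∈ ys by
        refine ⟨this.1, fun u θ' v hu hl => ?_⟩
        cases u with
        | nil =>
          simp only [List.nil_append, List.cons.injEq] at hu
          obtain ⟨rfl, rfl⟩ := hu
          exact this.2.1 hl
        | cons a u =>
          simp only [List.cons_append, List.cons.injEq] at hu
          exact this.2.2 u θ' v hu.2 hl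
      generalize s.head? = t at hs
      cases hs with
      | start l =>
        obtain ⟨h1, h2⟩ := ih (y := []) (ys := ys) h (by
          rw [pending_nil]
          exact hy)
        exact ⟨nofun, fun hl => h1 _ _ (by rw [← hl]; rfl), h2⟩
      | @move m ph ph' l _ _ hp =>
        rcases l with _ | _ | _
        · obtain ⟨h1, h2⟩ := ih (y := y) (ys := ys) h hy
          exact ⟨nofun, nofun, h2⟩
        · obtain ⟨h1, h2⟩ := ih (y := y ++ m.qry.toList) (ys := ys) h (by
            rw [← hy, List.filterMap_cons]
            cases hm : m.qry <;> simp [Tok.nq, pending, hm])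
          refine ⟨fun q ph _ => ?_, nofun, h2⟩
          rw [extract_cons_map T (b := .move m _) rfl, ← List.append_assoc]
          exact h1 _ _ rfl
        · obtain ⟨h1, h2⟩ := ih (y := y) (ys := ys) h hy
          exact ⟨nofun, nofun, h2⟩
      | ans b l =>
        cases b with
        | false =>
          obtain ⟨ys, rfl, hys⟩ := encWords_eq_append hy
          obtain ⟨h1, h2⟩ := ih (y := []) (ys := ys) h (by rw [pending_nil]; exact hys)
          refine ⟨fun q ph _ => ?_, fun hl => .tail _ (h1 _ _ (by rw [← hl]; rfl)),
            fun u θ v hu hl => .tail _ (h2 u θ v hu hl)⟩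
          rw [extract_cons_stop (f := Tok.fd) (b := .ans false l) _ rfl]
          simp
        | true =>
          obtain ⟨h1, h2⟩ := ih (y := []) (ys := ys) h (by
            rw [pending_nil]
            exact hy)
          exact ⟨nofun, fun hl => h1 _ _ (by rw [← hl]; rfl), h2⟩
      | drain l _ _ hp =>
        obtain ⟨h1, h2⟩ := ih (y := y) (ys := ys) h (by
          rw [← hy]
          rcases l with _ | _ | _ <;> rfl)
        refine ⟨fun q ph hc => ?_, nofun, h2⟩
        cases hc
        exact h1 _ _ rfl
      | finish =>
        obtain ⟨h1, h2⟩ := ih (y := y) (ys := ys) h hy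
        exact ⟨nofun, nofun, h2⟩

theorem exec_drain {q : M.State} (hq : q ∈ M.acc) (ph : Phase) {x : List α}
    (hx : ph = .post → x = []) (s : List (Option M.Stack)) :
    Exec M.CStep (.run q ph none, s) ((tapeAt ph x).map .drain ++ [.finish]) (.idle, s) := by
  have one : ∀ {ph ph' a}, PhStep ph (some a) ph' → ∀ {T d},
      Exec M.CStep (.run q ph' none, s) T d →
      Exec M.CStep (.run q ph none, s) (.drain a :: T) d := by
    intro ph ph' a hp T d h
    refine .cons (.drain none _ hq hp) ?_
    rwa [head_toList_append_tail]
  have post : Exec M.CStep (.run q .post none, s) [.finish] (.idle, s) := by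
    refine .cons (.finish _ hq) ?_
    rw [head_toList_append_tail]
    exact .nil _
  have mid : ∀ x : List α, Exec M.CStep (.run q .mid none, s)
      ((tapeAt .mid x).map .drain ++ [.finish]) (.idle, s) := by
    intro x
    induction x with
    | nil => exact one .right post
    | cons a x ih => exact one (.letter a) ih
  cases ph with
  | pre => exact one .left (mid x)
  | mid => exact mid x
  | post => exact post

/-- Induction on the first step of the run, so that the transcript is built from its end: the label
to be put on an entry depends on an answer in the future and is supplied by the part already
constructed. -/
theorem exists_transcript_of_run {t : ℕ} {q : M.State} {ph : Phase} {x : List α}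
    {v : List M.Stack} {y : List Ω} {z : List Γ} {e : M.Cfg}
    (h : M.Run A t ⟨q, tapeAt ph x, v, y, z⟩ e) (he : e.state ∈ M.acc)
    (hx : ph = .post → x = []) :
    ∃ l T₀ T, T = T₀ ++ [.finish] ∧
      (∀ r, ∃ s, Exec M.CStep (.run q ph l, v.map some ++ none :: r) T (.idle, s)) ∧
      (∀ b, l = some b → (y ++ extract Tok.fd T ∈ A ↔ b = true)) ∧ QueriesOk A T ∧
      T.filterMap Tok.rd = x.map some ++ [none] ∧ e.output = z ++ T.filterMap Tok.ot ∧
      (∃ ys, (∀ y ∈ ys, y ∉ A) ∧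
        pending (.run q ph l : M.CSt) y ++ T.filterMap Tok.nq = encWords ys) ∧
      T.length ≤ t + x.length + 3 := by
  induction t generalizing q ph x v y z with
  | zero =>
    obtain ⟨-, rfl⟩ | ⟨_, _, h, -⟩ := h.cases_head
    · have hdr : ∀ w : List (TapeSym α), (w.map (.drain : _ → M.Tok)).filterMap Tok.ot = [] ∧
          (w.map (.drain : _ → M.Tok)).filterMap Tok.nq = [] := by
        intro w
        induction w with
        | nil => simp
        | cons a w ih => simp [Tok.ot, Tok.nq]
      -- The current query is never submitted, hence the label `none`. The unread tape has at most
      -- `x.length + 2` cells, and `finish` adds the third unit of the length bound.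
      refine ⟨none, (tapeAt ph x).map .drain, _, rfl, fun r => ⟨_, exec_drain he ph hx _⟩, nofun,
        ?_, ?_, ?_, ⟨[], by simp, ?_⟩, ?_⟩
      · generalize tapeAt ph x = w
        induction w with
        | nil => exact QueriesOk.cons (by simp [QueriesOk]) nofun
        | cons a w ih => exact ih.cons nofun
      · have hm : ∀ x : List α, ((x.map TapeSym.letter).map (.drain : _ → M.Tok)).filterMap Tok.rd
            = x.map some := by
          intro x
          induction x with
          | nil => rfl
          | cons a x ih => simpa [Tok.rd, letterOf] using ih
        have hm' : ((tapeAt .mid x).map (.drain : _ → M.Tok) ++ [Tok.finish]).filterMap Tok.rd =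
            x.map some ++ [none] := by
          rw [tapeAt, List.map_append, List.filterMap_append, List.filterMap_append, hm]
          change (x.map some ++ []) ++ [none] = _
          simp
        cases ph with
        | pre => exact hm'
        | mid => exact hm'
        | post => simp [hx rfl, tapeAt, Tok.rd]
      · simp [(hdr _).1, Tok.ot]
      · simp [(hdr _).2, Tok.nq, pending, encWords]
      · cases ph <;> simp [tapeAt, inputTape]
    · simp at h
  | succ t ih =>
    obtain ⟨h, -⟩ | ⟨t, d, ht, hs, hr⟩ := h.cases_head
    · simp at h
    cases ht
    rcases hs.inversion with ⟨h1, h2, p, a, u, v', b, o, hst, h⟩ | ⟨h1, h⟩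
    · simp only at hst
      subst hst
      have key : ∀ {s ph' x'}, (p, u, b, o) ∈ M.δ q s a → PhStep ph s ph' →
          x = (letterOf s).toList ++ x' → (ph' = .post → x' = []) →
          d = ⟨p, tapeAt ph' x', u ++ v', y ++ b.toList, z ++ o.toList⟩ →
          ∃ l T₀ T, T = T₀ ++ [.finish] ∧
            (∀ r, ∃ s, Exec M.CStep (.run q ph l, (a :: v').map some ++ none :: r) T (.idle, s)) ∧
            (∀ b, l = some b → (y ++ extract Tok.fd T ∈ A ↔ b = true)) ∧ QueriesOk A T ∧
            T.filterMap Tok.rd = x.map some ++ [none] ∧ e.output = z ++ T.filterMap Tok.ot ∧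
            (∃ ys, (∀ y ∈ ys, y ∉ A) ∧
              pending (.run q ph l : M.CSt) y ++ T.filterMap Tok.nq = encWords ys) ∧
            T.length ≤ t + 1 + x.length + 3 := by
        rintro s ph' x' hm hp rfl hx' rfl
        obtain ⟨l, T₀, T, rfl, g2, g3, g4, g5, g6, ⟨ys, g7, g8⟩, g9⟩ := ih hr hx'
        let m : M.Move := ⟨q, s, a, p, u, b, o, hm⟩
        refine ⟨l, .move m l :: T₀, _, rfl, fun r => ?_, fun b hb => ?_, ?_, ?_, ?_, ⟨ys, g7, ?_⟩,
          ?_⟩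
        · obtain ⟨s', hs'⟩ := g2 r
          refine ⟨s', .cons (.move (m := m) l h1 h2 hp) ?_⟩
          simpa [m] using hs'
        · rw [List.cons_append, extract_cons_map (f := Tok.fd) _ (b := .move m l) (o := m.qry) rfl,
            ← List.append_assoc]
          exact g3 b hb
        · exact g4.cons nofun
        · rw [List.cons_append, List.filterMap_cons, g5]
          cases hs : letterOf s <;> simp [Tok.rd, m, hs]
        · rw [List.cons_append, List.filterMap_cons, g6]
          cases o <;> simp [Tok.ot, m]
        · rw [← g8, List.cons_append, List.filterMap_cons]
          rcases l with _ | _ | _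
          · rfl
          · cases b <;> simp [Tok.nq, m, pending]
          · rfl
        · simp only [List.cons_append, List.length_cons, List.length_append] at g9 ⊢
          omega
      rcases h with ⟨s, w, hw, hδ, rfl⟩ | ⟨hδ, rfl⟩
      · obtain ⟨ph', x', e1, e2, rfl, e4⟩ := exists_phStep hw
        exact key hδ e1 e2 e4 rfl
      · exact key hδ (.silent ph) rfl hx rfl
    · simp only at h1
      subst h1
      have key : ∀ b, (b = true ↔ y ∈ A) → d = ⟨M.reply b, tapeAt ph x, v, [], z⟩ →
          ∃ l T₀ T, T = T₀ ++ [.finish] ∧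
            (∀ r, ∃ s, Exec M.CStep (.run M.query ph l, v.map some ++ none :: r) T (.idle, s)) ∧
            (∀ b, l = some b → (y ++ extract Tok.fd T ∈ A ↔ b = true)) ∧ QueriesOk A T ∧
            T.filterMap Tok.rd = x.map some ++ [none] ∧ e.output = z ++ T.filterMap Tok.ot ∧
            (∃ ys, (∀ y ∈ ys, y ∉ A) ∧
              pending (.run M.query ph l : M.CSt) y ++ T.filterMap Tok.nq = encWords ys) ∧
            T.length ≤ t + 1 + x.length + 3 := by
        rintro b hb rfl
        obtain ⟨l, T₀, T, rfl, g2, g3, g4, g5, g6, ⟨ys, g7, g8⟩, g9⟩ := ih hr hx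
        rw [pending_nil, List.nil_append] at g8
        -- The label before the answer is the answer itself, and `l` from the rest announces the
        -- next query.
        refine ⟨some b, .ans b l :: T₀, _, rfl, fun r => ?_, ?_, ?_, ?_, ?_, ?_, ?_⟩
        · obtain ⟨s', hs'⟩ := g2 r
          refine ⟨s', .cons (.ans b l ph _) ?_⟩
          rwa [head_toList_append_tail]
        · rintro b' h
          cases h
          rw [List.cons_append, extract_cons_stop (f := Tok.fd) (b := .ans b l) _ rfl,
            List.append_nil, hb]
        · exact g4.cons g3
        · rw [List.cons_append, List.filterMap_cons, g5]; rfl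
        · rw [List.cons_append, List.filterMap_cons, g6]; rfl
        · cases b with
          | false =>
            refine ⟨y :: ys, ?_, ?_⟩
            · simp only [List.mem_cons, forall_eq_or_imp]
              exact ⟨fun h => by simpa using hb.2 h, g7⟩
            · rw [encWords_cons, ← g8]
              rfl
          | true => exact ⟨ys, g7, g8⟩
        · simp only [List.cons_append, List.length_cons, List.length_append] at g9 ⊢
          omega
      rcases h with ⟨h, rfl⟩ | ⟨h, rfl⟩
      · exact key true ⟨fun _ => h, fun _ => rfl⟩ rfl
      · exact key false ⟨nofun, fun h' => absurd h' h⟩ rfl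

theorem exists_transcript {t : ℕ} {x : List α} {e : M.Cfg} (h : M.Run A t (M.init x) e)
    (he : e.state ∈ M.acc) :
    ∃ T₀ T, T = T₀ ++ [.finish] ∧ (∀ s, ∃ s', Exec M.CStep (.idle, s) T (.idle, s')) ∧
      QueriesOk A T ∧ T.filterMap Tok.rd = x.map some ++ [none] ∧ T.filterMap Tok.ot = e.output ∧
      (∃ ys, (∀ y ∈ ys, y ∉ A) ∧ T.filterMap Tok.nq = encWords ys) ∧
      T.length ≤ t + x.length + 4 := by
  obtain ⟨l, T₀, T, rfl, g2, g3, g4, g5, g6, ⟨ys, g7, g8⟩, g9⟩ :=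
    exists_transcript_of_run (ph := .pre) (x := x) h he nofun
  rw [pending_nil, List.nil_append] at g8
  refine ⟨.start l :: T₀, _, rfl, fun s => ?_, g4.cons g3, ?_, ?_, ⟨ys, g7, ?_⟩, ?_⟩
  · obtain ⟨s', hs'⟩ := g2 s
    refine ⟨s', .cons (.start l _) ?_⟩
    simpa [head_toList_append_tail] using hs'
  · rw [← g5]; rfl
  · rw [g6]; rfl
  · rw [← g8]; rfl
  · simp only [List.cons_append, List.length_cons, List.length_append] at g9 ⊢
    omega

/-- A word `x` costs at most `a * x.length + b` moves and answers and `x.length + 4` further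
entries, which is within `a + b + 4` times `x.length + 1`, its share in `encWords`. -/
theorem exists_transcript_of_words {a b : ℕ}
    (hM : ∀ (x : List α) t c, M.Run A t (M.init x) c → t ≤ a * x.length + b)
    {xs : List (List α)} (h : ∀ x ∈ xs, x ∈ M.accepts A) :
    ∃ T : List M.Tok, (∀ s, ∃ s', Exec M.CStep (.idle, s) T (.idle, s')) ∧ QueriesOk A T ∧
      T.filterMap Tok.rd = encWords xs ∧ T.length ≤ (a + b + 4) * (encWords xs).length := by
  induction xs with
  | nil => exact ⟨[], fun s => ⟨s, .nil _⟩, by simp [QueriesOk], rfl, by simp⟩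
  | cons x xs ih =>
    simp only [List.mem_cons, forall_eq_or_imp] at h
    obtain ⟨T', h1, h2, h3, h4⟩ := ih h.2
    obtain ⟨t, c, hr, hc⟩ := h.1
    obtain ⟨T₀, T, rfl, g2, g3, g4, -, -, g7⟩ := exists_transcript hr hc
    refine ⟨T₀ ++ [.finish] ++ T', fun s => ?_, g3.append_finish h2, ?_, ?_⟩
    · obtain ⟨s₁, hs₁⟩ := g2 s
      obtain ⟨s₂, hs₂⟩ := h1 s₁
      exact ⟨s₂, hs₁.append hs₂⟩
    · rw [List.filterMap_append, g4, h3, encWords_cons]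
      simp
    · have := hM _ _ _ hr
      rw [List.length_append, encWords_cons]
      simp only [List.length_append, List.length_map, List.length_cons] at *
      nlinarith [Nat.zero_le (b * x.length), Nat.zero_le x.length]

end OracleNPDA

/-! ### Guessing a certificate and submitting it as a single query -/

section Generator

variable {α Θ : Type}

/-- Steps of the generator: it copies its input, marks its end by `none`, and in between writes
at most `C` symbols of `Θ` per input letter. -/
inductive GStep (α Θ : Type) (C : ℕ) : Option (Fin (C + 1)) → Option α →
    Option (Fin (C + 1)) × Option (Option α ⊕ Θ) → Prop
  | write {i j} (h : j < i) (θ) : GStep α Θ C (some i) none (some j, some (.inr θ))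
  | finish (i) : GStep α Θ C (some i) none (none, some (.inl none))
  | read (i a) : GStep α Θ C (some i) (some a) (some (Fin.last C), some (.inl (some a)))

/-- The program that writes the input, interspersed with arbitrary symbols of `Θ`, on the query
tape. -/
abbrev genProg (α Θ : Type) [Finite α] [Finite Θ] (C : ℕ) : Prog α (Option α ⊕ Θ) where
  Q := Option (Fin (C + 1))
  S := Empty
  finite_Q := inferInstance
  finite_S := inferInstance
  δ q a _ := {r | GStep α Θ C q a (r.1, r.2.2) ∧ r.2.1 = []}
  finite_δ q a _ := by
    have : (Set.univ ×ˢ {[]} ×ˢ Set.univ :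
        Set (Option (Fin (C + 1)) × List Empty × Option (Option α ⊕ Θ))).Finite :=
      Set.finite_univ.prod ((Set.finite_singleton _).prod Set.finite_univ)
    exact this.subset fun r hr => ⟨trivial, hr.2, trivial⟩
  start := some (Fin.last C)
  verdict q b := q = none ∧ b = true
  rank q := match q with
    | none => 0
    | some i => i + 1
  rank_lt := by
    rintro q s ⟨p, u, o⟩ ⟨h, -⟩
    cases h with
    | write h => simpa using h
    | finish => simp

variable [Finite α] [Finite Θ] {C : ℕ}

theorem genProg_reach {x : List α} {q v} {w : List (Option α ⊕ Θ)}
    (h : (genProg α Θ C).Reach x q v w) :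
    w.filterMap Sum.getLeft? = x.map some ++ if q = none then [none] else [] := by
  induction h with
  | init => simp
  | read h h' ih =>
    obtain ⟨h', -⟩ := h'
    generalize hr : ((_, _) : Option (Fin (C + 1)) × Option (Option α ⊕ Θ)) = r at h'
    cases h' with
    | read =>
      simp only [Prod.mk.injEq] at hr
      obtain ⟨rfl, rfl⟩ := hr
      simp [ih]
  | silent h h' ih =>
    obtain ⟨h', -⟩ := h'
    generalize hr : ((_, _) : Option (Fin (C + 1)) × Option (Option α ⊕ Θ)) = r at h'
    cases h' with
    | write =>
      simp only [Prod.mk.injEq] at hr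
      obtain ⟨rfl, rfl⟩ := hr
      simp [ih]
    | finish =>
      simp only [Prod.mk.injEq] at hr
      obtain ⟨rfl, rfl⟩ := hr
      simp [ih]

theorem genProg_write {x : List α} {i : Fin (C + 1)} {w : List (Option α ⊕ Θ)}
    (h : (genProg α Θ C).Reach x (some i) [] w) {m : List Θ} (hm : m.length ≤ i) :
    ∃ j : Fin (C + 1), (genProg α Θ C).Reach x (some j) [] (w ++ m.map .inr) := by
  induction m generalizing i w with
  | nil => exact ⟨i, by simpa using h⟩
  | cons θ m ih =>
    simp only [List.length_cons] at hm
    have hi := i.2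
    have := h.silent (p := some (⟨i - 1, by omega⟩ : Fin (C + 1))) (u := [])
      (b := some (.inr θ)) ⟨.write (by rw [Fin.lt_def]; change i.val - 1 < i.val; omega) θ, rfl⟩
    obtain ⟨j, hj⟩ := ih this (by simp; omega)
    exact ⟨j, by simpa using hj⟩

omit [Finite α] [Finite Θ] in
theorem filterMap_getRight_append (w : List (Option α ⊕ Θ)) (m : List Θ) (a : Option α) :
    (w ++ m.map Sum.inr ++ [Sum.inl a]).filterMap Sum.getRight? =
      w.filterMap Sum.getRight? ++ m := by
  rw [List.filterMap_append, List.filterMap_append, List.filterMap_map]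
  have : Sum.getRight? ∘ (Sum.inr : Θ → Option α ⊕ Θ) = some := rfl
  rw [this, List.filterMap_some]
  exact List.append_nil _

theorem genProg_exists_reach {x : List α} {m : List Θ} (hm : m.length ≤ C * x.length) :
    ∃ w, (genProg α Θ C).Reach x (some (Fin.last C)) [] w ∧ w.filterMap Sum.getRight? = m := by
  induction x using List.reverseRecOn generalizing m with
  | nil =>
    obtain rfl : m = [] := by simpa using hm
    exact ⟨[], .init, rfl⟩
  | append_singleton x a ih =>
    simp only [List.length_append, List.length_singleton, Nat.mul_add, Nat.mul_one] at hm
    -- All but the last batch of at most `C` symbols is distributed over the earlier letters; the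
    -- last batch is written just before `a`.
    obtain ⟨w, h1, h2⟩ := ih (m := m.take (C * x.length)) (by simp)
    obtain ⟨j, hj⟩ := genProg_write h1 (m := m.drop (C * x.length)) (by simp; omega)
    refine ⟨_, hj.read (p := some (Fin.last C)) (u := []) (b := some (.inl (some a)))
      ⟨.read j a, rfl⟩, ?_⟩
    exact (filterMap_getRight_append _ _ _).trans (by rw [h2, List.take_append_drop])

theorem genProg_exists_reach_end {x : List α} {m : List Θ} (hm : m.length ≤ C * (x.length + 1)) :
    ∃ w, (genProg α Θ C).Reach x none [] w ∧ w.filterMap Sum.getRight? = m := by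
  simp only [Nat.mul_add, Nat.mul_one] at hm
  obtain ⟨w, h1, h2⟩ := genProg_exists_reach (C := C) (x := x) (m := m.take (C * x.length)) (by simp)
  obtain ⟨j, hj⟩ := genProg_write h1 (m := m.drop (C * x.length)) (by simp; omega)
  refine ⟨_, hj.silent (p := (none : Option (Fin (C + 1)))) (u := []) (b := some (.inl none))
    ⟨.finish j, rfl⟩, ?_⟩
  exact (filterMap_getRight_append _ _ _).trans (by rw [h2, List.take_append_drop])

/-- The generator has no control over how the guessed symbols interleave with the input beyond the
limit of `C` per gap, so completeness is demanded for every interleaving. One gap more than there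
are letters gives the bound `C * (x.length + 1)`. -/
theorem recog_of_certificates {L : Language α} {D : Language (Option α ⊕ Θ)} (C : ℕ)
    (sound : ∀ x w, w ∈ D → w.filterMap Sum.getLeft? = x.map some ++ [none] → x ∈ L)
    (complete : ∀ x ∈ L, ∃ m : List Θ, m.length ≤ C * (x.length + 1) ∧
      ∀ w : List (Option α ⊕ Θ), w.filterMap Sum.getLeft? = x.map some ++ [none] →
        w.filterMap Sum.getRight? = m → w ∈ D) : L ∈ Recog D α := by
  refine ⟨(genProg α Θ C).machine, Prog.machine_terminates _, ?_⟩
  ext x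
  rw [Prog.mem_accepts_machine]
  constructor
  · intro hx
    obtain ⟨m, hm, h⟩ := complete x hx
    obtain ⟨w, h1, h2⟩ := genProg_exists_reach_end hm
    exact ⟨none, [], w, true, h1, by simpa using h w (by simpa using genProg_reach h1) h2, rfl, rfl⟩
  · rintro ⟨q, v, w, b, h, hb, rfl, rfl⟩
    exact sound x w (hb.1 rfl) (by simpa using genProg_reach h)

end Generator

/-! ### Recognizing two-track words -/

section Track

variable {α Γ σ : Type}

/-- Steps of the device that checks that a word is of the form `track x y` and runs `D` on it. -/
def TrackStep (D : DFA (Option α × Option Γ) σ) (q : σ × Bool × Bool) (a : Option α × Option Γ)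
    (_ : Option Empty) (r : (σ × Bool × Bool) × List Empty) : Prop :=
  a ≠ (none, none) ∧ (q.2.1 = true → a.1 = none) ∧ (q.2.2 = true → a.2 = none) ∧
    r = ((D.step q.1 a, a.1.isNone, a.2.isNone), [])

/-- The flags `f` and `g` record that the upper or the lower track has ended; a track that has ended
must not resume, and this together with the exclusion of `(none, none)` characterizes correct
padding. -/
theorem TrackStep.sound {D : DFA (Option α × Option Γ) σ} {st : σ} {f g : Bool}
    {T : List (Option α × Option Γ)} {q : σ × Bool × Bool} {s v : List Empty}
    (h : Exec (TrackStep D) ((st, f, g), s) T (q, v)) :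
    T = track (T.filterMap Prod.fst) (T.filterMap Prod.snd) ∧ q.1 = D.evalFrom st T ∧
      (f = true → T.filterMap Prod.fst = []) ∧ (g = true → T.filterMap Prod.snd = []) := by
  induction T generalizing st f g s with
  | nil =>
    cases h
    simp [track, DFA.evalFrom]
  | cons a T ih =>
    cases h with
    | cons hs h =>
      obtain ⟨h1, h2, h3, h4⟩ := hs
      cases h4
      obtain ⟨e1, e2, e3, e4⟩ := ih h
      obtain ⟨a, b⟩ := a
      refine ⟨?_, e2, ?_, ?_⟩
      · rcases a with _ | a <;> rcases b with _ | b
        · simp at h1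
        · conv_lhs => rw [e1]
          simp [track, e3 rfl]
        · conv_lhs => rw [e1]
          simp [track, e4 rfl]
        · conv_lhs => rw [e1]
          simp [track]
      · intro hf
        cases h2 hf
        simpa using e3 rfl
      · intro hg
        cases h3 hg
        simpa using e4 rfl

theorem TrackStep.complete (D : DFA (Option α × Option Γ) σ) (st : σ) (f g : Bool) (x : List α)
    (y : List Γ) (hf : f = true → x = []) (hg : g = true → y = []) :
    ∃ f' g', Exec (TrackStep D) ((st, f, g), []) (track x y)
      ((D.evalFrom st (track x y), f', g'), []) := by
  have step : ∀ {st f g a b T q}, (a, b) ≠ (none, none) → (f = true → a = none) →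
      (g = true → b = none) →
      Exec (TrackStep D) ((D.step st (a, b), a.isNone, b.isNone), []) T q →
      Exec (TrackStep D) ((st, f, g), []) ((a, b) :: T) q := fun h1 h2 h3 h4 =>
    .cons ⟨h1, h2, h3, rfl⟩ h4
  induction x generalizing st f g y with
  | nil =>
    induction y generalizing st f g with
    | nil => exact ⟨f, g, .nil _⟩
    | cons b y ih =>
      obtain ⟨f', g', h⟩ := ih (D.step st (none, some b)) true false (by simp) (by simp)
      exact ⟨f', g', step (by simp) (by simp) (fun h => by simpa using hg h) h⟩
  | cons a x ih =>
    cases y with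
    | nil =>
      obtain ⟨f', g', h⟩ := ih (D.step st (some a, none)) false true [] (by simp) (by simp)
      have e : track (a :: x) ([] : List Γ) = (some a, none) :: track x [] := by simp [track]
      rw [e]
      exact ⟨f', g', step (by simp) (fun h => by simpa using hf h) (by simp) h⟩
    | cons b y =>
      obtain ⟨f', g', h⟩ := ih (D.step st (some a, some b)) false false y (by simp) (by simp)
      exact ⟨f', g', step (by simp) (fun h => by simpa using hf h)
        (fun h => by simpa using hg h) h⟩

theorem track_filterMap_fst (x : List α) (y : List Γ) : (track x y).filterMap Prod.fst = x := by
  induction x generalizing y with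
  | nil => simp [track, List.filterMap_map]
  | cons a x ih =>
    cases y with
    | nil => simp [track]
    | cons b y => simpa [track] using ih y

theorem track_filterMap_snd (x : List α) (y : List Γ) : (track x y).filterMap Prod.snd = y := by
  induction x generalizing y with
  | nil => simp [track, List.filterMap_map]
  | cons a x ih =>
    cases y with
    | nil => simp [track]
    | cons b y => simpa [track] using ih y

theorem track_length_le (x : List α) (y : List Γ) :
    (track x y).length ≤ x.length + y.length := by
  induction x generalizing y with
  | nil => simp [track]
  | cons a x ih =>
    cases y with
    | nil => simp [track]
    | cons b y =>
      have := ih y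
      simp only [track, List.zipWithAll_cons_cons, List.length_cons] at this ⊢
      omega

end Track

/-! ### Comparing subsequences and testing queries inside a word -/

/-- Since no symbol contributes to both subsequences, the word can be read as an interleaving of two
tracks, one letter at a time. -/
theorem recog_filterMap_ne {β X Ω : Type} [Finite X] (A : Language Ω) (f g : β → Option X)
    (hfg : ∀ b, f b = none ∨ g b = none) :
    {w | w.filterMap f ≠ w.filterMap g} ∈ Recog A β := by
  let k : β → Option (Bool × X) := fun b =>
    (f b).elim ((g b).map fun x => (true, x)) fun x => some (false, x)
  convert recog_comap (recog_queue (X := X) A) k using 1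
  ext w
  have h1 : onTrack false (w.filterMap k) = w.filterMap f := by
    rw [onTrack, List.filterMap_filterMap]
    congr 1
    funext b
    rcases hb : f b with _ | x <;> rcases hb' : g b with _ | y <;> simp [k, hb, hb']
  have h2 : onTrack true (w.filterMap k) = w.filterMap g := by
    rw [onTrack, List.filterMap_filterMap]
    congr 1
    funext b
    have := hfg b
    rcases hb : f b with _ | x <;> rcases hb' : g b with _ | y <;> simp_all [k]
  change _ ↔ onTrack false (w.filterMap k) ≠ onTrack true (w.filterMap k)
  rw [h1, h2]
  rfl

open OracleNPDA in
/-- If some query with label `b` in the transcript of a machine belongs to `L`, this can be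
recognized. -/
theorem recog_queries {α Ω Γ Ω' β : Type} [Finite α] [Finite Ω] {M : OracleNPDA α Ω Γ}
    {A : Language Ω'} {L : Language Ω} (hL : L ∈ Recog A Ω) (f : β → Option M.Tok) (b : Bool) :
    {w | ∃ u θ v, w.filterMap f = u ++ θ :: v ∧ θ.label = some b ∧ extract Tok.fd v ∈ L} ∈
      Recog A β := by
  have := recog_segment hL (fun θ : Option M.Tok => ∃ θ', θ = some θ' ∧ θ'.label = some b) Tok.fd
  convert recog_comap this f using 1
  ext w
  constructor
  · rintro ⟨u, θ, v, h1, h2, h3⟩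
    exact ⟨v, .inr ⟨u, θ, h1, θ, rfl, h2⟩, h3⟩
  · rintro ⟨v, ⟨⟨_, h, _⟩, -⟩ | ⟨u, θ, h1, θ', h, h2⟩, h3⟩
    · simp at h
    · cases h
      exact ⟨u, θ, v, h1, h2, h3⟩

/-! ### Certificates for membership in an advised regular language -/

section Advice

open OracleNPDA

variable {α Ω Γ Ω' σ : Type}

/-- The symbols of certificates, besides those of the input: entries of a transcript of the
machine `M` computing a function with an oracle `A`, entries of transcripts of the machine `M'`
recognizing the complement of `A`, and symbols of two-track words. -/
abbrev CertSym (M : OracleNPDA α Ω Γ) (M' : OracleNPDA Ω Ω' Empty) : Type :=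
  M.Tok ⊕ M'.Tok ⊕ (Option α × Option Γ)

variable (M : OracleNPDA α Ω Γ) (M' : OracleNPDA Ω Ω' Empty)

/-- The entry of the transcript of `M`. -/
def mainTok (c : Option α ⊕ CertSym M M') : Option M.Tok := c.getRight?.bind Sum.getLeft?

/-- The entry of the transcripts of `M'`. -/
def subTok (c : Option α ⊕ CertSym M M') : Option M'.Tok :=
  c.getRight?.bind fun d => d.getRight?.bind Sum.getLeft?

/-- The symbol of the two-track word. -/
def trackSym (c : Option α ⊕ CertSym M M') : Option (Option α × Option Γ) :=
  c.getRight?.bind fun d => d.getRight?.bind Sum.getRight?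

/-- The valid certificates. -/
def certificates (A' : Language Ω') (D : DFA (Option α × Option Γ) σ) :
    Language (Option α ⊕ CertSym M M') :=
  {w |
    (∃ q v, Exec M.CStep (.idle, []) (w.filterMap (mainTok M M')) (q, v) ∧ q = .idle) ∧
    (∃ q v, Exec M'.CStep (.idle, []) (w.filterMap (subTok M M')) (q, v) ∧ q = .idle) ∧
    (∃ q v, Exec (TrackStep D) ((D.start, false, false), []) (w.filterMap (trackSym M M')) (q, v) ∧
      q.1 ∈ D.accept) ∧
    w.filterMap Sum.getLeft? = w.filterMap (fun c => (mainTok M M' c).bind Tok.rd) ∧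
    w.filterMap (fun c => c.getLeft?.bind id) =
      w.filterMap (fun c => (trackSym M M' c).bind Prod.fst) ∧
    w.filterMap (fun c => (mainTok M M' c).bind Tok.ot) =
      w.filterMap (fun c => (trackSym M M' c).bind Prod.snd) ∧
    w.filterMap (fun c => (mainTok M M' c).bind Tok.nq) =
      w.filterMap (fun c => (subTok M M' c).bind Tok.rd) ∧
    (¬ ∃ u θ v, w.filterMap (mainTok M M') = u ++ θ :: v ∧ θ.label = some true ∧
      extract Tok.fd v ∈ M'.accepts A') ∧
    (¬ ∃ u θ v, w.filterMap (subTok M M') = u ++ θ :: v ∧ θ.label = some true ∧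
      extract Tok.fd v ∈ A'ᶜ) ∧
    (¬ ∃ u θ v, w.filterMap (subTok M M') = u ++ θ :: v ∧ θ.label = some false ∧
      extract Tok.fd v ∈ A')}

variable {M M'}

theorem recog_and_compl {β : Type} [Finite β] {A' : Language Ω'} {p q : List β → Prop}
    (hp : {w | ¬ p w} ∈ Recog A' β) (hq : {w | ¬ q w} ∈ Recog A' β) :
    {w | ¬ (p w ∧ q w)} ∈ Recog A' β := by
  convert recog_union hp hq using 1
  ext w
  exact not_and_or

theorem recog_not_not {β : Type} {A' : Language Ω'} {p : List β → Prop}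
    (hp : {w | p w} ∈ Recog A' β) : {w | ¬ ¬ p w} ∈ Recog A' β := by
  simpa only [not_not] using hp

/-- All ten ways to violate validity are recognized with the same oracle `A'`, so their union is as
well. Three are failures of deterministic devices, four are differences of subsequences, and three
are wrongly labelled queries. Among the last, only the positive label of a query of `M` requires
running `M'`. -/
theorem certificates_compl_recog [Finite α] [Finite Ω] [Finite Γ] [Finite Ω'] [Finite σ]
    {A' : Language Ω'} (D : DFA (Option α × Option Γ) σ) (hM' : M'.Terminates) :
    (certificates M M' A' D)ᶜ ∈ Recog A' (Option α ⊕ CertSym M M') := by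
  have := M.finite_stack
  have := M'.finite_stack
  refine recog_and_compl ?_ <| recog_and_compl ?_ <| recog_and_compl ?_ <| recog_and_compl ?_ <|
    recog_and_compl ?_ <| recog_and_compl ?_ <| recog_and_compl ?_ <| recog_and_compl ?_ <|
    recog_and_compl ?_ ?_
  · exact recog_comap (recog_check A' M.CStep CStep.unique .idle (fun q => q = .idle)) _
  · exact recog_comap (recog_check A' M'.CStep CStep.unique .idle (fun q => q = .idle)) _
  · refine recog_comap (recog_check A' (TrackStep D) ?_ (D.start, false, false)
      (fun q => q.1 ∈ D.accept)) _
    rintro q a s r r' ⟨-, -, -, rfl⟩ ⟨-, -, -, rfl⟩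
    rfl
  · exact recog_filterMap_ne A' _ _ (by rintro (_ | _) <;> simp [mainTok])
  · exact recog_filterMap_ne A' _ _ (by rintro (_ | _) <;> simp [trackSym])
  · exact recog_filterMap_ne A' _ _ (by rintro (_ | _ | _ | _) <;> simp [mainTok, trackSym])
  · exact recog_filterMap_ne A' _ _ (by rintro (_ | _ | _ | _) <;> simp [mainTok, subTok])
  · exact recog_not_not (recog_queries ⟨M', hM', rfl⟩ _ _)
  · exact recog_not_not (recog_queries (recog_compl_self A') _ _)
  · exact recog_not_not (recog_queries (recog_self A') _ _)

/-- Trust is established from the bottom up: the labels for `A'` are right, so the transcripts of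
`M'` describe true acceptances, so the negative labels for `A` are right; the positive ones are
tested directly. -/
theorem certificates_sound {A : Language Ω} {A' : Language Ω'} (hA : Aᶜ = M'.accepts A')
    {D : DFA (Option α × Option Γ) σ} {x : List α} {w : List (Option α ⊕ CertSym M M')}
    (hw : w ∈ certificates M M' A' D) (hx : w.filterMap Sum.getLeft? = x.map some ++ [none]) :
    ∃ y ∈ M.outcomes A x, track x y ∈ D.accepts := by
  obtain ⟨⟨_, s₁, h1, rfl⟩, ⟨_, s₂, h2, rfl⟩, ⟨q, s₃, h3, hq⟩, h4, h5, h6, h7, h8, h9, h10⟩ := hw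
  have e5 : w.filterMap (fun c => c.getLeft?.bind id) = x := by
    rw [← List.filterMap_filterMap (f := Sum.getLeft?) (g := id), hx]
    simp
  rw [← List.filterMap_filterMap, hx] at h4
  rw [e5, ← List.filterMap_filterMap] at h5
  simp only [← List.filterMap_filterMap] at h6 h7
  obtain ⟨g1, g2, -, -⟩ := TrackStep.sound h3
  rw [← h5, ← h6] at g1
  refine ⟨(w.filterMap (mainTok M M')).filterMap Tok.ot, ?_, ?_⟩
  · refine mem_outcomes_of_transcript h1 ?_ h4.symm
    have hQ : QueriesOk A' (w.filterMap (subTok M M')) := by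
      rintro u θ v (_ | _) hu hl
      · exact ⟨fun h => absurd ⟨u, θ, v, hu, hl, h⟩ h10, nofun⟩
      · exact ⟨fun _ => rfl, fun _ => by_contra fun h => h9 ⟨u, θ, v, hu, hl, h⟩⟩
    obtain ⟨ys, e1, e2⟩ := exists_words_of_transcript h2 hQ
    rw [e1] at h7
    -- Every negatively labelled query of `M` is one of the words accepted by `M'`, hence outside
    -- `A`.
    have hneg := extract_mem_of_negative (y := []) (ys := ys) h1 h7
    rintro u θ v (_ | _) hu hl
    · refine ⟨fun h => ?_, nofun⟩
      have := e2 _ (hneg.2 u θ v hu hl)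
      rw [← hA] at this
      exact absurd h this
    · refine ⟨fun _ => rfl, fun _ => by_contra fun h => h8 ⟨u, θ, v, hu, hl, ?_⟩⟩
      rw [← hA]
      exact h
  · rw [← g1, DFA.mem_accepts, DFA.eval, ← g2]
    exact hq

/-- Validity depends only on the projections of a word to the input and to the kinds of certificate
symbols, never on how these are interleaved, as the generator needs. -/
theorem certificates_complete {A : Language Ω} {A' : Language Ω'} (hA : Aᶜ = M'.accepts A')
    (hM : M.Terminates) (hM' : M'.Terminates) (D : DFA (Option α × Option Γ) σ) :
    ∃ C, ∀ x, (∃ y ∈ M.outcomes A x, track x y ∈ D.accepts) →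
      ∃ m : List (CertSym M M'), m.length ≤ C * (x.length + 1) ∧
        ∀ w : List (Option α ⊕ CertSym M M'), w.filterMap Sum.getLeft? = x.map some ++ [none] →
          w.filterMap Sum.getRight? = m → w ∈ certificates M M' A' D := by
  obtain ⟨a, b, hab⟩ := hM
  obtain ⟨a', b', hab'⟩ := hM'
  -- The transcript of `M` has length at most `(a + b + 5) * (x.length + 1)`. The words read by `M'`
  -- and the output are no longer than it; this gives the factors `a' + b' + 4` for the transcripts
  -- of `M'` and `2` for the main transcript and the output. The final `1` is for the upper track.
  refine ⟨(a' + b' + 4 + 2) * (a + b + 5) + 1, ?_⟩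
  rintro x ⟨y, ⟨t, c, hr, hc, rfl⟩, hy⟩
  obtain ⟨-, T₁, -, g2, g3, g4, g5, ⟨ys, g6, g7⟩, g8⟩ := exists_transcript hr hc
  obtain ⟨T₂, k1, k2, k3, k4⟩ := exists_transcript_of_words (M := M') (A := A')
    (fun x t c h => (hab' A' x t c h).1) (xs := ys) (fun y hy => by rw [← hA]; exact g6 y hy)
  have ht := (hab A x t c hr).1
  refine ⟨T₁.map .inl ++ (T₂.map (.inr ∘ .inl) ++ (track x c.output).map (.inr ∘ .inr)), ?_, ?_⟩
  · have h1 : (encWords ys).length ≤ T₁.length := by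
      rw [← g7]
      exact List.length_filterMap_le _ _
    have h2 : c.output.length ≤ T₁.length := by
      rw [← g5]
      exact List.length_filterMap_le _ _
    have h3 := track_length_le x c.output
    have h4 : T₁.length ≤ (a + b + 5) * (x.length + 1) := by
      refine g8.trans ?_
      nlinarith [Nat.zero_le (b * x.length), Nat.zero_le x.length]
    have h5 : T₂.length ≤ (a' + b' + 4) * T₁.length := k4.trans (Nat.mul_le_mul_left _ h1)
    simp only [List.length_append, List.length_map]
    calc _ ≤ T₁.length + ((a' + b' + 4) * T₁.length + (x.length + T₁.length)) := by omega
      _ = (a' + b' + 4 + 2) * T₁.length + x.length := by ring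
      _ ≤ (a' + b' + 4 + 2) * ((a + b + 5) * (x.length + 1)) + (x.length + 1) := by gcongr; omega
      _ = _ := by ring
  · intro w hl hr
    have e0 : w.filterMap (fun c => c.getLeft?.bind id) = x := by
      rw [← List.filterMap_filterMap (f := Sum.getLeft?) (g := id), hl]
      simp
    have e1 : w.filterMap (mainTok M M') = T₁ := by
      unfold mainTok
      rw [← List.filterMap_filterMap (f := Sum.getRight?) (g := Sum.getLeft?), hr]
      simp [List.filterMap_append, List.filterMap_map, Function.comp_def]
    have e2 : w.filterMap (subTok M M') = T₂ := by
      unfold subTok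
      rw [← List.filterMap_filterMap (f := Sum.getRight?)
        (g := fun d : CertSym M M' => d.getRight?.bind Sum.getLeft?), hr]
      simp [List.filterMap_append, List.filterMap_map, Function.comp_def]
    have e3 : w.filterMap (trackSym M M') = track x c.output := by
      unfold trackSym
      rw [← List.filterMap_filterMap (f := Sum.getRight?)
        (g := fun d : CertSym M M' => d.getRight?.bind Sum.getRight?), hr]
      simp [List.filterMap_append, List.filterMap_map, Function.comp_def]
    have hb : ∀ {X Y Z : Type} (f : X → Option Y) (g : Y → Option Z) (w : List X),
        w.filterMap (fun c => (f c).bind g) = (w.filterMap f).filterMap g :=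
      fun f g w => List.filterMap_filterMap.symm
    refine ⟨?_, ?_, ?_, ?_, ?_, ?_, ?_, ?_, ?_, ?_⟩
    · rw [e1]
      obtain ⟨s, hs⟩ := g2 []
      exact ⟨_, s, hs, rfl⟩
    · rw [e2]
      obtain ⟨s, hs⟩ := k1 []
      exact ⟨_, s, hs, rfl⟩
    · rw [e3]
      obtain ⟨f, g, h⟩ := TrackStep.complete D D.start false false x c.output (by simp) (by simp)
      exact ⟨_, _, h, hy⟩
    · rw [hb, e1, g4, hl]
    · rw [e0, hb, e3, track_filterMap_fst]
    · rw [hb, hb, e1, e3, g5, track_filterMap_snd]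
    · rw [hb, hb, e1, e2, g7, k3]
    · rw [e1]
      rintro ⟨u, θ, v, h1, h2, h3⟩
      rw [← hA] at h3
      exact h3 ((g3 u θ v true h1 h2).2 rfl)
    · rw [e2]
      rintro ⟨u, θ, v, h1, h2, h3⟩
      exact h3 ((k2 u θ v true h1 h2).2 rfl)
    · rw [e2]
      rintro ⟨u, θ, v, h1, h2, h3⟩
      simpa using (k2 u θ v false h1 h2).1 h3

/-- The languages that are reduced to a regular language by a function computed with an oracle
whose complement is recognized with oracle `A'`. -/
theorem recog_advice [Finite α] [Finite Ω] [Finite Γ] [Finite Ω'] {A : Language Ω}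
    {A' : Language Ω'} (hA : Aᶜ ∈ Recog A' Ω) (hM : M.Terminates)
    {B : Language (Option α × Option Γ)} (hB : B.IsRegular) :
    ∃ (Θ : Type) (_ : Finite Θ) (E : Language Θ), Eᶜ ∈ Recog A' Θ ∧
      {x | ∃ y ∈ M.outcomes A x, track x y ∈ B} ∈ Recog E α := by
  obtain ⟨M', hM', hA⟩ := hA
  obtain ⟨σ, _, D, rfl⟩ := hB
  obtain ⟨C, hC⟩ := certificates_complete hA hM hM' D
  exact ⟨_, inferInstance, _, certificates_compl_recog (M := M) D hM',
    recog_of_certificates C (fun x w hw hx => certificates_sound hA hw hx) hC⟩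

end Advice

/-! ### Merging several oracles of one level into one -/

section Join

variable {ι : Type} {Ω : ι → Type}

/-- The word `w` over the alphabet number `i`, preceded by the tag `i`. -/
def tagged (i : ι) (w : List (Ω i)) : List (ι ⊕ Σ i, Ω i) :=
  .inl i :: w.map fun a => .inr ⟨i, a⟩

/-- A symbol of the grammar number `i` as a symbol of the joined grammar. -/
def liftSymbol {N : ι → Type} (i : ι) :
    Symbol (Ω i) (N i) → Symbol (ι ⊕ Σ i, Ω i) (Option (Σ i, N i))
  | .terminal a => .terminal (.inr ⟨i, a⟩)
  | .nonterminal n => .nonterminal (some ⟨i, n⟩)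

theorem liftSymbol_injective {N : ι → Type} (i : ι) :
    Function.Injective (liftSymbol (Ω := Ω) (N := N) i) := by
  rintro (a | a) (b | b) h <;> simp_all [liftSymbol]

/-- The rules of the joined grammar. -/
inductive JoinRule (g : ∀ i, ContextFreeGrammar (Ω i)) :
    ContextFreeRule (ι ⊕ Σ i, Ω i) (Option (Σ i, (g i).NT)) → Prop
  | start (i : ι) :
      JoinRule g ⟨none, [.terminal (.inl i), .nonterminal (some ⟨i, (g i).initial⟩)]⟩
  | lift (i : ι) (r : ContextFreeRule (Ω i) (g i).NT) (h : r ∈ (g i).rules) :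
      JoinRule g ⟨some ⟨i, r.input⟩, r.output.map (liftSymbol i)⟩

theorem finite_joinRule [Finite ι] (g : ∀ i, ContextFreeGrammar (Ω i)) :
    {r | JoinRule g r}.Finite := by
  refine ((Set.finite_range fun i => ⟨none, [.terminal (.inl i),
    .nonterminal (some ⟨i, (g i).initial⟩)]⟩).union (Set.finite_range
    fun p : Σ i, (g i).rules => ⟨some ⟨p.1, p.2.1.input⟩, p.2.1.output.map (liftSymbol p.1)⟩)).subset
    ?_
  rintro r (i | ⟨i, r, h⟩)
  · exact .inl ⟨i, rfl⟩
  · exact .inr ⟨⟨i, r, h⟩, rfl⟩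

/-- A grammar that generates the tagged words of all the given grammars. -/
noncomputable abbrev joinGrammar [Finite ι] (g : ∀ i, ContextFreeGrammar (Ω i)) :
    ContextFreeGrammar (ι ⊕ Σ i, Ω i) where
  NT := Option (Σ i, (g i).NT)
  initial := none
  rules := (finite_joinRule g).toFinset

/-- The leading tag is a terminal and stays, and the nonterminals of the grammar number `i` are
rewritten only by lifted rules of that grammar. -/
theorem joinGrammar_produces [Finite ι] {g : ∀ i, ContextFreeGrammar (Ω i)} {i : ι}
    {u : List (Symbol (Ω i) (g i).NT)} {v : List (Symbol (ι ⊕ Σ i, Ω i) (Option (Σ i, (g i).NT)))} :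
    (joinGrammar g).Produces (.terminal (.inl i) :: u.map (liftSymbol i)) v ↔
      ∃ u', v = .terminal (.inl i) :: u'.map (liftSymbol i) ∧ (g i).Produces u u' := by
  constructor
  · rintro ⟨r, hr, hv⟩
    replace hr : JoinRule g r := (finite_joinRule g).mem_toFinset.1 hr
    obtain ⟨p, q, h1, rfl⟩ := hv.exists_parts
    rcases p with _ | ⟨s, p⟩
    · simp at h1
    simp only [List.cons_append, List.cons.injEq] at h1
    obtain ⟨rfl, h1⟩ := h1
    obtain ⟨u₁, q', rfl, h2, rfl⟩ := List.map_eq_append_iff.1 h1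
    obtain ⟨p', n, rfl, rfl, h3⟩ := List.map_eq_append_iff.1 h2
    clear h1 h2
    obtain ⟨s, rfl, h1⟩ := List.map_eq_singleton_iff.1 h3
    rcases s with a | n
    · simp [liftSymbol] at h1
    cases hr with
    | start j => simp [liftSymbol] at h1
    | lift j r h =>
      simp only [liftSymbol, Symbol.nonterminal.injEq, Option.some.injEq, Sigma.mk.injEq] at h1
      obtain ⟨rfl, h1⟩ := h1
      obtain rfl := eq_of_heq h1
      exact ⟨p' ++ r.output ++ q', by simp, r, h, r.rewrites_of_exists_parts p' q'⟩
  · rintro ⟨u', rfl, r, hr, hu⟩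
    obtain ⟨p, q, rfl, rfl⟩ := hu.exists_parts
    refine ⟨_, (finite_joinRule g).mem_toFinset.2 (.lift i r hr), ?_⟩
    have := ContextFreeRule.rewrites_of_exists_parts
      (⟨some ⟨i, r.input⟩, r.output.map (liftSymbol i)⟩ :
        ContextFreeRule (ι ⊕ Σ i, Ω i) (Option (Σ i, (g i).NT)))
      (.terminal (.inl i) :: p.map (liftSymbol i)) (q.map (liftSymbol i))
    rw [List.map_append, List.map_append]
    simpa [liftSymbol] using this

theorem joinGrammar_derives [Finite ι] {g : ∀ i, ContextFreeGrammar (Ω i)} {i : ι}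
    {u : List (Symbol (Ω i) (g i).NT)} {v : List (Symbol (ι ⊕ Σ i, Ω i) (Option (Σ i, (g i).NT)))} :
    (joinGrammar g).Derives (.terminal (.inl i) :: u.map (liftSymbol i)) v ↔
      ∃ u', v = .terminal (.inl i) :: u'.map (liftSymbol i) ∧ (g i).Derives u u' := by
  constructor
  · intro h
    induction h with
    | refl => exact ⟨u, rfl, .refl _⟩
    | tail _ h ih =>
      obtain ⟨u', rfl, hu⟩ := ih
      obtain ⟨u'', rfl, hu'⟩ := joinGrammar_produces.1 h
      exact ⟨u'', rfl, hu.tail hu'⟩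
  · rintro ⟨u', rfl, h⟩
    induction h with
    | refl => exact .refl _
    | tail _ h ih => exact ih.tail (joinGrammar_produces.2 ⟨_, rfl, h⟩)

/-- The first step from the new initial symbol fixes a tag for good, so a word tagged `i` can come
only from the grammar number `i`. -/
theorem tagged_mem_joinGrammar_language [Finite ι] {g : ∀ i, ContextFreeGrammar (Ω i)} {i : ι}
    {w : List (Ω i)} : tagged i w ∈ (joinGrammar g).language ↔ w ∈ (g i).language := by
  have hw : (tagged i w).map (Symbol.terminal (N := (joinGrammar g).NT)) =
      .terminal (.inl i) :: (w.map .terminal).map (liftSymbol (N := fun i => (g i).NT) i) := by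
    simp [tagged, liftSymbol, Function.comp_def]
  rw [ContextFreeGrammar.mem_language_iff, ContextFreeGrammar.mem_language_iff, hw]
  constructor
  · intro h
    rcases h.cases_head with h | ⟨v, ⟨r, hr, hv⟩, h⟩
    · simp at h
    replace hr : JoinRule g r := (finite_joinRule g).mem_toFinset.1 hr
    obtain ⟨p, q, h1, rfl⟩ := hv.exists_parts
    have hp : p = [] ∧ q = [] ∧ r.input = none := by
      rcases p with _ | ⟨s, p⟩
      · simp at h1
        exact ⟨rfl, h1.2, h1.1.symm⟩
      · simp at h1
    obtain ⟨rfl, rfl, h2⟩ := hp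
    cases hr with
    | lift => simp at h2
    | start j =>
      obtain ⟨u', h3, h4⟩ := (joinGrammar_derives (g := g) (i := j)
        (u := [.nonterminal (g j).initial])).1 (by simpa [liftSymbol] using h)
      simp only [List.cons.injEq, Symbol.terminal.injEq, Sum.inl.injEq] at h3
      obtain ⟨rfl, h3⟩ := h3
      rw [← List.map_map] at h3
      rwa [(liftSymbol_injective i).list_map h3]
  · intro h
    refine .head ⟨_, (finite_joinRule g).mem_toFinset.2 (.start i), .head []⟩ ?_
    exact (joinGrammar_derives (g := g) (u := [.nonterminal (g i).initial])).2 ⟨_, rfl, h⟩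

/-- A bundle that executes the machine `i` on the words with tag `i`. -/
noncomputable abbrev joinBundle {Ω' : ι → Type} (M : ∀ i, OracleNPDA (Ω i) (Ω' i) Empty) :
    Bundle ι Ω Ω' (ι ⊕ Σ i, Ω i) (ι ⊕ Σ i, Ω' i) Empty where
  M := M
  launch i b := b = some (.inl i)
  feed i b := open Classical in b.getRight?.bind fun a =>
    if h : a.1 = i then some (some (h ▸ a.2)) else none
  tag i := some (.inl i)
  emb i a := .inr ⟨i, a⟩
  out _ := none

/-- A tagged word has its only tag in front, so nothing but the machine `i` can be launched, and it
sees all of `w`. Its queries are tagged in turn, so the joined oracle answers them as `A i` would.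
-/
theorem tagged_mem_joinBundle [Finite ι] [∀ i, Finite (Ω i)] {Ω' : ι → Type}
    {M : ∀ i, OracleNPDA (Ω i) (Ω' i) Empty} (hM : ∀ i, (M i).Terminates)
    {A : ∀ i, Language (Ω' i)} {A' : Language (ι ⊕ Σ i, Ω' i)}
    (hA : ∀ i w, tagged i w ∈ A' ↔ w ∈ A i) {i : ι} {w : List (Ω i)} :
    tagged i w ∈ (joinBundle M).machine.accepts A' ↔ w ∈ (M i).accepts (A i) := by
  have ho : ∀ j, (joinBundle M).oracle A' j = A j := fun j => Set.ext fun w => hA j w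
  have he : ∀ w : List (Ω i),
      extract ((joinBundle M).feed i) (w.map fun a => .inr ⟨i, a⟩) = w := by
    intro w
    induction w with
    | nil => rfl
    | cons a w ih => simpa [extract] using ih
  rw [Bundle.mem_accepts_machine hM]
  constructor
  · rintro ⟨j, r, hl, h⟩
    rw [ho] at h
    rcases hl with ⟨hl, -⟩ | ⟨u, b, hu, hl⟩
    · simp at hl
    · obtain rfl : b = .inl j := by simpa using hl
      rcases u with _ | ⟨c, u⟩
      · simp only [tagged, List.nil_append, List.cons.injEq, Sum.inl.injEq] at hu
        obtain ⟨rfl, rfl⟩ := hu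
        rwa [he] at h
      · have : Sum.inl j ∈ w.map fun a => (Sum.inr ⟨i, a⟩ : ι ⊕ Σ i, Ω i) := by
          simp only [tagged, List.cons_append, List.cons.injEq] at hu
          rw [hu.2]
          simp
        simp at this
  · intro h
    refine ⟨i, w.map fun a => .inr ⟨i, a⟩, .inr ⟨[], .inl i, rfl, rfl⟩, ?_⟩
    rwa [ho, he]

/-- The classes of the hierarchy are closed under tagged joins. -/
theorem exists_join [Finite ι] (k : ℕ) {Ω : ι → Type} [∀ i, Finite (Ω i)]
    (A : ∀ i, Language (Ω i)) (hA : ∀ i, A i ∈ PiCFL (k + 1) (Ω i)) :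
    ∃ A' ∈ PiCFL (k + 1) (ι ⊕ Σ i, Ω i), ∀ i w, tagged i w ∈ A' ↔ w ∈ A i := by
  induction k generalizing Ω with
  | zero =>
    -- At the lowest level the complements of the `A i` are context-free; their grammars are joined.
    choose g hg using hA
    refine ⟨(joinGrammar g).languageᶜ, ⟨joinGrammar g, (compl_compl _).symm⟩, fun i w => ?_⟩
    exact (not_congr (tagged_mem_joinGrammar_language.trans (by rw [hg]; rfl))).trans
      (not_not (a := w ∈ A i))
  | succ k ih =>
    choose Ω' hΩ' A' hA' M hM hAM using hA
    -- The oracles used for the complements of the `A i` are joined first; the machines are bundled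
    -- over that single oracle.
    obtain ⟨A'', h, hA''⟩ := ih A' hA'
    refine ⟨((joinBundle M).machine.accepts A'')ᶜ, ⟨_, inferInstance, A'', h,
      (joinBundle M).machine, (Bundle.machine_terminates hM).2, compl_compl _⟩, fun i w => ?_⟩
    exact (not_congr ((tagged_mem_joinBundle hM hA'').trans (by rw [← hAM]; rfl))).trans
      (not_not (a := w ∈ A i))

end Join

/-! ### The two inclusions -/

section Main

/-- A bundle that executes one of two machines on the input and outputs its number. -/
abbrev decisionBundle {α : Type} {Ω : Bool → Type} (M : ∀ i, OracleNPDA α (Ω i) Empty) :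
    Bundle Bool (fun _ => α) Ω α (Bool ⊕ Σ i, Ω i) Bool where
  M := M
  launch _ b := b = none
  feed _ a := some (some a)
  tag i := some (.inl i)
  emb i a := .inr ⟨i, a⟩
  out := some

theorem mem_outcomes_decisionBundle {α : Type} [Finite α] {Ω : Bool → Type}
    {M : ∀ i, OracleNPDA α (Ω i) Empty} (hM : ∀ i, (M i).Terminates)
    {A : ∀ i, Language (Ω i)} {A' : Language (Bool ⊕ Σ i, Ω i)}
    (hA : ∀ i w, tagged i w ∈ A' ↔ w ∈ A i) {x : List α} {z : List Bool} :
    z ∈ (decisionBundle M).machine.outcomes A' x ↔ ∃ i, x ∈ (M i).accepts (A i) ∧ z = [i] := by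
  have ho : ∀ j, (decisionBundle M).oracle A' j = A j := fun j => Set.ext fun w => hA j w
  have he : ∀ w : List α, extract (fun a => some (some a)) w = w := by
    intro w
    induction w with
    | nil => rfl
    | cons a w ih => simp [extract, ih]
  rw [Bundle.mem_outcomes_machine hM]
  simp [Bundle.Launches, ho, he]

/-- The two-track words with lower track beginning with `true` form a regular language. -/
theorem isRegular_lower_head_true (α : Type) :
    Language.IsRegular {w : List (Option α × Option Bool) | ∃ a v, w = (a, some true) :: v} := by
  classical
  refine ⟨Option Bool, inferInstance, ⟨fun s a => some (s.getD (decide (a.2 = some true))), none,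
    {some true}⟩, ?_⟩
  ext w
  have h : ∀ (b : Bool) (w : List (Option α × Option Bool)),
      w.foldl (fun s a => some (s.getD (decide (a.2 = some true)))) (some b) = some b := by
    intro b w
    induction w with
    | nil => rfl
    | cons a w ih => simpa using ih
  rw [DFA.mem_accepts]
  change _ ↔ ∃ a v, w = (a, some true) :: v
  rcases w with _ | ⟨⟨a, c⟩, w⟩
  · simp [DFA.eval, DFA.evalFrom]
  · simp [DFA.eval, DFA.evalFrom, h]

/-- A nonempty lower track of a two-track word begins at its first symbol. -/
theorem track_singleton {α Γ : Type} (x : List α) (c : Γ) :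
    ∃ a v, track x [c] = (a, some c) :: v := by
  cases x <;> simp [track, List.zipWithAll]

theorem mainTheorem4 (k : ℕ) (hk : 3 ≤ k) (α : Type) [Finite α] :
    SigmaCFL k α ∩ PiCFL k α = RegAdvice (SigmaCFLSVt k) α := by
  obtain ⟨k, rfl⟩ := Nat.exists_eq_add_of_le' hk
  ext L
  constructor
  · rintro ⟨h₁, h₂⟩
    -- The language for `i = true` is `L`, the one for `i = false` its complement: exactly one of
    -- them contains a given input.
    have h : ∀ i : Bool, {x | i = true ↔ x ∈ L} ∈ SigmaCFL (k + 3) α := by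
      rintro (_ | _)
      · have e : {x | false = true ↔ x ∈ L} = Lᶜ := by
          ext x
          change (false = true ↔ x ∈ L) ↔ ¬ x ∈ L
          simp
        rwa [e]
      · have e : {x | true = true ↔ x ∈ L} = L := by
          ext x
          change (true = true ↔ x ∈ L) ↔ x ∈ L
          simp
        rwa [e]
    choose Ω hΩ A hA M hM hL using h
    obtain ⟨A', hA', hj⟩ := exists_join (k + 1) A hA
    have ho : ∀ x z, z ∈ (decisionBundle M).machine.outcomes A' x ↔
        ∃ i, (i = true ↔ x ∈ L) ∧ z = [i] := by
      intro x z
      rw [mem_outcomes_decisionBundle hM hj]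
      refine exists_congr fun i => and_congr_left fun _ => ?_
      rw [← hL]
      rfl
    refine ⟨Bool, inferInstance, _, (decisionBundle M).machine.outcomes A',
      isRegular_lower_head_true α, ⟨⟨⟨_, inferInstance, A', hA', (decisionBundle M).machine,
        (Bundle.machine_terminates hM).2, fun _ => rfl⟩, ?_⟩, ?_⟩, ?_⟩
    · intro x z hz z' hz'
      obtain ⟨i, hi, rfl⟩ := (ho x z).1 hz
      obtain ⟨j, hj, rfl⟩ := (ho x z').1 hz'
      rw [Bool.eq_iff_iff.2 (hi.trans hj.symm)]
    · intro x
      classical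
      exact ⟨_, (ho x _).2 ⟨decide (x ∈ L), by simp, rfl⟩⟩
    · ext x
      change x ∈ L ↔ ∃ y ∈ _, ∃ a v, track x y = (a, some true) :: v
      constructor
      · exact fun hx => ⟨[true], (ho x _).2 ⟨true, by simp [hx], rfl⟩, track_singleton x true⟩
      · rintro ⟨y, hy, a, v, h⟩
        obtain ⟨i, hi, rfl⟩ := (ho x y).1 hy
        obtain ⟨a', v', h'⟩ := track_singleton x i
        rw [h'] at h
        simp only [List.cons.injEq, Prod.mk.injEq, Option.some.injEq] at h
        exact hi.1 h.1.2
  -- The assumption on the level enters here: the oracle `A` has level `k + 2 ≥ 2`, so its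
  -- complement is recognized by an oracle machine, with an oracle `A'` one level lower.
  · rintro ⟨Γ, _, B, f, hB, ⟨⟨⟨Ω, _, A, ⟨Ω', _, A', hA', hA⟩, M, hM, hf⟩, hs⟩, ht⟩, rfl⟩
    have key : ∀ B : Language (Option α × Option Γ), B.IsRegular →
        {x | ∃ y ∈ f x, track x y ∈ B} ∈ SigmaCFL (k + 3) α := by
      intro B hB
      obtain ⟨Θ, _, E, hE, h⟩ := recog_advice hA hM hB
      simp only [hf]
      exact ⟨Θ, inferInstance, E, ⟨Ω', inferInstance, A', hA', hE⟩, h⟩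
    refine ⟨key B hB, ?_⟩
    -- As `f x` has exactly one element, the complement is obtained by complementing the regular
    -- language, and `key` applies once more.
    suffices e : ({x | ∃ y ∈ f x, track x y ∈ B} : Language α)ᶜ =
        {x | ∃ y ∈ f x, track x y ∈ Bᶜ} by
      change ({x | ∃ y ∈ f x, track x y ∈ B} : Language α)ᶜ ∈ SigmaCFL (k + 3) α
      exact e ▸ key Bᶜ hB.compl
    ext x
    obtain ⟨y, hy⟩ := ht x
    change (¬ ∃ y ∈ f x, track x y ∈ B) ↔ ∃ y ∈ f x, track x y ∉ B
    refine ⟨fun h => ⟨y, hy, fun hb => h ⟨y, hy, hb⟩⟩, ?_⟩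
    rintro ⟨y', hy', h⟩ ⟨y'', hy'', h'⟩
    rw [hs x hy' hy''] at h
    exact h h'

end Main
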